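/- Let $\mathcal R=\bigoplus_{k\ge 0}\mathcal M_k(SL(2,\mathbb Z))=\mathbb C[a,b]$, where $a=-\tfrac13E_4=-\tfrac13\bigl(1+240\sum_{n\ge1}\sigma_3(n)q^n\bigr)$ and $b=\tfrac2{27}E_6=\tfrac2{27}\bigl(1-504\sum_{n\ge1}\sigma_5(n)q^n\bigr)$ are algebraically independent over $\mathbb C$. Let $N$ be a prime, and let $T_N$ be the Hecke operator, given on forms $f$ of weight $k$ for $SL(2,\mathbb Z)$ by $$T_Nf(\tau)=\frac1N\Bigl(N^kf(N\tau)+\sum_{t=0}^{N-1}f\bigl(\tfrac{\tau+t}N\bigr)\Bigr).$$ Let $F_N(a,b,A,B)=\sum_{i,j\ge0}A^iB^j\,T_N(a^ib^j)\in\mathbb C[a,b][[A,B]]$, where each $T_N(a^ib^j)$ is written (uniquely) as a polynomial in $a,b$. **Theorem 4.3.** $F_N$ is a rational function in $\mathbb Q(a,b,A,B)$: there are $P,Q\in\mathbb Q[a,b,A,B]$ with $Q\ne0$ and $QF_N=P$. Moreover $F_N$ is given explicitly as follows. Let $\mathcal K$ and $\mathcal K_{\Gamma_\pm(N)}$ be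 the fields of fractions of $\mathcal R$ and of the ring $\mathcal R_{\Gamma_\pm(N)}$ of modular forms of all weights for $\Gamma_\pm(N)=\{\pm I\}\cdot\Gamma_1(N)$. Put $a'(\tau)=N^4a(N\tau)$, $b'(\tau)=N^6b(N\tau)$ and $x_P(\tau)=-\pi^{-2}\wp(1/N;\mathbb Z+\mathbb Z\tau)$. Then $a',b',x_P\in\mathcal R_{\Gamma_\pm(N)}$, the powers $1,x_P,\dots,x_P^{d-1}$ form a basis of $\mathcal K_{\Gamma_\pm(N)}$ over $\mathcal K$, where $d=3$ if $N=2$ and $d=(N^2-1)/2$ if $N$ is odd, and, if $\rho$ denotes the regular representation of $\mathcal K_{\Gamma_\pm(N)}$ over $\mathcal K$ in this basis, $$F_N=\frac{c_N}{N}\,\operatorname{tr}\Bigl[\bigl(I-A\rho(a')\bigr)\bigl(I-B\rho(b')\bigr)\Bigr]^{-1},\qquad c_2=1,\quad c_N=\frac2{N-1}\ (N\text{ odd}),$$ as power series in $A,B$ over $\mathcal K$. The matrices $\rho(x_P),\rho(a'),\rho(b')$ have the following explicit entries in $\mathbb Q(a,b)$. For the curve $y^2=x^3+ax+b$ let $\psi_\ell$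 be the division polynomials and $\varphi_\ell=x\psi_\ell^2-\psi_{\ell+1}\psi_{\ell-1}$, with $\psi_\ell^2$ and $\varphi_\ell$ regarded as polynomials in $x$. - If $N=2$, then $\rho(x_P)$ is the companion matrix of $x^3+ax+b$, and $\rho(a')=-4a-15\rho(x_P)^2$, $\rho(b')=22b+14a\,\rho(x_P)$. - If $N$ is odd, then $\rho(x_P)$ is the companion matrix of $\psi_N$ divided by its leading coefficient $N$, and with $X_\ell=\varphi_\ell(\rho(x_P))\,\psi_\ell^2(\rho(x_P))^{-1}$ and $S=\{1,\dots,(N-1)/2\}$, $$\rho(a')=a-30\sum_{\ell\in S}X_\ell^2-5(N-1)a,\qquad \rho(b')=b-70\sum_{\ell\in S}X_\ell^3-42a\sum_{\ell\in S}X_\ell-14(N-1)b.$$ -/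

import Mathlib

open UpperHalfPlane ModularForm CongruenceSubgroup
open scoped MatrixGroups Manifold

noncomputable section

namespace HeckeGF

/-! ### Rings of modular forms and their fields of fractions -/

/-- The map from the graded ring `⨁ₖ Mₖ(Γ)` to functions on the upper half plane, sending a sum of
modular forms of various weights to the corresponding sum of functions. -/
def gradedToFun (Γ : Subgroup (GL (Fin 2) ℝ)) [Γ.HasDetOne] :
    (DirectSum ℤ fun k => ModularForm Γ k) →ₐ[ℂ] (ℍ → ℂ) :=
  DirectSum.toAlgebra ℂ (fun k => ModularForm Γ k)
    (fun _ =>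
      { toFun := fun f => (f : ℍ → ℂ)
        map_add' := fun _ _ => rfl
        map_smul' := fun _ _ => rfl })
    rfl (fun _ _ => rfl)

/-- The ring `ℛ_Γ` of all modular forms for `Γ`, viewed as holomorphic functions on the upper half
plane: finite sums of modular forms of arbitrary weights. (Nonzero forms of distinct weights are
linearly independent, and there are none of negative weight for the groups used below, so this is
the direct sum of the `Mₖ(Γ)`, `k ≥ 0`.) -/
def modularRing (Γ : Subgroup (GL (Fin 2) ℝ)) [Γ.HasDetOne] : Subalgebra ℂ (ℍ → ℂ) :=
  (gradedToFun Γ).range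

variable {Γ Γ' : Subgroup (GL (Fin 2) ℝ)} [Γ.HasDetOne] [Γ'.HasDetOne]

theorem gradedToFun_of {k : ℤ} (f : ModularForm Γ k) :
    gradedToFun Γ (DirectSum.of (fun k => ModularForm Γ k) k f) = (f : ℍ → ℂ) :=
  DirectSum.toAddMonoid_of (β := fun k => ModularForm Γ k)
    (fun k => (⟨⟨fun f : ModularForm Γ k => (f : ℍ → ℂ), rfl⟩, fun _ _ => rfl⟩ :
      ModularForm Γ k →+ (ℍ → ℂ))) k f

theorem coe_mem_modularRing {k : ℤ} (f : ModularForm Γ k) : (f : ℍ → ℂ) ∈ modularRing Γ :=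
  ⟨DirectSum.of (fun k => ModularForm Γ k) k f, gradedToFun_of f⟩

theorem mdifferentiable_of_mem {f : ℍ → ℂ} (hf : f ∈ modularRing Γ) : MDiff f := by
  obtain ⟨x, rfl⟩ := hf
  change MDiff (gradedToFun Γ x)
  induction x using DirectSum.induction_on with
  | zero => rw [map_zero]; exact mdifferentiable_const
  | of k f => rw [gradedToFun_of]; exact f.holo'
  | add x y hx hy => rw [map_add]; exact hx.add hy

instance instIsDomainModularRing : IsDomain (modularRing Γ) :=
  have : NoZeroDivisors (modularRing Γ) :=
    ⟨fun {f g} h => by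
      have h' : (f : ℍ → ℂ) * (g : ℍ → ℂ) = 0 := congrArg Subtype.val h
      rcases (UpperHalfPlane.mul_eq_zero_iff (mdifferentiable_of_mem f.2)
        (mdifferentiable_of_mem g.2)).1 h' with h | h
      · exact Or.inl (Subtype.ext h)
      · exact Or.inr (Subtype.ext h)⟩
  NoZeroDivisors.to_isDomain _

theorem modularRing_mono (h : Γ ≤ Γ') : modularRing Γ' ≤ modularRing Γ := by
  rintro _ ⟨x, rfl⟩
  change gradedToFun Γ' x ∈ modularRing Γ
  induction x using DirectSum.induction_on with
  | zero => rw [map_zero]; exact zero_mem _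
  | of k f =>
    rw [gradedToFun_of]
    exact coe_mem_modularRing (Γ := Γ) (k := k)
      { toFun := f
        slash_action_eq' := fun g hg => f.slash_action_eq' g (h hg)
        holo' := f.holo'
        bdd_at_cusps' := fun hc => f.bdd_at_cusps' (hc.mono h) }
  | add x y hx hy => rw [map_add]; exact add_mem hx hy

variable (Γ) in
/-- The field of fractions `𝒦_Γ` of the integral domain `ℛ_Γ`. -/
def modularField : Type := FractionRing (modularRing Γ)

instance instFieldModularField : Field (modularField Γ) :=
  inferInstanceAs (Field (FractionRing (modularRing Γ)))

instance instAlgebraModularField : Algebra (modularRing Γ) (modularField Γ) :=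
  inferInstanceAs (Algebra (modularRing Γ) (FractionRing (modularRing Γ)))

instance instIsFractionRingModularField : IsFractionRing (modularRing Γ) (modularField Γ) :=
  inferInstanceAs (IsFractionRing (modularRing Γ) (FractionRing (modularRing Γ)))

/-- The group `Γ_±(N) = {±1} · Γ₁(N)`. -/
def GammaPM (N : ℕ) : Subgroup SL(2, ℤ) := Gamma1 N ⊔ Subgroup.zpowers (-1)

theorem GammaPM_le (N : ℕ) : (GammaPM N : Subgroup (GL (Fin 2) ℝ)) ≤ 𝒮ℒ := by
  rintro _ ⟨g, _, rfl⟩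
  exact ⟨g, rfl⟩

/-- The ring `ℛ = ℛ_{Γ(1)}`. -/
abbrev R₁ : Subalgebra ℂ (ℍ → ℂ) := modularRing 𝒮ℒ

/-- The ring `ℛ_{Γ_±(N)}`. -/
abbrev RPM (N : ℕ) : Subalgebra ℂ (ℍ → ℂ) := modularRing (GammaPM N : Subgroup (GL (Fin 2) ℝ))

/-- The field `𝒦 = 𝒦_{Γ(1)}`. -/
abbrev K₁ : Type := modularField 𝒮ℒ

/-- The field `𝒦_{Γ_±(N)}`. -/
abbrev KPM (N : ℕ) : Type := modularField (GammaPM N : Subgroup (GL (Fin 2) ℝ))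

/-- `𝒦_{Γ_±(N)}` is a `𝒦`-algebra through the inclusion of `ℛ` in `ℛ_{Γ_±(N)}`. -/
instance instAlgebraKPM (N : ℕ) : Algebra K₁ (KPM N) :=
  (IsFractionRing.map (A := R₁) (B := RPM N) (K := K₁) (L := KPM N)
    (j := (Subalgebra.inclusion (modularRing_mono (GammaPM_le N))).toRingHom)
    (Subalgebra.inclusion_injective (modularRing_mono (GammaPM_le N)))).toAlgebra

/-! ### The modular forms `a`, `b`, and the Hecke operator -/

/-- `a = -(1/3) (1 + 240 ∑ σ₃(n) qⁿ)`. -/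
def aForm : ModularForm 𝒮ℒ 4 := (-(1 / 3) : ℂ) • E₄

/-- `b = (2/27) (1 - 504 ∑ σ₅(n) qⁿ)`. -/
def bForm : ModularForm 𝒮ℒ 6 := (2 / 27 : ℂ) • E₆

/-- `a` as an element of `ℛ`. -/
def aR : R₁ := ⟨aForm, coe_mem_modularRing aForm⟩

/-- `b` as an element of `ℛ`. -/
def bR : R₁ := ⟨bForm, coe_mem_modularRing bForm⟩

/-- The function `f'(τ) = Nᵏ f(Nτ)`. -/
def primed (N k : ℕ) (f : ℍ → ℂ) (τ : ℍ) : ℂ :=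
  (N : ℂ) ^ k * f (ofComplex (N * (τ : ℂ)))

/-- The Hecke operator `T_N` (`N` prime) on level one forms of weight `k`:
`T_N f(τ) = N⁻¹ (Nᵏ f(Nτ) + ∑_{0 ≤ t < N} f((τ + t) / N))`. -/
def hecke (N k : ℕ) (f : ℍ → ℂ) (τ : ℍ) : ℂ :=
  1 / (N : ℂ) * (primed N k f τ + ∑ t ∈ Finset.range N, f (ofComplex (((τ : ℂ) + t) / N)))

/-- `F = ∑_{i,j} Aⁱ Bʲ T_N(aⁱ bʲ)` as a power series in `A = X 0`, `B = X 1` over the polynomial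
ring `ℂ[a, b]` (`a = X 0`, `b = X 1`): the coefficient of `Aⁱ Bʲ` is a polynomial
`∑ c_{ijkl} aᵏ bˡ` whose value at the modular forms `a`, `b` is `T_N(aⁱ bʲ)`. -/
def IsHeckeGeneratingFunction (N : ℕ)
    (F : MvPowerSeries (Fin 2) (MvPolynomial (Fin 2) ℂ)) : Prop :=
  ∀ (m : Fin 2 →₀ ℕ) (τ : ℍ),
    MvPolynomial.eval ![aForm τ, bForm τ] (MvPowerSeries.coeff m F) =
      hecke N (4 * m 0 + 6 * m 1) (fun z => aForm z ^ m 0 * bForm z ^ m 1) τ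

/-- The inclusion of `ℚ[a, b, A, B]` in `ℂ[a, b][[A, B]]`, where the four variables of the source
are `a`, `b`, `A`, `B` in this order. -/
def polyToSeries :
    MvPolynomial (Fin 4) ℚ →ₐ[ℚ] MvPowerSeries (Fin 2) (MvPolynomial (Fin 2) ℂ) :=
  MvPolynomial.aeval ![MvPowerSeries.C (MvPolynomial.X 0), MvPowerSeries.C (MvPolynomial.X 1),
    MvPowerSeries.X 0, MvPowerSeries.X 1]

/-- The identification of `ℂ[a, b]` with `ℛ`, followed by the inclusion of `ℛ` in `𝒦`. -/
def polyToField : MvPolynomial (Fin 2) ℂ →+* K₁ :=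
  (algebraMap R₁ K₁).comp
    (MvPolynomial.aeval (R := ℂ) ![aR, bR] : MvPolynomial (Fin 2) ℂ →ₐ[ℂ] R₁).toRingHom

/-! ### The `x`-coordinate of the point of order `N` -/

theorem indep_one_tau (τ : ℍ) : LinearIndependent ℝ ![(1 : ℂ), (τ : ℂ)] := by
  rw [LinearIndependent.pair_iff]
  intro s t h
  have him := congrArg Complex.im h
  have hre := congrArg Complex.re h
  simp only [Complex.real_smul, mul_one, Complex.add_im, Complex.ofReal_im, Complex.mul_im,
    Complex.ofReal_re, zero_mul, add_zero, zero_add, Complex.zero_im] at him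
  have ht : t = 0 := (mul_eq_zero.1 him).resolve_right τ.im_pos.ne'
  subst ht
  simpa using hre

/-- The lattice `L_τ = ℤ + ℤτ`. -/
def lattice (τ : ℍ) : PeriodPair := ⟨1, τ, indep_one_tau τ⟩

/-- `x_P(τ) = -π⁻² ℘(1/N; L_τ)`, the `x`-coordinate of the point `P = 1/N` of order `N` on
`y² = x³ + a x + b`. -/
def xP (N : ℕ) (τ : ℍ) : ℂ :=
  -(1 / (Real.pi : ℂ) ^ 2) * (lattice τ).weierstrassP (1 / (N : ℂ))

/-! ### The explicit matrices

Here `a`, `b` are elements of an arbitrary field `k`, and all entries of the matrices are given by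
rational expressions in `a`, `b` with rational coefficients. -/

section Explicit

variable {k : Type*} [Field k] (a b : k) (N : ℕ)

/-- The Weierstrass curve `y² = x³ + a x + b`. -/
def curve : WeierstrassCurve k := ⟨0, 0, 0, a, b⟩

/-- The polynomial in `x` whose roots are the `x`-coordinates of the points of order `N`, `N` prime:
for `N = 2` the cubic `x³ + a x + b`, for `N` odd the division polynomial `ψ_N`. -/
def torsionPoly : Polynomial k :=
  if N = 2 then Polynomial.X ^ 3 + Polynomial.C a * Polynomial.X + Polynomial.C b
  else (curve a b).preΨ' N

/-- The degree of the previous polynomial: `3` for `N = 2`, and `(N² - 1) / 2` for `N` odd. -/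
def torsionDegree : ℕ := if N = 2 then 3 else (N ^ 2 - 1) / 2

/-- The companion matrix: multiplication by `x` on `k[x]/(ψ_N)` in the basis
`1, x, x², …`. -/
def xMatrix : Matrix (Fin (torsionDegree N)) (Fin (torsionDegree N)) k := fun i j =>
  if (j : ℕ) + 1 < torsionDegree N then (if (i : ℕ) = j + 1 then 1 else 0)
  else -((torsionPoly a b N).coeff i / (torsionPoly a b N).coeff (torsionDegree N))

/-- The matrix of `x_{ℓP} = φ_ℓ(x_P) / ψ_ℓ(x_P)²`, the `x`-coordinate of `ℓP`. -/
def xMulMatrix (l : ℕ) : Matrix (Fin (torsionDegree N)) (Fin (torsionDegree N)) k :=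
  Polynomial.aeval (xMatrix a b N) ((curve a b).Φ l) *
    (Polynomial.aeval (xMatrix a b N) ((curve a b).ΨSq l))⁻¹

/-- The matrix of `a'`: for odd `N` that of
`a - 30 ∑_ℓ x_{ℓP}² - 5 (N - 1) a`, with `1 ≤ ℓ ≤ (N - 1) / 2`, and for `N = 2` that of
`-4 a - 15 x_P²`. -/
def aMatrix : Matrix (Fin (torsionDegree N)) (Fin (torsionDegree N)) k :=
  if N = 2 then (-4 * a) • 1 - (15 : k) • xMatrix a b N ^ 2
  else a • 1 - (30 : k) • ∑ l ∈ Finset.Icc 1 ((N - 1) / 2), xMulMatrix a b N l ^ 2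
    - (5 * ((N : k) - 1) * a) • 1

/-- The matrix of `b'`: for odd `N` that of
`b - 70 ∑_ℓ x_{ℓP}³ - 42 a ∑_ℓ x_{ℓP} - 14 (N - 1) b`, with `1 ≤ ℓ ≤ (N - 1) / 2`, and for `N = 2`
that of `22 b + 14 a x_P`. -/
def bMatrix : Matrix (Fin (torsionDegree N)) (Fin (torsionDegree N)) k :=
  if N = 2 then (22 * b) • 1 + (14 * a) • xMatrix a b N
  else b • 1 - (70 : k) • ∑ l ∈ Finset.Icc 1 ((N - 1) / 2), xMulMatrix a b N l ^ 3
    - (42 * a) • ∑ l ∈ Finset.Icc 1 ((N - 1) / 2), xMulMatrix a b N l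
    - (14 * ((N : k) - 1) * b) • 1

end Explicit

/-- The trace of `[(I - A S)(I - B T)]⁻¹`, where `S`, `T` are square matrices over `k`, and the
inverse is that of a matrix over `k[[A, B]]` (its determinant has constant term `1`). -/
def traceSeries {k ι : Type*} [Field k] [Fintype ι] [DecidableEq ι] (S T : Matrix ι ι k) :
    MvPowerSeries (Fin 2) k :=
  Matrix.trace
    (((1 - (MvPowerSeries.X 0 : MvPowerSeries (Fin 2) k) • S.map (MvPowerSeries.C (σ := Fin 2))) *
      (1 - (MvPowerSeries.X 1 : MvPowerSeries (Fin 2) k) • T.map (MvPowerSeries.C (σ := Fin 2)))) :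
      Matrix ι ι (MvPowerSeries (Fin 2) k))⁻¹

/-- `1 / [Γ₀(N) : Γ_±(N)]` for `N` prime: `1` for `N = 2` and `2 / (N - 1)` for `N` odd. -/
def indexFactor (k : Type*) [Field k] (N : ℕ) : k := if N = 2 then 1 else 2 / ((N : k) - 1)

end HeckeGF

end

/-!
Let `x_v(τ) = -π⁻² ℘((u τ + w) / N)` be the `x`-coordinate of the point of order `N` with index
`v = (u, w) ∈ (ℤ/N)²` on `y² = x³ + a x + b` (`torsionX`), so that `x_P = x_(0,1)`. The group
`SL(2, ℤ)` permutes the `x_v`, and the `d` functions `x_v`, `v ≠ 0` up to sign, are the conjugates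
of `x_P` over `𝒦`: they are the roots of `x³ + a x + b` for `N = 2` and of `ψ_N` for odd `N`.

*Isogenies.* Summing the Eisenstein series over the cosets of a lattice in a larger one gives
Vélu's formulas (`PeriodPair.scaledA_of_cosets`, `PeriodPair.scaledB_of_cosets`). They express
`a'`, `b'` through `x_P, x_(2P), …`, and the same polynomials in `x_v, x_(2v), …` (`isogA`, `isogB`)
are the conjugates of `a'`, `b'`. Up to the choice of a generator of the kernel, these conjugates
are `N⁴ a(N τ)` and `a((τ + t) / N)`, and likewise for `b`; hence the trace of `a'ⁱ b'ʲ` over `𝒦` is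
a multiple of `T_N(aⁱ bʲ)` (`trace_eq`), and summing over `i`, `j` yields the trace of the resolvent
(`map_polyToField_eq`). The coordinates `x_(ℓP)` are rational functions of `x_P` by the
multiplication formula `x(ℓP) = φ_ℓ / ψ_ℓ²`. It follows from the addition theorem for `℘`
(`PeriodPair.weierstrassP_add`), which shows that the `x`-coordinates of the multiples of a point
generate an elliptic sequence (`IsMultipleSeq.psi_add_mul_psi_sub`).

*The basis.* An algebraic relation for `x_P` over `ℛ`, taken at the translates `g τ` of a fixed
point, becomes a polynomial equation in the automorphy factor `j(g, τ)` which has infinitely many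
roots. It therefore also holds for every conjugate `x_v` (`eval₂_torsionX_eq_zero`), and as the
`x_v` have distinct values, the powers of `x_P` below the `d`-th are linearly independent. They span
by the formula for the dual basis: for a form `h` for `Γ_±(N)` with conjugates `h_i`, the sums
`∑ h_i x_i ^ n` have level one, and they determine `h` times the derivative of the minimal
polynomial at `x_P` (`mul_derivative_eq`).

*The generating function.* Sums over all isogenies are forms of level one, and those are polynomials
in `a`, `b` by induction on the weight, with division of cusp forms by `Δ` (`levelOne_mem`). The
polynomials are unique because `b` vanishes at `i` and `a` does not, which makes `a` and `b`
algebraically independent (`evalForms_injective`). Finally the matrices of `a'` and `b'` are defined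
over `ℚ(a, b)`, and Cramer's rule for the resolvent, with denominators cleared, gives rationality
(`exists_rational`).
-/

noncomputable section

namespace PeriodPair

/-! ### The addition theorem for `℘` -/

open Filter Topology

variable (L : PeriodPair)

theorem countable_lattice : (L.lattice : Set ℂ).Countable :=
  Set.countable_coe_iff.1 (L.latticeEquivProd.toEquiv.countable_iff.2 inferInstance)

/-- Identities between `℘` and its translates are continued analytically over the complement of
finitely many translates of the lattice, which is connected since a countable set is removed. -/
theorem isPreconnected_compl_of_countable {s : Set ℂ} (hs : s.Countable) : IsPreconnected sᶜ :=
  (hs.isPathConnected_compl_of_one_lt_rank (by simp)).isConnected.isPreconnected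

theorem isOpen_compl_lattice : IsOpen ((L.lattice : Set ℂ)ᶜ) := L.isClosed_lattice.isOpen_compl

theorem hasDerivAt_weierstrassP {z : ℂ} (hz : z ∉ L.lattice) :
    HasDerivAt ℘[L] (℘'[L] z) z := by
  have h := ((L.analyticOnNhd_weierstrassP z hz).differentiableAt).hasDerivAt
  rwa [L.deriv_weierstrassP] at h

/-- `℘'` does not vanish identically near any point, since `℘` has a pole at `0`. -/
theorem exists_derivWeierstrassP_ne_zero : ∃ z, z ∉ L.lattice ∧ ℘'[L] z ≠ 0 := by
  by_contra! h
  have hconn := isPreconnected_compl_of_countable L.countable_lattice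
  have hconst : ∀ z ∉ L.lattice, ∀ w ∉ L.lattice, ℘[L] z = ℘[L] w := by
    intro z hz w hw
    refine L.isOpen_compl_lattice.is_const_of_deriv_eq_zero hconn
      L.differentiableOn_weierstrassP (fun x hx => ?_) hz hw
    rw [L.deriv_weierstrassP]; exact h x hx
  have h2 := L.order_weierstrassP 0 (zero_mem _)
  have h3 : ℘[L] =ᶠ[𝓝[≠] 0] fun _ => ℘[L] (L.ω₁ / 2) := by
    filter_upwards [self_mem_nhdsWithin, mem_nhdsWithin_of_mem_nhds
      (L.compl_lattice_sdiff_singleton_mem_nhds 0)] with z hz hz'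
    exact hconst z (by simp_all) _ L.ω₁_div_two_notMem_lattice
  rw [meromorphicOrderAt_congr h3, meromorphicOrderAt_const] at h2
  split_ifs at h2
  · exact WithTop.top_ne_coe (a := (-2 : ℤ)) h2
  · have h4 : ((0 : ℤ) : WithTop ℤ) = ((-2 : ℤ) : WithTop ℤ) := h2
    exact absurd (WithTop.coe_injective h4) (by decide)

/-- `℘'' = 6 ℘² - g₂ / 2`. -/
theorem deriv_derivWeierstrassP {z : ℂ} (hz : z ∉ L.lattice) :
    deriv ℘'[L] z = 6 * ℘[L] z ^ 2 - L.g₂ / 2 := by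
  have hU := L.isOpen_compl_lattice
  have key : ∀ x ∈ (L.lattice : Set ℂ)ᶜ,
      ℘'[L] x * (deriv ℘'[L] x - (6 * ℘[L] x ^ 2 - L.g₂ / 2)) = 0 := by
    intro x hx
    have h1 : HasDerivAt ℘'[L] (deriv ℘'[L] x) x :=
      ((L.analyticOnNhd_derivWeierstrassP x hx).differentiableAt).hasDerivAt
    have h2 := L.hasDerivAt_weierstrassP hx
    have h3 := h1.pow 2
    have h4 := (((h2.pow 3).const_mul 4).sub (h2.const_mul L.g₂)).sub_const L.g₃
    have h5 : (fun z => ℘'[L] z ^ 2) =ᶠ[𝓝 x]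
        fun z => 4 * ℘[L] z ^ 3 - L.g₂ * ℘[L] z - L.g₃ := by
      filter_upwards [hU.mem_nhds hx] with y hy using L.derivWeierstrassP_sq y hy
    have h6 := h3.unique (h4.congr_of_eventuallyEq h5)
    norm_num at h6
    linear_combination h6 / 2
  have han1 : AnalyticOnNhd ℂ ℘'[L] (L.lattice : Set ℂ)ᶜ := L.analyticOnNhd_derivWeierstrassP
  have han2 : AnalyticOnNhd ℂ (fun x => deriv ℘'[L] x - (6 * ℘[L] x ^ 2 - L.g₂ / 2))
      (L.lattice : Set ℂ)ᶜ := fun x hx => by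
    have := (han1 x hx).deriv
    have := L.analyticOnNhd_weierstrassP x hx
    fun_prop
  rcases han1.eq_zero_or_eq_zero_of_mul_eq_zero han2 key
    (isPreconnected_compl_of_countable L.countable_lattice) with h | h
  · obtain ⟨w, hw, hw'⟩ := L.exists_derivWeierstrassP_ne_zero
    exact absurd (h w hw) hw'
  · exact sub_eq_zero.1 (h z hz)

theorem hasDerivAt_derivWeierstrassP {z : ℂ} (hz : z ∉ L.lattice) :
    HasDerivAt ℘'[L] (6 * ℘[L] z ^ 2 - L.g₂ / 2) z := by
  have h := ((L.analyticOnNhd_derivWeierstrassP z hz).differentiableAt).hasDerivAt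
  rwa [L.deriv_derivWeierstrassP hz] at h

/-- The square of half the slope of the chord through the points with parameters `z` and `c - z`,
minus their `x`-coordinates. The addition theorem says that this is `℘ c`. -/
def chord (c z : ℂ) : ℂ :=
  ((℘'[L] z - ℘'[L] (c - z)) / (℘[L] z - ℘[L] (c - z))) ^ 2 / 4 - ℘[L] z - ℘[L] (c - z)

/-- By the differential equation of `℘`, `chord c` is locally constant. -/
theorem hasDerivAt_chord {c z : ℂ} (hz : z ∉ L.lattice) (hcz : c - z ∉ L.lattice)
    (hne : ℘[L] z ≠ ℘[L] (c - z)) : HasDerivAt (L.chord c) 0 z := by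
  have h0 : ℘[L] z - ℘[L] (c - z) ≠ 0 := sub_ne_zero.2 hne
  have hs : HasDerivAt (fun z => c - z) (-1) z := by simpa using (hasDerivAt_id z).const_sub c
  have u := L.hasDerivAt_weierstrassP hz
  have u' := L.hasDerivAt_derivWeierstrassP hz
  have v : HasDerivAt (fun z => ℘[L] (c - z)) (℘'[L] (c - z) * -1) z :=
    (L.hasDerivAt_weierstrassP hcz).comp z hs
  have v' : HasDerivAt (fun z => ℘'[L] (c - z)) ((6 * ℘[L] (c - z) ^ 2 - L.g₂ / 2) * -1) z :=
    (L.hasDerivAt_derivWeierstrassP hcz).comp z hs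
  have h := (((((u'.sub v').div (u.sub v) h0).pow 2).div_const 4).sub u).sub v
  refine (h.congr_deriv ?_)
  have e1 := L.derivWeierstrassP_sq z hz
  have e2 := L.derivWeierstrassP_sq _ hcz
  simp only [Pi.sub_apply, Pi.div_apply, Nat.cast_ofNat]
  generalize ℘[L] (c - z) = q at *
  generalize ℘'[L] (c - z) = q' at *
  generalize ℘[L] z = p at *
  generalize ℘'[L] z = p' at *
  -- `N' = 2 (℘ z - ℘ (c - z))` for the slope `N`, by the differential equation
  have hN : ((6 * p ^ 2 - L.g₂ / 2 - (6 * q ^ 2 - L.g₂ / 2) * -1) * (p - q) -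
      (p' - q') * (p' - q' * -1)) / (p - q) ^ 2 = 2 * (p - q) := by
    rw [div_eq_iff (pow_ne_zero 2 h0)]
    linear_combination e2 - e1
  have hN' : (p' - q') / (p - q) * (p - q) = p' - q' := div_mul_cancel₀ _ h0
  rw [hN]
  norm_num
  linear_combination hN'

/-- The constant value of `chord c` is read off at `z = 0`, where the double pole of `℘` cancels. -/
theorem tendsto_chord {c : ℂ} (hc : c ∉ L.lattice) :
    (∀ᶠ z in 𝓝[≠] (0 : ℂ), ℘[L] z ≠ ℘[L] (c - z)) ∧
      Tendsto (L.chord c) (𝓝[≠] 0) (𝓝 (℘[L] c)) := by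
  have he : Tendsto ℘[L - (0 : ℂ)] (𝓝[≠] 0) (𝓝 0) := by
    have := (L.analyticAt_weierstrassPExcept 0).continuousAt.tendsto
    rw [L.weierstrassPExcept_zero] at this
    exact this.mono_left nhdsWithin_le_nhds
  have he' : Tendsto ℘'[L - (0 : ℂ)] (𝓝[≠] 0) (𝓝 (℘'[L - (0 : ℂ)] 0)) :=
    (L.analyticAt_derivWeierstrassPExcept 0).continuousAt.tendsto.mono_left nhdsWithin_le_nhds
  have hs : Tendsto (fun z => c - z) (𝓝[≠] 0) (𝓝 c) := by
    have : ContinuousAt (fun z => c - z) 0 := by fun_prop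
    simpa using this.tendsto.mono_left (nhdsWithin_le_nhds (s := {0}ᶜ))
  have hv : Tendsto (fun z => ℘[L] (c - z)) (𝓝[≠] 0) (𝓝 (℘[L] c)) :=
    (L.analyticOnNhd_weierstrassP c hc).continuousAt.tendsto.comp hs
  have hv' : Tendsto (fun z => ℘'[L] (c - z)) (𝓝[≠] 0) (𝓝 (℘'[L] c)) :=
    (L.analyticOnNhd_derivWeierstrassP c hc).continuousAt.tendsto.comp hs
  have hz : Tendsto (fun z : ℂ => z) (𝓝[≠] 0) (𝓝 0) := tendsto_id.mono_left nhdsWithin_le_nhds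
  have hB : Tendsto (fun z => 1 + z ^ 2 * (℘[L - (0 : ℂ)] z - ℘[L] (c - z))) (𝓝[≠] 0)
      (𝓝 (1 + 0 ^ 2 * (0 - ℘[L] c))) := ((hz.pow 2).mul (he.sub hv)).const_add 1
  have hA : Tendsto (fun z => 1 - z ^ 3 * (℘'[L - (0 : ℂ)] z - ℘'[L] (c - z)) / 2) (𝓝[≠] 0)
      (𝓝 (1 - 0 ^ 3 * (℘'[L - (0 : ℂ)] 0 - ℘'[L] c) / 2)) :=
    (((hz.pow 3).mul (he'.sub hv')).div_const 2).const_sub 1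
  have hB0 : ∀ᶠ z in 𝓝[≠] (0 : ℂ), 1 + z ^ 2 * (℘[L - (0 : ℂ)] z - ℘[L] (c - z)) ≠ 0 := by
    refine hB.eventually_ne ?_
    simp
  have hex : ∀ z, ℘[L] z = ℘[L - (0 : ℂ)] z + 1 / z ^ 2 := fun z => by
    have := L.weierstrassPExcept_def 0 z
    simp only [ZeroMemClass.coe_zero] at this
    rw [this]; simp
  have hex' : ∀ z, ℘'[L] z = ℘'[L - (0 : ℂ)] z - 2 / z ^ 3 := fun z => by
    have := L.derivWeierstrassPExcept_def 0 z
    simp only [ZeroMemClass.coe_zero] at this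
    rw [this]; simp
  refine ⟨?_, ?_⟩
  · filter_upwards [hB0, self_mem_nhdsWithin] with z h1 h2 h3
    have hz0 : z ≠ 0 := h2
    rw [hex] at h3
    apply h1
    rw [← h3]
    field_simp
    ring
  · have hlim : Tendsto (fun z => (-z * (℘'[L - (0 : ℂ)] z - ℘'[L] (c - z)) / 2 -
        (℘[L - (0 : ℂ)] z - ℘[L] (c - z))) *
        ((1 - z ^ 3 * (℘'[L - (0 : ℂ)] z - ℘'[L] (c - z)) / 2) +
        (1 + z ^ 2 * (℘[L - (0 : ℂ)] z - ℘[L] (c - z)))) /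
        (1 + z ^ 2 * (℘[L - (0 : ℂ)] z - ℘[L] (c - z))) ^ 2 - ℘[L - (0 : ℂ)] z -
        ℘[L] (c - z)) (𝓝[≠] 0) (𝓝 ((-0 * (℘'[L - (0 : ℂ)] 0 - ℘'[L] c) / 2 -
        (0 - ℘[L] c)) *
        ((1 - 0 ^ 3 * (℘'[L - (0 : ℂ)] 0 - ℘'[L] c) / 2) +
        (1 + 0 ^ 2 * (0 - ℘[L] c))) /
        (1 + 0 ^ 2 * (0 - ℘[L] c)) ^ 2 - 0 - ℘[L] c)) := by
      refine (((((((hz.neg.mul (he'.sub hv')).div_const 2).sub (he.sub hv)).mul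
        (hA.add hB)).div (hB.pow 2) ?_).sub he).sub hv)
      simp
    have hval : ((-0 * (℘'[L - (0 : ℂ)] 0 - ℘'[L] c) / 2 -
        (0 - ℘[L] c)) *
        ((1 - 0 ^ 3 * (℘'[L - (0 : ℂ)] 0 - ℘'[L] c) / 2) +
        (1 + 0 ^ 2 * (0 - ℘[L] c))) /
        (1 + 0 ^ 2 * (0 - ℘[L] c)) ^ 2 - 0 - ℘[L] c) = ℘[L] c := by ring
    rw [hval] at hlim
    refine hlim.congr' ?_
    filter_upwards [hB0, self_mem_nhdsWithin] with z h1 h2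
    have hz0 : z ≠ 0 := h2
    rw [chord, hex z, hex' z]
    generalize ℘[L] (c - z) = q at *
    generalize ℘'[L] (c - z) = q' at *
    generalize ℘[L - (0 : ℂ)] z = e at *
    generalize ℘'[L - (0 : ℂ)] z = e' at *
    have h3 : e + 1 / z ^ 2 - q = (1 + z ^ 2 * (e - q)) / z ^ 2 := by field_simp; ring
    have h4 : e' - 2 / z ^ 3 - q' = -2 * (1 - z ^ 3 * (e' - q') / 2) / z ^ 3 := by
      field_simp; ring
    rw [h3, h4]
    generalize hBB : 1 + z ^ 2 * (e - q) = B at *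
    have hq : q = e - (B - 1) / z ^ 2 := by rw [← hBB]; field_simp; ring
    subst hq
    field_simp
    ring

/-- The addition theorem for `℘`, in a form without denominators. -/
theorem weierstrassP_add {z w : ℂ} (hz : z ∉ L.lattice) (hw : w ∉ L.lattice)
    (hzw : z + w ∉ L.lattice) :
    4 * (℘[L] (z + w) + ℘[L] z + ℘[L] w) * (℘[L] z - ℘[L] w) ^ 2 =
      (℘'[L] z - ℘'[L] w) ^ 2 := by
  set c := z + w with hc
  obtain ⟨hne, hlim⟩ := L.tendsto_chord hzw
  let U : Set ℂ := ((L.lattice : Set ℂ) ∪ (fun x => c - x) ⁻¹' L.lattice)ᶜ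
  have hcl : IsClosed ((fun x => c - x) ⁻¹' (L.lattice : Set ℂ)) :=
    L.isClosed_lattice.preimage (by fun_prop)
  have hUo : IsOpen U := (L.isClosed_lattice.union hcl).isOpen_compl
  have hUc : IsPreconnected U := isPreconnected_compl_of_countable
    (L.countable_lattice.union (L.countable_lattice.preimage (sub_right_injective)))
  have hU : ∀ x, x ∈ U ↔ x ∉ L.lattice ∧ c - x ∉ L.lattice := fun x => by simp [U]
  have hUn : ∀ᶠ x in 𝓝[≠] (0 : ℂ), x ∈ U := by
    have h1 : ∀ᶠ x in 𝓝[≠] (0 : ℂ), x ∉ L.lattice := by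
      filter_upwards [self_mem_nhdsWithin, mem_nhdsWithin_of_mem_nhds
        (L.compl_lattice_sdiff_singleton_mem_nhds 0)] with x h1 h2
      simp_all
    have h2 : ∀ᶠ x in 𝓝[≠] (0 : ℂ), x ∈ ((fun x => c - x) ⁻¹' (L.lattice : Set ℂ))ᶜ := by
      refine nhdsWithin_le_nhds (hcl.isOpen_compl.mem_nhds ?_)
      simpa using hzw
    filter_upwards [h1, h2] with x h1 h2
    exact (hU x).2 ⟨h1, h2⟩
  -- the chord function is constant on a punctured disc around `0`
  obtain ⟨r, hr, hball⟩ := Metric.mem_nhdsWithin_iff.1 (hne.and hUn)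
  let D : Set ℂ := Metric.ball 0 r ∩ {0}ᶜ
  have hDo : IsOpen D := Metric.isOpen_ball.inter isOpen_compl_singleton
  have hDc : IsPreconnected D := by
    have : D = Complex.exp '' {x : ℂ | x.re < Real.log r} := by
      ext x
      simp only [D, Set.mem_inter_iff, mem_ball_zero_iff, Set.mem_compl_iff,
        Set.mem_singleton_iff, Set.mem_image, Set.mem_ofPred_eq]
      refine ⟨fun h => ⟨Complex.log x, ?_, Complex.exp_log h.2⟩, ?_⟩
      · rw [Complex.log_re]
        exact Real.log_lt_log (norm_pos_iff.2 h.2) h.1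
      · rintro ⟨y, hy, rfl⟩
        refine ⟨?_, Complex.exp_ne_zero y⟩
        rw [Complex.norm_exp]
        exact (Real.lt_log_iff_exp_lt hr).1 hy
    rw [this]
    exact (convex_halfSpace_re_lt _).isPreconnected.image _ Complex.continuous_exp.continuousOn
  have hder : ∀ x ∈ D, HasDerivAt (L.chord c) 0 x := fun x hx =>
    L.hasDerivAt_chord ((hU x).1 (hball hx).2).1 ((hU x).1 (hball hx).2).2 (hball hx).1
  have hDmem : ∀ᶠ x in 𝓝[≠] (0 : ℂ), x ∈ D :=
    inter_mem (mem_nhdsWithin_of_mem_nhds (Metric.ball_mem_nhds 0 hr)) self_mem_nhdsWithin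
  have hconst : ∀ x ∈ D, L.chord c x = ℘[L] c := by
    intro x hx
    refine tendsto_nhds_unique (l := 𝓝[≠] (0 : ℂ)) (f := L.chord c) ?_ hlim
    refine tendsto_const_nhds.congr' ?_
    filter_upwards [hDmem] with y hy
    exact hDo.is_const_of_deriv_eq_zero hDc
      (fun y hy => (hder y hy).differentiableAt.differentiableWithinAt)
      (fun y hy => (hder y hy).deriv) hx hy
  have han : AnalyticOnNhd ℂ (fun x => 4 * (℘[L] c + ℘[L] x + ℘[L] (c - x)) *
      (℘[L] x - ℘[L] (c - x)) ^ 2 - (℘'[L] x - ℘'[L] (c - x)) ^ 2) U := by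
    intro x hx
    obtain ⟨h1, h2⟩ := (hU x).1 hx
    have a1 := L.analyticOnNhd_weierstrassP x h1
    have a2 := L.analyticOnNhd_derivWeierstrassP x h1
    have a3 : AnalyticAt ℂ (fun x => ℘[L] (c - x)) x :=
      (L.analyticOnNhd_weierstrassP _ h2).comp (f := fun x => c - x) (by fun_prop)
    have a4 : AnalyticAt ℂ (fun x => ℘'[L] (c - x)) x :=
      (L.analyticOnNhd_derivWeierstrassP _ h2).comp (f := fun x => c - x) (by fun_prop)
    fun_prop
  obtain ⟨x₀, hx₀⟩ := hDmem.exists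
  have hzero := han.eqOn_zero_of_preconnected_of_eventuallyEq_zero hUc
    (hball hx₀).2 (by
      filter_upwards [hDo.mem_nhds hx₀] with x hx
      have h1 := hconst x hx
      have h2 : ℘[L] x - ℘[L] (c - x) ≠ 0 := sub_ne_zero.2 (hball hx).1
      rw [← h1, chord, Pi.zero_apply]
      field_simp
      ring)
  have hzU : z ∈ U := (hU z).2 ⟨hz, by simpa [hc] using hw⟩
  have := hzero hzU
  simp only [hc, add_sub_cancel_left, Pi.zero_apply] at this
  linear_combination this

/-- The duplication formula for `℘`, the limit of the addition theorem as `z → w`. -/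
theorem weierstrassP_two_mul {w : ℂ} (hw : w ∉ L.lattice) (h2w : w + w ∉ L.lattice) :
    4 * (℘[L] (w + w) + 2 * ℘[L] w) * ℘'[L] w ^ 2 = (6 * ℘[L] w ^ 2 - L.g₂ / 2) ^ 2 := by
  have s1 := (hasDerivAt_iff_tendsto_slope.1 (L.hasDerivAt_weierstrassP hw))
  have s2 := (hasDerivAt_iff_tendsto_slope.1 (L.hasDerivAt_derivWeierstrassP hw))
  have c1 : Tendsto (fun z => ℘[L] (z + w)) (𝓝[≠] w) (𝓝 (℘[L] (w + w))) := by
    have : ContinuousAt (fun z => ℘[L] (z + w)) w :=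
      ((L.analyticOnNhd_weierstrassP _ h2w).comp (f := fun x => x + w)
        (by fun_prop)).continuousAt
    exact this.tendsto.mono_left nhdsWithin_le_nhds
  have c2 : Tendsto ℘[L] (𝓝[≠] w) (𝓝 (℘[L] w)) :=
    (L.analyticOnNhd_weierstrassP _ hw).continuousAt.tendsto.mono_left nhdsWithin_le_nhds
  have hl := (((c1.add c2).add_const (℘[L] w)).const_mul 4).mul (s1.pow 2)
  have hr := s2.pow 2
  have h : Tendsto (fun z => 4 * (℘[L] (z + w) + ℘[L] z + ℘[L] w) * slope ℘[L] w z ^ 2)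
      (𝓝[≠] w) (𝓝 ((6 * ℘[L] w ^ 2 - L.g₂ / 2) ^ 2)) := by
    refine hr.congr' ?_
    have o1 : ∀ᶠ z in 𝓝[≠] w, z ∉ L.lattice :=
      nhdsWithin_le_nhds (L.isOpen_compl_lattice.mem_nhds hw)
    have o2 : ∀ᶠ z in 𝓝[≠] w, z + w ∉ L.lattice :=
      nhdsWithin_le_nhds ((L.isOpen_compl_lattice.preimage
        (continuous_id.add continuous_const : Continuous fun z : ℂ => z + w)).mem_nhds h2w)
    filter_upwards [o1, o2, self_mem_nhdsWithin] with z h1 h2 h3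
    have h4 := L.weierstrassP_add h1 hw h2
    have h5 : z - w ≠ 0 := sub_ne_zero.2 h3
    rw [slope_def_field, slope_def_field, div_pow, div_pow, ← h4]
    ring
  have := tendsto_nhds_unique hl h
  linear_combination this

/-- Translation by a zero `w` of `℘'` acts on `℘ - ℘ w` by inversion. -/
theorem weierstrassP_add_sub_mul {w : ℂ} (hw : w ∉ L.lattice) (hw' : ℘'[L] w = 0) {t : ℂ}
    (ht : t ∉ L.lattice) (htw : t + w ∉ L.lattice) :
    (℘[L] (t + w) - ℘[L] w) * (℘[L] t - ℘[L] w) = 3 * ℘[L] w ^ 2 - L.g₂ / 4 := by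
  let U : Set ℂ := ((L.lattice : Set ℂ) ∪ (fun x => x + w) ⁻¹' L.lattice)ᶜ
  have hUc : IsPreconnected U := isPreconnected_compl_of_countable
    (L.countable_lattice.union (L.countable_lattice.preimage (add_left_injective w)))
  have hUo : IsOpen U := (L.isClosed_lattice.union
    (L.isClosed_lattice.preimage (by fun_prop))).isOpen_compl
  have hU : ∀ x, x ∈ U ↔ x ∉ L.lattice ∧ x + w ∉ L.lattice := fun x => by simp [U]
  have han1 : AnalyticOnNhd ℂ (fun x => ℘[L] x - ℘[L] w) U := fun x hx => by
    have a1 := L.analyticOnNhd_weierstrassP x ((hU x).1 hx).1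
    fun_prop
  have han2 : AnalyticOnNhd ℂ (fun x => (℘[L] (x + w) - ℘[L] w) * (℘[L] x - ℘[L] w) -
      (3 * ℘[L] w ^ 2 - L.g₂ / 4)) U := fun x hx => by
    have a1 := L.analyticOnNhd_weierstrassP x ((hU x).1 hx).1
    have a3 : AnalyticAt ℂ (fun x => ℘[L] (x + w)) x :=
      (L.analyticOnNhd_weierstrassP _ ((hU x).1 hx).2).comp (f := fun x => x + w) (by fun_prop)
    fun_prop
  have htU : t ∈ U := (hU t).2 ⟨ht, htw⟩
  rcases han1.eq_zero_or_eq_zero_of_mul_eq_zero han2 (fun x hx => by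
    have h1 := L.weierstrassP_add ((hU x).1 hx).1 hw ((hU x).1 hx).2
    have h2 := L.derivWeierstrassP_sq x ((hU x).1 hx).1
    have h3 := L.derivWeierstrassP_sq w hw
    rw [hw'] at h1 h3
    linear_combination (h1 + h2 - h3) / 4) hUc with h | h
  · exfalso
    -- otherwise `℘'` would vanish identically
    have h0 : Set.EqOn (deriv ℘[L]) 0 U := fun x hx => by
      have : ℘[L] =ᶠ[𝓝 x] fun _ => ℘[L] w := by
        filter_upwards [hUo.mem_nhds hx] with y hy using sub_eq_zero.1 (h y hy)
      rw [this.deriv_eq, deriv_const, Pi.zero_apply]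
    rw [deriv_weierstrassP] at h0
    have h1 := (L.analyticOnNhd_derivWeierstrassP).eqOn_zero_of_preconnected_of_eventuallyEq_zero
      (isPreconnected_compl_of_countable L.countable_lattice) ht
      (by filter_upwards [hUo.mem_nhds htU] with x hx using h0 hx)
    obtain ⟨z, hz, hz'⟩ := L.exists_derivWeierstrassP_ne_zero
    exact hz' (h1 hz)
  · exact sub_eq_zero.1 (h t htU)

/-! ### Values of `℘` and power sums over the lattice -/

section Discriminant

variable {L} (hD : L.g₂ ^ 3 - 27 * L.g₃ ^ 2 ≠ 0)

include hD

/-- If `℘ t = ℘ w`, then the constant in `weierstrassP_add_sub_mul` is `0`, so that the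
cubic has a double root at `℘ w`. -/
theorem weierstrassP_ne_of_deriv_eq_zero {w : ℂ} (hw : w ∉ L.lattice) (hw' : ℘'[L] w = 0) {t : ℂ}
    (ht : t ∉ L.lattice) (htw : t + w ∉ L.lattice) : ℘[L] t ≠ ℘[L] w := by
  intro h
  have h1 := L.weierstrassP_add_sub_mul hw hw' ht htw
  have h3 := L.derivWeierstrassP_sq w hw
  rw [hw'] at h3
  rw [h, sub_self, mul_zero] at h1
  apply hD
  have h2 : L.g₂ = 12 * ℘[L] w ^ 2 := by linear_combination 4 * h1
  have h4 : L.g₃ = -8 * ℘[L] w ^ 3 := by rw [h2] at h3; linear_combination h3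
  rw [h2, h4]; ring

/-- `℘` takes equal values only at points that agree up to sign modulo the lattice. -/
theorem weierstrassP_ne {z w : ℂ} (hz : z ∉ L.lattice) (hw : w ∉ L.lattice)
    (h1 : z + w ∉ L.lattice) (h2 : z - w ∉ L.lattice) : ℘[L] z ≠ ℘[L] w := by
  intro h
  have e1 := L.weierstrassP_add hz hw h1
  have e2 := L.weierstrassP_add hz (fun h => hw (by simpa using neg_mem h) : -w ∉ L.lattice)
    (by simpa [sub_eq_add_neg] using h2)
  simp only [weierstrassP_neg, derivWeierstrassP_neg, h, sub_self] at e1 e2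
  have e3 : ℘'[L] z - ℘'[L] w = 0 := by simpa using e1.symm
  have e4 : ℘'[L] z - -℘'[L] w = 0 := by simpa using e2.symm
  exact weierstrassP_ne_of_deriv_eq_zero hD hw (by linear_combination (e4 - e3) / 2) hz h1 h

theorem derivWeierstrassP_ne_zero {w : ℂ} (hw : w ∉ L.lattice) (h2w : w + w ∉ L.lattice) :
    ℘'[L] w ≠ 0 :=
  fun h => weierstrassP_ne_of_deriv_eq_zero hD hw h hw h2w rfl

end Discriminant

theorem derivWeierstrassP_eq_zero {w : ℂ} (h2w : w + w ∈ L.lattice) : ℘'[L] w = 0 := by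
  have h := L.derivWeierstrassP_sub_coe w ⟨w + w, h2w⟩
  simp only [sub_add_cancel_left, derivWeierstrassP_neg] at h
  linear_combination -h / 2

theorem iteratedDeriv_weierstrassP {z : ℂ} (hz : z ∉ L.lattice) {n : ℕ} (hn : n ≠ 0) :
    iteratedDeriv n ℘[L] z = (n + 1).factorial * L.sumInvPow z (n + 2) := by
  obtain ⟨r, h₁, h₂⟩ := Metric.nhds_basis_closedBall.mem_iff.mp (L.isOpen_compl_lattice.mem_nhds hz)
  lift r to NNReal using h₁.le
  have h := (L.hasFPowerSeriesOnBall_weierstrassP z r (by exact_mod_cast h₁) h₂).hasFPowerSeriesAt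
  have h2 := (L.analyticOnNhd_weierstrassP z hz).hasFPowerSeriesAt
  have h3 := congrArg (fun p => p.coeff n) (h2.eq_formalMultilinearSeries h)
  simp only [weierstrassPSeries, FormalMultilinearSeries.coeff_ofScalars, hn, if_false] at h3
  rw [div_eq_iff (by exact_mod_cast n.factorial_ne_zero)] at h3
  rw [h3, Nat.factorial_succ]
  push_cast
  ring

/-- The sum `∑ (z - l)⁻⁴` over the lattice is `℘'' / 6`. -/
theorem sumInvPow_four {z : ℂ} (hz : z ∉ L.lattice) :
    L.sumInvPow z 4 = ℘[L] z ^ 2 - L.g₂ / 12 := by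
  have h := L.iteratedDeriv_weierstrassP hz (n := 2) (by norm_num)
  rw [iteratedDeriv_succ, iteratedDeriv_one, L.deriv_weierstrassP,
    L.deriv_derivWeierstrassP hz] at h
  norm_num [Nat.factorial] at h
  linear_combination -h / 6

/-- The sum `∑ (z - l)⁻⁶` over the lattice is the fourth derivative of `℘` divided by `120`. -/
theorem sumInvPow_six {z : ℂ} (hz : z ∉ L.lattice) :
    L.sumInvPow z 6 = ℘[L] z ^ 3 - 3 / 20 * L.g₂ * ℘[L] z - L.g₃ / 10 := by
  have h := L.iteratedDeriv_weierstrassP hz (n := 4) (by norm_num)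
  have e2 : ∀ x ∉ L.lattice, iteratedDeriv 2 ℘[L] x = 6 * ℘[L] x ^ 2 - L.g₂ / 2 := fun x hx => by
    rw [iteratedDeriv_succ, iteratedDeriv_one, L.deriv_weierstrassP, L.deriv_derivWeierstrassP hx]
  have e3 : ∀ x ∉ L.lattice, iteratedDeriv 3 ℘[L] x = 12 * ℘[L] x * ℘'[L] x := fun x hx => by
    rw [iteratedDeriv_succ, Filter.EventuallyEq.deriv_eq
      (f := fun x => 6 * ℘[L] x ^ 2 - L.g₂ / 2)]
    · refine (((((L.hasDerivAt_weierstrassP hx).pow 2).const_mul 6).sub_const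
        (L.g₂ / 2)).congr_deriv ?_).deriv
      norm_num
      ring
    · filter_upwards [L.isOpen_compl_lattice.mem_nhds hx] with y hy using e2 y hy
  have hd : deriv (fun x => 12 * ℘[L] x * ℘'[L] x) z = _ :=
    ((((L.hasDerivAt_weierstrassP hz).const_mul 12)).mul (L.hasDerivAt_derivWeierstrassP hz)).deriv
  rw [iteratedDeriv_succ, Filter.EventuallyEq.deriv_eq (f := fun x => 12 * ℘[L] x * ℘'[L] x),
    hd] at h
  · norm_num [Nat.factorial] at h
    have h3 := L.derivWeierstrassP_sq z hz
    linear_combination -h / 120 + h3 / 10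
  · filter_upwards [L.isOpen_compl_lattice.mem_nhds hz] with y hy using e3 y hy

end PeriodPair

namespace HeckeGF

/-! ### Division polynomials and multiples of a point -/

/-- For points `P`, `Q` of `y² = x³ + a x + b` with `x`-coordinates `p ≠ q`, this is
`(x(P + Q) - t) (x(P - Q) - t) (p - q)²`. It is symmetric in `p`, `q`, `t`. -/
def addForm {k : Type*} [Field k] (a b p q t : k) : k :=
  t ^ 2 * (p - q) ^ 2 - 2 * t * ((p * q + a) * (p + q) + 2 * b) + (p * q - a) ^ 2 -
    4 * b * (p + q)

/-- `x n` behaves, for `1 ≤ n < N`, as the `x`-coordinate of `n P`, where `P = (x 1, y)` is a point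
of order at least `N` on `y² = x³ + a x + b`. -/
structure IsMultipleSeq {k : Type*} [Field k] (a b y : k) (x : ℕ → k) (N : ℕ) : Prop where
  sq : y ^ 2 = x 1 ^ 3 + a * x 1 + b
  y_ne : y ≠ 0
  dup : 4 * y ^ 2 * x 2 = (x 1 ^ 2 - a) ^ 2 - 8 * b * x 1
  add : ∀ m n, 1 ≤ n → n < m → m + n < N → ∀ t,
    (x (m + n) - t) * (x (m - n) - t) * (x m - x n) ^ 2 = addForm a b (x m) (x n) t
  ne : ∀ m n, 1 ≤ n → n < m → m + n < N → x m ≠ x n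

/-- The values `ψ_n(P)` of the division polynomials, rebuilt from the `x`-coordinates of the
multiples of `P` by means of `x(P) - x(nP) = ψ_{n+1} ψ_{n-1} / ψ_n²`. -/
def psiSeq {k : Type*} [Field k] (y : k) (x : ℕ → k) : ℕ → k
  | 0 => 0
  | 1 => 1
  | 2 => 2 * y
  | n + 3 => (x 1 - x (n + 2)) * psiSeq y x (n + 2) ^ 2 / psiSeq y x (n + 1)

namespace IsMultipleSeq

variable {k : Type*} [Field k] [CharZero k] {a b y : k} {x : ℕ → k} {N : ℕ}

theorem psi_ne_zero (h : IsMultipleSeq a b y x N) : ∀ n, 1 ≤ n → n < N → psiSeq y x n ≠ 0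
  | 0, h1, _ => by omega
  | 1, _, _ => by simp [psiSeq]
  | 2, _, _ => by simpa [psiSeq] using h.y_ne
  | n + 3, _, h2 => by
    rw [psiSeq]
    have h3 := h.ne (n + 2) 1 le_rfl (by omega) (by omega)
    exact div_ne_zero (mul_ne_zero (sub_ne_zero.2 h3.symm)
      (pow_ne_zero 2 (psi_ne_zero h (n + 2) (by omega) (by omega))))
      (psi_ne_zero h (n + 1) (by omega) (by omega))

theorem psi_succ_mul (h : IsMultipleSeq a b y x N) {n : ℕ} (hn : n + 2 ≤ N) :
    psiSeq y x (n + 2) * psiSeq y x n = (x 1 - x (n + 1)) * psiSeq y x (n + 1) ^ 2 := by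
  match n with
  | 0 => simp [psiSeq]
  | n + 1 =>
    have := h.psi_ne_zero (n + 1) (by omega) (by omega)
    rw [psiSeq]
    field_simp

/-- The defining relation of an elliptic sequence, by induction on `n`. The induction step compares
two instances of the addition law by means of the symmetry of `addForm`. -/
theorem psi_add_mul_psi_sub (h : IsMultipleSeq a b y x N) (n : ℕ) (hn : 1 ≤ n) :
    ∀ m, n ≤ m → m + n ≤ N → psiSeq y x (m + n) * psiSeq y x (m - n) =
      (x n - x m) * psiSeq y x m ^ 2 * psiSeq y x n ^ 2 := by
  induction n using Nat.strong_induction_on with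
  | _ n ih =>
  intro m hnm hmN
  rcases hnm.eq_or_lt with rfl | hlt
  · simp [psiSeq]
  obtain rfl | rfl | hn3 : n = 1 ∨ n = 2 ∨ 3 ≤ n := by omega
  · obtain ⟨m, rfl⟩ : ∃ j, m = j + 1 := ⟨m - 1, by omega⟩
    have := h.psi_succ_mul (n := m) (by omega)
    simp only [Nat.add_sub_cancel]
    rw [show psiSeq y x 1 = 1 by simp [psiSeq]]
    linear_combination this
  · obtain ⟨m, rfl⟩ : ∃ j, m = j + 2 := ⟨m - 2, by omega⟩
    have e1 := h.psi_succ_mul (n := m + 2) (by omega)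
    have e2 := h.psi_succ_mul (n := m) (by omega)
    have e3 := h.psi_succ_mul (n := m + 1) (by omega)
    have e4 := h.add (m + 2) 1 le_rfl (by omega) (by omega) (x 1)
    simp only [Nat.add_sub_cancel, show m + 2 - 1 = m + 1 by omega,
      show m + 2 + 1 = m + 3 by omega,
      show m + 1 + 1 = m + 2 by omega, addForm] at e1 e2 e3 e4 ⊢
    have hm := h.psi_ne_zero (m + 2) (by omega) (by omega)
    rw [show psiSeq y x 2 = 2 * y by simp [psiSeq]]
    apply mul_left_cancel₀ (pow_ne_zero 2 hm)
    have key : (x 1 - x (m + 3)) * (x 1 - x (m + 1)) * (x 1 - x (m + 2)) ^ 2 =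
        4 * y ^ 2 * (x 2 - x (m + 2)) := by
      linear_combination e4 - h.dup + 4 * x (m + 2) * h.sq
    calc psiSeq y x (m + 2) ^ 2 * (psiSeq y x (m + 2 + 2) * psiSeq y x m)
        = (psiSeq y x (m + 2 + 2) * psiSeq y x (m + 2)) *
            (psiSeq y x (m + 2) * psiSeq y x m) := by ring
      _ = (x 1 - x (m + 3)) * (x 1 - x (m + 1)) *
            (psiSeq y x (m + 3) * psiSeq y x (m + 1)) ^ 2 := by
        rw [e1, e2]; ring
      _ = _ := by rw [e3]; linear_combination psiSeq y x (m + 2) ^ 4 * key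
  · obtain ⟨n, rfl⟩ : ∃ j, n = j + 2 := ⟨n - 2, by omega⟩
    obtain ⟨d, rfl⟩ : ∃ j, m = n + 2 + (j + 1) := ⟨m - (n + 3), by omega⟩
    set m := n + 2 + (d + 1) with hm
    have e1 := h.psi_succ_mul (n := m + n) (by omega)
    have e2 := h.psi_succ_mul (n := d + 1) (by omega)
    have e3 := ih (n + 1) (by omega) (by omega) m (by omega) (by omega)
    have e4 := ih n (by omega) (by omega) m (by omega) (by omega)
    have e5 := h.psi_succ_mul (n := n) (by omega)
    have e6 := h.add m (n + 1) (by omega) (by omega) (by omega) (x 1)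
    have e7 := h.add (n + 1) 1 (by omega) (by omega) (by omega) (x m)
    simp only [show m - (n + 2) = d + 1 by omega, show m - (n + 1) = d + 2 by omega,
      show m - n = d + 3 by omega, show n + 1 - 1 = n by omega,
      show d + 1 + 2 = d + 3 by omega, show d + 1 + 1 = d + 2 by omega,
      show n + 1 + 1 = n + 2 by omega, ← add_assoc] at *
    have hx := h.ne m n (by omega) (by omega) (by omega)
    have c1 := h.psi_ne_zero m (by omega) (by omega)
    have c2 := h.psi_ne_zero n (by omega) (by omega)
    have c : (x n - x m) * psiSeq y x m ^ 2 * psiSeq y x n ^ 2 ≠ 0 :=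
      mul_ne_zero (mul_ne_zero (sub_ne_zero.2 hx.symm) (pow_ne_zero 2 c1)) (pow_ne_zero 2 c2)
    apply mul_right_cancel₀ c
    simp only [addForm] at e6 e7
    -- the symmetry of `addForm` under a cyclic permutation of its three abscissas
    have key : (x 1 - x (m + n + 1)) * (x 1 - x (d + 2)) * (x (n + 1) - x m) ^ 2 =
        (x (n + 2) - x m) * (x n - x m) * (x 1 - x (n + 1)) ^ 2 := by
      linear_combination e6 - e7
    calc psiSeq y x (m + n + 2) * psiSeq y x (d + 1) *
          ((x n - x m) * psiSeq y x m ^ 2 * psiSeq y x n ^ 2)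
        = (psiSeq y x (m + n + 2) * psiSeq y x (m + n)) *
            (psiSeq y x (d + 3) * psiSeq y x (d + 1)) := by rw [← e4]; ring
      _ = (x 1 - x (m + n + 1)) * (x 1 - x (d + 2)) *
            (psiSeq y x (m + n + 1) * psiSeq y x (d + 2)) ^ 2 := by
        rw [e1, e2]; ring
      _ = (x (n + 2) - x m) * (x n - x m) * psiSeq y x m ^ 4 *
            ((x 1 - x (n + 1)) * psiSeq y x (n + 1) ^ 2) ^ 2 := by
        rw [e3]; linear_combination psiSeq y x m ^ 4 * psiSeq y x (n + 1) ^ 4 * key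
      _ = _ := by rw [← e5]; ring

variable (a b) in
omit [CharZero k] in
theorem eval_Ψ₂Sq (h : IsMultipleSeq a b y x N) :
    (curve a b).Ψ₂Sq.eval (x 1) = 4 * y ^ 2 := by
  simp only [WeierstrassCurve.Ψ₂Sq, WeierstrassCurve.b₂, WeierstrassCurve.b₄, WeierstrassCurve.b₆,
    curve]
  simp
  linear_combination -4 * h.sq

/-- The division polynomials at `P` are given by the multiples of `P`. -/
theorem eval_preΨ' (h : IsMultipleSeq a b y x N) (n : ℕ) (hn : n ≤ N) :
    ((curve a b).preΨ' n).eval (x 1) * (if Even n then 2 * y else 1) = psiSeq y x n := by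
  have hy := h.y_ne
  induction n using Nat.strong_induction_on with
  | _ n ih =>
  obtain rfl | rfl | rfl | rfl | rfl | hn5 :
    n = 0 ∨ n = 1 ∨ n = 2 ∨ n = 3 ∨ n = 4 ∨ 5 ≤ n := by omega
  · simp [psiSeq]
  · simp [psiSeq]
  · simp [psiSeq]
  · have hd := h.dup
    simp only [WeierstrassCurve.preΨ'_three, WeierstrassCurve.Ψ₃, WeierstrassCurve.b₂,
      WeierstrassCurve.b₄, WeierstrassCurve.b₆, WeierstrassCurve.b₈, curve, psiSeq]
    rw [if_neg (by decide)]
    simp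
    linear_combination hd - 4 * x 1 * h.sq
  · have hd := h.dup
    have h0 := h.add 2 1 le_rfl (by omega) (by omega) 0
    have h1 := h.add 2 1 le_rfl (by omega) (by omega) 1
    simp only [addForm] at h0 h1
    norm_num at h0 h1
    have hs : (x 3 + x 1) * (x 2 - x 1) ^ 2 =
        2 * ((x 1 * x 2 + a) * (x 1 + x 2) + 2 * b) := by linear_combination h0 - h1
    have hp : (4 * y ^ 2) * ((curve a b).preΨ' 4).eval (x 1) =
        (4 * y ^ 2) ^ 2 * (2 * x 1 * (x 1 - x 2) ^ 2 -
          2 * ((x 1 * x 2 + a) * (x 1 + x 2) + 2 * b)) := by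
      have : (4 * y ^ 2) ^ 2 * (2 * x 1 * (x 1 - x 2) ^ 2 -
          2 * ((x 1 * x 2 + a) * (x 1 + x 2) + 2 * b)) =
          2 * x 1 * (4 * y ^ 2 * x 1 - 4 * y ^ 2 * x 2) ^ 2 -
          2 * ((x 1 * (4 * y ^ 2 * x 2) + a * (4 * y ^ 2)) *
            (4 * y ^ 2 * x 1 + 4 * y ^ 2 * x 2) + 2 * b * (4 * y ^ 2) ^ 2) := by ring
      rw [this, hd, h.sq]
      simp only [WeierstrassCurve.preΨ'_four, WeierstrassCurve.preΨ₄, WeierstrassCurve.b₂,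
        WeierstrassCurve.b₄, WeierstrassCurve.b₆, WeierstrassCurve.b₈, curve]
      simp
      ring
    rw [if_pos (by decide)]
    simp only [psiSeq]
    have hy4 : 4 * y ^ 2 ≠ 0 := mul_ne_zero (by norm_num) (pow_ne_zero 2 hy)
    field_simp
    apply mul_left_cancel₀ hy4
    linear_combination hp + (4 * y ^ 2) ^ 2 * hs
  · rcases Nat.even_or_odd' n with ⟨j, rfl | rfl⟩
    · obtain ⟨m, rfl⟩ : ∃ m, j = m + 3 := ⟨j - 3, by omega⟩
      have i1 := ih (m + 1) (by omega) (by omega)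
      have i2 := ih (m + 2) (by omega) (by omega)
      have i3 := ih (m + 3) (by omega) (by omega)
      have i4 := ih (m + 4) (by omega) (by omega)
      have i5 := ih (m + 5) (by omega) (by omega)
      have e1 := h.psi_add_mul_psi_sub (m + 2) (by omega) (m + 4) (by omega) (by omega)
      have e2 := h.psi_succ_mul (n := m + 1) (by omega)
      have e3 := h.psi_succ_mul (n := m + 3) (by omega)
      simp only [show m + 4 + (m + 2) = 2 * (m + 3) by omega,
        show m + 4 - (m + 2) = 2 by omega, show psiSeq y x 2 = 2 * y by simp [psiSeq],
        show m + 1 + 2 = m + 3 by omega, show m + 1 + 1 = m + 2 by omega,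
        show m + 3 + 2 = m + 5 by omega, show m + 3 + 1 = m + 4 by omega] at e1 e2 e3
      have hy2 : 2 * y ≠ 0 := mul_ne_zero two_ne_zero hy
      have e4 : psiSeq y x (2 * (m + 3)) * (2 * y) =
          psiSeq y x (m + 3) * (psiSeq y x (m + 5) * psiSeq y x (m + 2) ^ 2 -
            psiSeq y x (m + 1) * psiSeq y x (m + 4) ^ 2) := by
        rw [e1]; linear_combination (-psiSeq y x (m + 2) ^ 2) * e3 + psiSeq y x (m + 4) ^ 2 * e2
      rw [if_pos (even_two_mul _), WeierstrassCurve.preΨ'_even]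
      apply mul_right_cancel₀ hy2
      rw [e4, ← i1, ← i2, ← i3, ← i4, ← i5]
      rcases Nat.even_or_odd m with hm | hm
      · have o1 : ¬ Even (m + 1) := by simpa [parity_simps] using hm
        have o3 : ¬ Even (m + 3) := by simpa [parity_simps] using hm
        have o5 : ¬ Even (m + 5) := by simpa [parity_simps] using hm
        have o2 : Even (m + 2) := by simpa [parity_simps] using hm
        have o4 : Even (m + 4) := by simpa [parity_simps] using hm
        simp only [o1, o2, o3, o4, o5, if_true, if_false]
        simp
        ring
      · rw [← Nat.not_even_iff_odd] at hm
        have o1 : Even (m + 1) := by simpa [parity_simps] using hm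
        have o3 : Even (m + 3) := by simpa [parity_simps] using hm
        have o5 : Even (m + 5) := by simpa [parity_simps] using hm
        have o2 : ¬ Even (m + 2) := by simpa [parity_simps] using hm
        have o4 : ¬ Even (m + 4) := by simpa [parity_simps] using hm
        simp only [o1, o2, o3, o4, o5, if_true, if_false]
        simp
        ring
    · obtain ⟨m, rfl⟩ : ∃ m, j = m + 2 := ⟨j - 2, by omega⟩
      have i1 := ih (m + 1) (by omega) (by omega)
      have i2 := ih (m + 2) (by omega) (by omega)
      have i3 := ih (m + 3) (by omega) (by omega)
      have i4 := ih (m + 4) (by omega) (by omega)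
      have e1 := h.psi_add_mul_psi_sub (m + 2) (by omega) (m + 3) (by omega) (by omega)
      have e2 := h.psi_succ_mul (n := m + 1) (by omega)
      have e3 := h.psi_succ_mul (n := m + 2) (by omega)
      simp only [show m + 3 + (m + 2) = 2 * (m + 2) + 1 by omega,
        show m + 3 - (m + 2) = 1 by omega, show psiSeq y x 1 = 1 by simp [psiSeq],
        show m + 1 + 2 = m + 3 by omega, show m + 1 + 1 = m + 2 by omega,
        show m + 2 + 2 = m + 4 by omega] at e1 e2 e3
      have e4 : psiSeq y x (2 * (m + 2) + 1) =
          psiSeq y x (m + 4) * psiSeq y x (m + 2) ^ 3 -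
            psiSeq y x (m + 1) * psiSeq y x (m + 3) ^ 3 := by
        linear_combination e1 - psiSeq y x (m + 2) ^ 2 * e3 + psiSeq y x (m + 3) ^ 2 * e2
      rw [if_neg (by simp [parity_simps]), WeierstrassCurve.preΨ'_odd, e4, ← i1, ← i2, ← i3, ← i4]
      have hΨ := h.eval_Ψ₂Sq a b
      rcases Nat.even_or_odd m with hm | hm
      · have o1 : ¬ Even (m + 1) := by simpa [parity_simps] using hm
        have o3 : ¬ Even (m + 3) := by simpa [parity_simps] using hm
        have o2 : Even (m + 2) := by simpa [parity_simps] using hm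
        have o4 : Even (m + 4) := by simpa [parity_simps] using hm
        simp only [hm, o1, o2, o3, o4, if_true, if_false]
        simp [hΨ]
        ring
      · rw [← Nat.not_even_iff_odd] at hm
        have o1 : Even (m + 1) := by simpa [parity_simps] using hm
        have o3 : Even (m + 3) := by simpa [parity_simps] using hm
        have o2 : ¬ Even (m + 2) := by simpa [parity_simps] using hm
        have o4 : ¬ Even (m + 4) := by simpa [parity_simps] using hm
        simp only [hm, o1, o2, o3, o4, if_true, if_false]
        simp [hΨ]
        ring

theorem eval_ΨSq (h : IsMultipleSeq a b y x N) {n : ℕ} (hn : n < N) :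
    ((curve a b).ΨSq n).eval (x 1) = psiSeq y x n ^ 2 := by
  rw [← h.eval_preΨ' n hn.le, WeierstrassCurve.ΨSq_ofNat]
  split_ifs <;> simp [h.eval_Ψ₂Sq a b]
  ring

theorem eval_ΨSq_ne_zero (h : IsMultipleSeq a b y x N) {n : ℕ} (hn1 : 1 ≤ n) (hn : n < N) :
    ((curve a b).ΨSq n).eval (x 1) ≠ 0 := by
  rw [h.eval_ΨSq hn]
  exact pow_ne_zero 2 (h.psi_ne_zero n hn1 hn)

/-- `x(nP) = φ_n(P) / ψ_n(P)²`. -/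
theorem mul_eval_ΨSq (h : IsMultipleSeq a b y x N) {n : ℕ} (hn1 : 1 ≤ n) (hn : n < N) :
    x n * ((curve a b).ΨSq n).eval (x 1) = ((curve a b).Φ n).eval (x 1) := by
  rw [h.eval_ΨSq hn]
  obtain ⟨n, rfl⟩ : ∃ j, n = j + 1 := ⟨n - 1, by omega⟩
  have e := h.psi_succ_mul (n := n) (by omega)
  have e1 := h.eval_preΨ' n (by omega)
  have e2 := h.eval_preΨ' (n + 1) (by omega)
  have e3 := h.eval_preΨ' (n + 2) (by omega)
  push_cast
  rw [WeierstrassCurve.Φ_ofNat]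
  have key : x (n + 1) * psiSeq y x (n + 1) ^ 2 =
      x 1 * psiSeq y x (n + 1) ^ 2 - psiSeq y x (n + 2) * psiSeq y x n := by
    linear_combination e
  rw [key, ← e1, ← e2, ← e3]
  have hΨ := h.eval_Ψ₂Sq a b
  rcases Nat.even_or_odd n with hm | hm
  · have o1 : ¬ Even (n + 1) := by simpa [parity_simps] using hm
    have o2 : Even (n + 2) := by simpa [parity_simps] using hm
    simp only [hm, o1, o2, if_true, if_false]
    simp [hΨ]
    ring
  · rw [← Nat.not_even_iff_odd] at hm
    have o1 : Even (n + 1) := by simpa [parity_simps] using hm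
    have o2 : ¬ Even (n + 2) := by simpa [parity_simps] using hm
    simp only [hm, o1, o2, if_true, if_false]
    simp [hΨ]
    ring

/-- The `N`-th division polynomial vanishes at a point of odd order `N`. -/
theorem eval_preΨ'_eq_zero (h : IsMultipleSeq a b y x N) (hN : 3 ≤ N) (hodd : Odd N)
    (hx : x (N - 1) = x 1) : ((curve a b).preΨ' N).eval (x 1) = 0 := by
  obtain ⟨n, rfl⟩ : ∃ j, N = j + 2 := ⟨N - 2, by omega⟩
  have e := h.psi_succ_mul (n := n) le_rfl
  rw [show n + 2 - 1 = n + 1 by omega] at hx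
  rw [hx, sub_self, zero_mul] at e
  have h1 := (mul_eq_zero.1 e).resolve_right (h.psi_ne_zero n (by omega) (by omega))
  have h2 := h.eval_preΨ' (n + 2) le_rfl
  rwa [if_neg (Nat.not_even_iff_odd.2 hodd), mul_one, h1] at h2

end IsMultipleSeq

end HeckeGF

namespace PeriodPair

variable (L : PeriodPair)

/-! ### Homogeneity, points of finite order, and isogenies -/

/-- Multiplication by `c` as a bijection between the lattices of `L` and `L'`. -/
def scaleEquiv {L L' : PeriodPair} {c : ℂ} (hc : c ≠ 0)
    (h : ∀ w, c * w ∈ L'.lattice ↔ w ∈ L.lattice) : L.lattice ≃ L'.lattice where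
  toFun l := ⟨c * l, (h l).2 l.2⟩
  invFun l := ⟨c⁻¹ * l, (h _).1 (by rw [mul_inv_cancel_left₀ hc]; exact l.2)⟩
  left_inv l := Subtype.ext (inv_mul_cancel_left₀ hc _)
  right_inv l := Subtype.ext (mul_inv_cancel_left₀ hc _)

theorem weierstrassP_scale {L L' : PeriodPair} {c : ℂ} (hc : c ≠ 0)
    (h : ∀ w, c * w ∈ L'.lattice ↔ w ∈ L.lattice) (z : ℂ) :
    L'.weierstrassP (c * z) = (c ^ 2)⁻¹ * L.weierstrassP z := by
  rw [weierstrassP, weierstrassP, ← (scaleEquiv hc h).tsum_eq, ← tsum_mul_left]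
  congr 1 with l
  simp only [scaleEquiv, Equiv.coe_fn_mk, ← mul_sub, mul_pow]
  simp [mul_sub, mul_comm]

theorem weierstrassP_eq_of_sub_mem {z w : ℂ} (h : z - w ∈ L.lattice) :
    L.weierstrassP z = L.weierstrassP w := by
  have := L.weierstrassP_add_coe w ⟨z - w, h⟩
  simpa using this

/-- The group generated by `L` and the point `z` of order `N` is, up to the factor `c`, the lattice
`L'`; summing `l⁻ⁿ` over the cosets of `L` gives the Eisenstein series of `L'`. -/
theorem G_of_cosets {L L' : PeriodPair} {c : ℂ} (hc : c ≠ 0) {N : ℕ} (hN : 0 < N) {z : ℂ}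
    (hz : ∀ n, 1 ≤ n → n < N → (n : ℂ) * z ∉ L.lattice)
    (h : ∀ w, c * w ∈ L'.lattice ↔ ∃ l < N, w + l * z ∈ L.lattice) {n : ℕ} (hn : 2 < n) :
    c ^ n * L'.G n = L.G n + ∑ l ∈ Finset.Ico 1 N, L.sumInvPow (l * z) n := by
  have key : ∀ (i j : Fin N) (l m : L.lattice), (l : ℂ) - i * z = m - j * z → i = j := by
    intro i j l m e
    wlog hij : i ≤ j generalizing i j l m
    · exact (this j i m l e.symm (le_of_not_ge hij)).symm
    by_contra hne
    have hlt : (i : ℕ) < j := lt_of_le_of_ne hij (fun h => hne (Fin.ext h))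
    refine hz (j - i) (by omega) (by omega) ?_
    rw [Nat.cast_sub hlt.le]
    have : ((j : ℂ) - i) * z = m - l := by linear_combination e
    rw [this]
    exact sub_mem m.2 l.2
  let f : Fin N × L.lattice → L'.lattice := fun p =>
    ⟨c * (p.2 - p.1 * z), (h _).2 ⟨p.1, p.1.2, by simp⟩⟩
  have hf : Function.Bijective f := by
    constructor
    · rintro ⟨i, l⟩ ⟨j, m⟩ e
      have e' := mul_left_cancel₀ hc (congrArg Subtype.val e)
      obtain rfl := key i j l m e'
      simpa using e'
    · rintro ⟨w, hw⟩
      have hw' : c * (c⁻¹ * w) ∈ L'.lattice := by rwa [mul_inv_cancel_left₀ hc]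
      obtain ⟨l, hl, hm⟩ := (h _).1 hw'
      refine ⟨(⟨l, hl⟩, ⟨_, hm⟩), Subtype.ext ?_⟩
      simp [f, mul_inv_cancel_left₀ hc]
  have hs : Summable fun p : Fin N × L.lattice => ((((p.2 : ℂ) - p.1 * z) ^ n)⁻¹ : ℂ) := by
    have h1 := (L'.hasSum_sumInvPow 0 hn).summable
    have h2 := ((Equiv.ofBijective f hf).summable_iff.2 h1).mul_left (c ^ n)
    refine h2.congr fun p => ?_
    simp only [Function.comp, Equiv.ofBijective_apply, f, sub_zero, mul_pow, mul_inv]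
    rw [mul_inv_cancel_left₀ (pow_ne_zero n hc)]
  have e1 : c ^ n * L'.G n = ∑' p : Fin N × L.lattice, ((((p.2 : ℂ) - p.1 * z) ^ n)⁻¹ : ℂ) := by
    rw [G, ← (Equiv.ofBijective f hf).tsum_eq, ← tsum_mul_left]
    congr 1 with p
    simp only [Equiv.ofBijective_apply, f, mul_pow, mul_inv]
    rw [mul_inv_cancel_left₀ (pow_ne_zero n hc)]
  rw [e1, hs.tsum_prod, tsum_fintype,
    Fin.sum_univ_eq_sum_range (fun i => ∑' l : L.lattice, (((l : ℂ) - i * z) ^ n)⁻¹) N,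
    Finset.range_eq_Ico, Finset.sum_eq_sum_Ico_succ_bot hN]
  simp [G, sumInvPow]

/-- The coefficient `a` of the equation `y² = x³ + a x + b` satisfied by `x = μ² ℘`,
`y = μ³ ℘' / 2`. -/
def scaledA (μ : ℂ) : ℂ := -(μ ^ 4 * L.g₂) / 4

/-- The coefficient `b` of the equation `y² = x³ + a x + b` satisfied by `x = μ² ℘`,
`y = μ³ ℘' / 2`. -/
def scaledB (μ : ℂ) : ℂ := -(μ ^ 6 * L.g₃) / 4

/-- Vélu's formulas for the isogenous curve. -/
theorem scaledA_of_cosets {L L' : PeriodPair} {c : ℂ} (hc : c ≠ 0) {N : ℕ} (hN : 0 < N) {z : ℂ}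
    (hz : ∀ n, 1 ≤ n → n < N → (n : ℂ) * z ∉ L.lattice)
    (h : ∀ w, c * w ∈ L'.lattice ↔ ∃ l < N, w + l * z ∈ L.lattice) (μ : ℂ) :
    c ^ 4 * L'.scaledA μ = L.scaledA μ -
      15 * ∑ l ∈ Finset.Ico 1 N, (μ ^ 2 * L.weierstrassP (l * z)) ^ 2 -
      5 * ((N : ℂ) - 1) * L.scaledA μ := by
  have e := G_of_cosets hc hN hz h (n := 4) (by norm_num)
  rw [Finset.sum_congr rfl fun l hl => L.sumInvPow_four
    (hz l (Finset.mem_Ico.1 hl).1 (Finset.mem_Ico.1 hl).2), Finset.sum_sub_distrib] at e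
  simp only [Finset.sum_const, Nat.card_Ico, nsmul_eq_mul, Nat.cast_sub hN, Nat.cast_one] at e
  simp only [mul_pow, ← Finset.mul_sum, scaledA]
  simp only [g₂] at *
  linear_combination (-15 * μ ^ 4) * e

theorem scaledB_of_cosets {L L' : PeriodPair} {c : ℂ} (hc : c ≠ 0) {N : ℕ} (hN : 0 < N) {z : ℂ}
    (hz : ∀ n, 1 ≤ n → n < N → (n : ℂ) * z ∉ L.lattice)
    (h : ∀ w, c * w ∈ L'.lattice ↔ ∃ l < N, w + l * z ∈ L.lattice) (μ : ℂ) :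
    c ^ 6 * L'.scaledB μ = L.scaledB μ -
      35 * ∑ l ∈ Finset.Ico 1 N, (μ ^ 2 * L.weierstrassP (l * z)) ^ 3 -
      21 * L.scaledA μ * ∑ l ∈ Finset.Ico 1 N, (μ ^ 2 * L.weierstrassP (l * z)) -
      14 * ((N : ℂ) - 1) * L.scaledB μ := by
  have e := G_of_cosets hc hN hz h (n := 6) (by norm_num)
  rw [Finset.sum_congr rfl fun l hl => L.sumInvPow_six
    (hz l (Finset.mem_Ico.1 hl).1 (Finset.mem_Ico.1 hl).2), Finset.sum_sub_distrib,
    Finset.sum_sub_distrib] at e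
  simp only [Finset.sum_const, Nat.card_Ico, nsmul_eq_mul, Nat.cast_sub hN, Nat.cast_one,
    ← Finset.mul_sum] at e
  simp only [mul_pow, ← Finset.mul_sum, scaledA, scaledB]
  simp only [g₃] at *
  linear_combination (-35 * μ ^ 6) * e

/-- The product of the `x`-coordinates of `z + w` and `z - w`, shifted by `t`. -/
theorem weierstrassP_add_sub {z w : ℂ} (hz : z ∉ L.lattice) (hw : w ∉ L.lattice)
    (ha : z + w ∉ L.lattice) (hs : z - w ∉ L.lattice)
    (hne : L.weierstrassP z ≠ L.weierstrassP w) (t : ℂ) :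
    (L.weierstrassP (z + w) - t) * (L.weierstrassP (z - w) - t) *
        (L.weierstrassP z - L.weierstrassP w) ^ 2 =
      HeckeGF.addForm (-L.g₂ / 4) (-L.g₃ / 4) (L.weierstrassP z) (L.weierstrassP w) t := by
  have e1 := L.weierstrassP_add hz hw ha
  have e2 := L.weierstrassP_add hz (w := -w) (by simpa using hw)
    (by simpa [← sub_eq_add_neg] using hs)
  rw [weierstrassP_neg, derivWeierstrassP_neg, ← sub_eq_add_neg] at e2
  have hp := L.derivWeierstrassP_sq z hz
  have hq := L.derivWeierstrassP_sq w hw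
  generalize L.weierstrassP (z + w) = s at *
  generalize L.weierstrassP (z - w) = d at *
  generalize L.weierstrassP z = p at *
  generalize L.weierstrassP w = q at *
  generalize L.derivWeierstrassP z = p' at *
  generalize L.derivWeierstrassP w = q' at *
  have hne' : (16 : ℂ) * (p - q) ^ 2 ≠ 0 :=
    mul_ne_zero (by norm_num) (pow_ne_zero 2 (sub_ne_zero.2 hne))
  apply mul_left_cancel₀ hne'
  have f1 : 4 * (s - t) * (p - q) ^ 2 = (p' - q') ^ 2 - 4 * (p + q + t) * (p - q) ^ 2 := by
    linear_combination e1
  have f2 : 4 * (d - t) * (p - q) ^ 2 = (p' + q') ^ 2 - 4 * (p + q + t) * (p - q) ^ 2 := by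
    linear_combination e2
  have f3 : (p' - q') ^ 2 * (p' + q') ^ 2 =
      ((p - q) * (4 * (p ^ 2 + p * q + q ^ 2) - L.g₂)) ^ 2 := by
    have : p' ^ 2 - q' ^ 2 = (p - q) * (4 * (p ^ 2 + p * q + q ^ 2) - L.g₂) := by
      linear_combination hp - hq
    rw [← this]
    ring
  calc 16 * (p - q) ^ 2 * ((s - t) * (d - t) * (p - q) ^ 2)
      = (4 * (s - t) * (p - q) ^ 2) * (4 * (d - t) * (p - q) ^ 2) := by ring
    _ = ((p - q) * (4 * (p ^ 2 + p * q + q ^ 2) - L.g₂)) ^ 2 -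
        4 * (p + q + t) * (p - q) ^ 2 * (2 * (p' ^ 2 + q' ^ 2)) +
        (4 * (p + q + t) * (p - q) ^ 2) ^ 2 := by
      rw [f1, f2]
      linear_combination f3
    _ = _ := by
      rw [hp, hq, HeckeGF.addForm]
      ring

/-- The `x`-coordinates of the multiples of a point of order at least `N`. -/
theorem isMultipleSeq (hD : L.g₂ ^ 3 - 27 * L.g₃ ^ 2 ≠ 0) {μ : ℂ} (hμ : μ ≠ 0) {N : ℕ}
    (hN : 3 ≤ N) {z : ℂ} (hz : ∀ n, 1 ≤ n → n < N → (n : ℂ) * z ∉ L.lattice) :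
    HeckeGF.IsMultipleSeq (L.scaledA μ) (L.scaledB μ) (μ ^ 3 * L.derivWeierstrassP z / 2)
      (fun n => μ ^ 2 * L.weierstrassP (n * z)) N := by
  have hz1 : z ∉ L.lattice := by simpa using hz 1 le_rfl (by omega)
  have hz2 : z + z ∉ L.lattice := by
    have := hz 2 (by omega) (by omega)
    rwa [Nat.cast_two, two_mul] at this
  have hsq := L.derivWeierstrassP_sq z hz1
  have hm : ∀ m n : ℕ, 1 ≤ n → n < m → m + n < N → L.weierstrassP (m * z) ≠ L.weierstrassP (n * z) ∧
      (m : ℂ) * z ∉ L.lattice ∧ (n : ℂ) * z ∉ L.lattice ∧ (m : ℂ) * z + n * z ∉ L.lattice ∧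
      (m : ℂ) * z - n * z ∉ L.lattice := by
    intro m n h1 h2 h3
    have i1 := hz m (by omega) (by omega)
    have i2 := hz n (by omega) (by omega)
    have i3 := hz (m + n) (by omega) (by omega)
    have i4 := hz (m - n) (by omega) (by omega)
    rw [Nat.cast_add, add_mul] at i3
    rw [Nat.cast_sub h2.le, sub_mul] at i4
    exact ⟨L.weierstrassP_ne hD i1 i2 i3 i4, i1, i2, i3, i4⟩
  refine ⟨?_, ?_, ?_, ?_, ?_⟩
  · simp only [scaledA, scaledB, Nat.cast_one, one_mul]
    linear_combination (μ ^ 6 / 4) * hsq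
  · exact div_ne_zero (mul_ne_zero (pow_ne_zero 3 hμ) (L.derivWeierstrassP_ne_zero hD hz1 hz2))
      two_ne_zero
  · have e := L.weierstrassP_two_mul hz1 hz2
    simp only [scaledA, scaledB, Nat.cast_one, one_mul, Nat.cast_two, two_mul z]
    linear_combination (μ ^ 8 / 4) * e - (2 * μ ^ 8 * L.weierstrassP z) * hsq
  · intro m n h1 h2 h3 t
    obtain ⟨i0, i1, i2, i3, i4⟩ := hm m n h1 h2 h3
    have e := L.weierstrassP_add_sub i1 i2 i3 i4 i0 (t / μ ^ 2)
    simp only [HeckeGF.addForm, scaledA, scaledB, Nat.cast_add, add_mul, Nat.cast_sub h2.le,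
      sub_mul] at *
    have e2 := congrArg (μ ^ 8 * ·) e
    field_simp at e2 ⊢
    linear_combination e2
  · intro m n h1 h2 h3 e
    exact (hm m n h1 h2 h3).1 (mul_left_cancel₀ (pow_ne_zero 2 hμ) e)

/-- The `x`-coordinate of a point of order `2` is a root of the cubic. -/
theorem cubic_eq_zero {z : ℂ} (hz : z ∉ L.lattice) (hz2 : z + z ∈ L.lattice) (μ : ℂ) :
    (μ ^ 2 * L.weierstrassP z) ^ 3 + L.scaledA μ * (μ ^ 2 * L.weierstrassP z) + L.scaledB μ =
      0 := by
  have e := L.derivWeierstrassP_sq z hz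
  rw [L.derivWeierstrassP_eq_zero hz2] at e
  simp only [scaledA, scaledB]
  linear_combination (-μ ^ 6 / 4) * e

end PeriodPair

namespace HeckeGF

/-! ### The lattices `ℤ + ℤ τ` -/

theorem mem_lattice_iff {τ : ℍ} {z : ℂ} :
    z ∈ (lattice τ).lattice ↔ ∃ m n : ℤ, z = m * (τ : ℂ) + n := by
  rw [PeriodPair.mem_lattice]
  constructor
  · rintro ⟨m, n, h⟩
    exact ⟨n, m, by rw [← h]; simp [lattice, add_comm]⟩
  · rintro ⟨m, n, h⟩
    exact ⟨n, m, by rw [h]; simp [lattice, add_comm]⟩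

theorem mul_coe_add_eq_zero {τ : ℍ} {m n : ℝ} (h : (m : ℂ) * τ + n = 0) : m = 0 ∧ n = 0 := by
  have := LinearIndependent.pair_iff.1 (indep_one_tau τ) n m (by simpa [add_comm] using h)
  exact ⟨this.2, this.1⟩

theorem div_mem_lattice_iff {τ : ℍ} {N : ℕ} [NeZero N] {m n : ℤ} :
    ((m : ℂ) * τ + n) / N ∈ (lattice τ).lattice ↔ (m : ZMod N) = 0 ∧ (n : ZMod N) = 0 := by
  have hN : (N : ℂ) ≠ 0 := Nat.cast_ne_zero.2 (NeZero.ne N)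
  simp only [ZMod.intCast_zmod_eq_zero_iff_dvd, mem_lattice_iff]
  constructor
  · rintro ⟨p, q, h⟩
    rw [div_eq_iff hN] at h
    have := mul_coe_add_eq_zero (τ := τ) (m := m - p * N) (n := n - q * N)
      (by push_cast; linear_combination h)
    refine ⟨⟨p, ?_⟩, ⟨q, ?_⟩⟩
    · have := sub_eq_zero.1 this.1
      rw [mul_comm]
      exact_mod_cast this
    · have := sub_eq_zero.1 this.2
      rw [mul_comm]
      exact_mod_cast this
  · rintro ⟨⟨p, rfl⟩, ⟨q, rfl⟩⟩
    refine ⟨p, q, ?_⟩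
    push_cast
    field_simp

/-- The lattice `ℤ + ℤ τ` indexed by `ℤ²`: the vector `(m, n)` corresponds to `m τ + n`. -/
def latticeEquiv (τ : ℍ) : (Fin 2 → ℤ) ≃ (lattice τ).lattice :=
  ((finTwoArrowEquiv ℤ).trans (Equiv.prodComm ℤ ℤ)).trans (lattice τ).latticeEquivProd.symm.toEquiv

theorem coe_latticeEquiv (τ : ℍ) (m : Fin 2 → ℤ) :
    (latticeEquiv τ m : ℂ) = m 0 * (τ : ℂ) + m 1 := by
  have := (lattice τ).latticeEquiv_symm_apply (m 1, m 0)
  simp only [latticeEquiv, Equiv.trans_apply]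
  refine this.trans ?_
  simp [lattice, add_comm]

theorem G_lattice (τ : ℍ) {k : ℕ} (hk : 3 ≤ k) :
    (lattice τ).G k = 2 * riemannZeta k * E hk τ := by
  have h1 := tsum_eisSummand_eq_riemannZeta_mul_eisensteinSeries hk τ
  have h2 : E hk τ = 1 / 2 * eisensteinSeries (N := 1) 0 k τ := rfl
  rw [h2, PeriodPair.G, ← (latticeEquiv τ).tsum_eq]
  simp only [coe_latticeEquiv]
  simp only [EisensteinSeries.eisSummand, zpow_neg, zpow_natCast] at h1
  rw [h1]
  ring

/-- The factor `μ` with `x = μ² ℘ = -π⁻² ℘`. -/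
def scaleFactor : ℂ := Complex.I / Real.pi

theorem scaleFactor_ne_zero : scaleFactor ≠ 0 :=
  div_ne_zero Complex.I_ne_zero (Complex.ofReal_ne_zero.2 Real.pi_ne_zero)

theorem scaleFactor_sq : scaleFactor ^ 2 = -(1 / (Real.pi : ℂ) ^ 2) := by
  rw [scaleFactor, div_pow, Complex.I_sq]
  ring

theorem riemannZeta_six : riemannZeta 6 = (Real.pi : ℂ) ^ 6 / 945 := by
  have := riemannZeta_two_mul_nat (k := 3) (by norm_num)
  norm_num at this
  rw [this]
  have hb : bernoulli 6 = 1 / 42 := by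
    rw [bernoulli_eq_bernoulli'_of_ne_one (by norm_num)]
    rw [bernoulli'_def]
    norm_num [Finset.sum_range_succ, Nat.choose]
    have h5 : bernoulli' 5 = 0 := bernoulli'_eq_zero_of_odd (by decide) (by norm_num)
    rw [h5]
    norm_num
  rw [hb]
  norm_num [Nat.factorial]
  ring

theorem scaledA_lattice (τ : ℍ) : (lattice τ).scaledA scaleFactor = aForm τ := by
  have hp : (Real.pi : ℂ) ≠ 0 := Complex.ofReal_ne_zero.2 Real.pi_ne_zero
  have h4 : aForm τ = -(1 / 3) * E₄ τ := rfl
  have hz : riemannZeta (4 : ℕ) = (Real.pi : ℂ) ^ 4 / 90 := by exact_mod_cast riemannZeta_four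
  rw [h4, PeriodPair.scaledA, PeriodPair.g₂, G_lattice τ (by norm_num), hz,
    show scaleFactor ^ 4 = (scaleFactor ^ 2) ^ 2 by ring, scaleFactor_sq]
  field_simp
  ring

theorem scaledB_lattice (τ : ℍ) : (lattice τ).scaledB scaleFactor = bForm τ := by
  have hp : (Real.pi : ℂ) ≠ 0 := Complex.ofReal_ne_zero.2 Real.pi_ne_zero
  have h6 : bForm τ = 2 / 27 * E₆ τ := rfl
  have hz : riemannZeta (6 : ℕ) = (Real.pi : ℂ) ^ 6 / 945 := by exact_mod_cast riemannZeta_six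
  rw [h6, PeriodPair.scaledB, PeriodPair.g₃, G_lattice τ (by norm_num), hz,
    show scaleFactor ^ 6 = (scaleFactor ^ 2) ^ 3 by ring, scaleFactor_sq]
  field_simp
  ring

/-- Up to a constant factor, `4 a³ + 27 b²` is the discriminant `Δ`. -/
theorem disc_form_ne_zero (τ : ℍ) : 4 * aForm τ ^ 3 + 27 * bForm τ ^ 2 ≠ 0 := by
  have h4 : aForm τ = -(1 / 3) * E₄ τ := rfl
  have h6 : bForm τ = 2 / 27 * E₆ τ := rfl
  have h1 := discriminant_eq_E₄_cube_sub_E₆_sq τ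
  have h2 := discriminant_ne_zero τ
  intro h
  apply h2
  rw [h1]
  rw [h4, h6] at h
  linear_combination (-27 / 4 / 1728) * h

theorem disc_lattice_ne_zero (τ : ℍ) :
    (lattice τ).g₂ ^ 3 - 27 * (lattice τ).g₃ ^ 2 ≠ 0 := by
  intro h
  apply disc_form_ne_zero τ
  rw [← scaledA_lattice, ← scaledB_lattice, PeriodPair.scaledA, PeriodPair.scaledB]
  linear_combination (-scaleFactor ^ 12 / 16) * h

/-! ### The `x`-coordinates of the points of finite order -/

/-- The `x`-coordinate `-π⁻² ℘((u τ + w) / N; ℤ + ℤ τ)` of the point of `y² = x³ + a x + b` with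
index `(u, w) ∈ (ℤ/N)²`. -/
def torsionX (N : ℕ) (v : Fin 2 → ZMod N) (τ : ℍ) : ℂ :=
  scaleFactor ^ 2 * (lattice τ).weierstrassP ((((v 0).val : ℂ) * τ + (v 1).val) / N)

theorem natCast_mul_pt {N : ℕ} (v : Fin 2 → ZMod N) (τ : ℍ) (n : ℕ) :
    (n : ℂ) * ((((v 0).val : ℂ) * τ + (v 1).val) / N) =
      (((n * (v 0).val : ℤ) : ℂ) * τ + (n * (v 1).val : ℤ)) / N := by
  push_cast
  ring

variable {N : ℕ} [NeZero N]

theorem torsionX_intCast (m n : ℤ) (τ : ℍ) :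
    torsionX N ![(m : ZMod N), (n : ZMod N)] τ =
      scaleFactor ^ 2 * (lattice τ).weierstrassP (((m : ℂ) * τ + n) / N) := by
  rw [torsionX]
  congr 1
  apply PeriodPair.weierstrassP_eq_of_sub_mem
  have := (div_mem_lattice_iff (τ := τ) (N := N) (m := ((m : ZMod N).val : ℤ) - m)
    (n := ((n : ZMod N).val : ℤ) - n)).2 (by simp)
  convert this using 1
  push_cast
  simp
  ring

theorem torsionX_eq (v : Fin 2 → ZMod N) (τ : ℍ) (m n : ℤ) (h0 : (m : ZMod N) = v 0)
    (h1 : (n : ZMod N) = v 1) :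
    torsionX N v τ = scaleFactor ^ 2 * (lattice τ).weierstrassP (((m : ℂ) * τ + n) / N) := by
  rw [← torsionX_intCast, h0, h1]
  congr 1
  ext i
  fin_cases i <;> rfl

theorem xP_eq_torsionX : xP N = torsionX N ![0, 1] := by
  ext τ
  rw [torsionX_eq _ τ 0 1 (by simp) (by simp), xP, scaleFactor_sq]
  simp

theorem torsionX_neg (v : Fin 2 → ZMod N) (τ : ℍ) : torsionX N (-v) τ = torsionX N v τ := by
  rw [torsionX_eq (-v) τ (-(v 0).val) (-(v 1).val) (by simp) (by simp), torsionX,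
    ← PeriodPair.weierstrassP_neg]
  congr 2
  push_cast
  ring

theorem torsionX_nsmul (v : Fin 2 → ZMod N) (τ : ℍ) (n : ℕ) :
    torsionX N ((n : ZMod N) • v) τ = scaleFactor ^ 2 *
      (lattice τ).weierstrassP (n * ((((v 0).val : ℂ) * τ + (v 1).val) / N)) := by
  rw [natCast_mul_pt, torsionX_eq _ τ (n * (v 0).val) (n * (v 1).val) (by simp) (by simp)]

theorem natCast_mul_pt_notMem [Fact N.Prime] {v : Fin 2 → ZMod N} (hv : v ≠ 0) (τ : ℍ) (n : ℕ)
    (h1 : 1 ≤ n) (h2 : n < N) :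
    (n : ℂ) * ((((v 0).val : ℂ) * τ + (v 1).val) / N) ∉ (lattice τ).lattice := by
  rw [natCast_mul_pt, div_mem_lattice_iff]
  push_cast
  simp only [ZMod.natCast_val, ZMod.cast_id', id_eq, mul_eq_zero]
  have hn : (n : ZMod N) ≠ 0 := by
    rw [Ne, ZMod.natCast_eq_zero_iff]
    exact fun h => absurd (Nat.le_of_dvd (by omega) h) (by omega)
  rintro ⟨h3, h4⟩
  exact hv (by ext i; fin_cases i <;> [exact h3.resolve_left hn; exact h4.resolve_left hn])

theorem pt_notMem {v : Fin 2 → ZMod N} (hv : v ≠ 0) (τ : ℍ) :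
    (((v 0).val : ℂ) * τ + (v 1).val) / N ∉ (lattice τ).lattice := by
  have := div_mem_lattice_iff (τ := τ) (N := N) (m := (v 0).val) (n := (v 1).val)
  push_cast at this
  rw [this]
  simp only [ZMod.natCast_val, ZMod.cast_id', id_eq]
  rintro ⟨h3, h4⟩
  exact hv (by ext i; fin_cases i <;> [exact h3; exact h4])

/-- Two points have the same `x`-coordinate only if they are equal or opposite. -/
theorem eq_or_eq_neg_of_torsionX_eq {v w : Fin 2 → ZMod N} (hv : v ≠ 0) (hw : w ≠ 0) {τ : ℍ}
    (h : torsionX N v τ = torsionX N w τ) : v = w ∨ v = -w := by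
  by_contra! hc
  rw [torsionX, torsionX] at h
  refine (lattice τ).weierstrassP_ne (disc_lattice_ne_zero τ) (pt_notMem hv τ) (pt_notMem hw τ)
    ?_ ?_ (mul_left_cancel₀ (pow_ne_zero 2 scaleFactor_ne_zero) h)
  · have := div_mem_lattice_iff (τ := τ) (N := N) (m := (v 0).val + (w 0).val)
      (n := (v 1).val + (w 1).val)
    rw [← add_div, show ((((v 0).val : ℂ) * τ + (v 1).val) + (((w 0).val : ℂ) * τ + (w 1).val)) =
      (((v 0).val + (w 0).val : ℤ) : ℂ) * τ + ((v 1).val + (w 1).val : ℤ) by push_cast; ring, this]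
    push_cast
    simp only [ZMod.natCast_val, ZMod.cast_id', id_eq]
    rintro ⟨h3, h4⟩
    exact hc.2 (by
      ext i; fin_cases i <;> [exact eq_neg_of_add_eq_zero_left h3;
        exact eq_neg_of_add_eq_zero_left h4])
  · have := div_mem_lattice_iff (τ := τ) (N := N) (m := (v 0).val - (w 0).val)
      (n := (v 1).val - (w 1).val)
    rw [← sub_div, show ((((v 0).val : ℂ) * τ + (v 1).val) - (((w 0).val : ℂ) * τ + (w 1).val)) =
      (((v 0).val - (w 0).val : ℤ) : ℂ) * τ + ((v 1).val - (w 1).val : ℤ) by push_cast; ring, this]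
    push_cast
    simp only [ZMod.natCast_val, ZMod.cast_id', id_eq]
    rintro ⟨h3, h4⟩
    exact hc.1 (by ext i; fin_cases i <;> [exact sub_eq_zero.1 h3; exact sub_eq_zero.1 h4])

/-- For an odd prime `N`, the `x`-coordinates of the multiples of a point of order `N`. -/
theorem isMultipleSeq_torsionX [Fact N.Prime] (hN : 3 ≤ N) {v : Fin 2 → ZMod N} (hv : v ≠ 0)
    (τ : ℍ) : ∃ y, IsMultipleSeq (aForm τ) (bForm τ) y
      (fun n : ℕ => torsionX N ((n : ZMod N) • v) τ) N := by
  have := (lattice τ).isMultipleSeq (disc_lattice_ne_zero τ) scaleFactor_ne_zero hN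
    (natCast_mul_pt_notMem hv τ)
  rw [scaledA_lattice, scaledB_lattice] at this
  simp only [torsionX_nsmul]
  exact ⟨_, this⟩

/-- The roots of `torsionPoly` at the modular forms `a`, `b`. -/
theorem eval_torsionPoly_torsionX [Fact N.Prime] {v : Fin 2 → ZMod N} (hv : v ≠ 0) (τ : ℍ) :
    (torsionPoly (aForm τ) (bForm τ) N).eval (torsionX N v τ) = 0 := by
  rcases (Fact.out : N.Prime).eq_two_or_odd' with rfl | hodd
  · rw [torsionPoly, if_pos rfl, ← scaledA_lattice, ← scaledB_lattice, torsionX]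
    have h2 := (lattice τ).cubic_eq_zero (pt_notMem hv τ) (by
      have := div_mem_lattice_iff (τ := τ) (N := 2) (m := 2 * (v 0).val)
        (n := 2 * (v 1).val)
      have h2 : (2 : ZMod 2) = 0 := rfl
      rw [← two_mul]
      push_cast [h2] at this
      rw [Nat.cast_two, show ∀ z w : ℂ, 2 * ((z + w) / 2) = (2 * z + 2 * w) / 2 by
        intros; ring, ← mul_assoc, this]
      simp) scaleFactor
    simpa using h2
  · have h3 : 3 ≤ N := by
      have := (Fact.out : N.Prime).two_le
      rcases hodd with ⟨k, rfl⟩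
      omega
    obtain ⟨y, hy⟩ := isMultipleSeq_torsionX h3 hv τ
    have := hy.eval_preΨ'_eq_zero h3 hodd (by
      rw [Nat.cast_sub (by omega), ← torsionX_neg]
      simp)
    rw [torsionPoly, if_neg (by omega)]
    simpa using this

/-- The action of `SL(2, ℤ)`: `x_v` has weight `2`, and the index `v` is a row vector. -/
theorem torsionX_smul (v : Fin 2 → ZMod N) (γ : SL(2, ℤ)) (τ : ℍ) :
    torsionX N v (γ • τ) = denom γ τ ^ 2 *
      torsionX N
        (Matrix.vecMul v ((γ : Matrix (Fin 2) (Fin 2) ℤ).map (Int.cast : ℤ → ZMod N))) τ := by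
  obtain ⟨D, hD⟩ : ∃ D, D = (γ 1 0 : ℂ) * τ + γ 1 1 := ⟨_, rfl⟩
  have hd : denom γ τ = D := by simp [denom, hD]
  have hd0 : D ≠ 0 := hd ▸ denom_ne_zero _ _
  have hdet : (γ 0 0 : ℂ) * γ 1 1 - γ 0 1 * γ 1 0 = 1 := by
    have := γ.det_coe
    rw [Matrix.det_fin_two] at this
    exact_mod_cast this
  have hτ : ((γ • τ : ℍ) : ℂ) = ((γ 0 0 : ℂ) * τ + γ 0 1) / D := by
    simp [UpperHalfPlane.specialLinearGroup_apply, hD]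
  rw [torsionX_eq (Matrix.vecMul v _) τ ((v 0).val * γ 0 0 + (v 1).val * γ 1 0)
    ((v 0).val * γ 0 1 + (v 1).val * γ 1 1) (by simp [Matrix.vecMul, Matrix.vec2_dotProduct])
    (by simp [Matrix.vecMul, Matrix.vec2_dotProduct]), torsionX]
  have hs := PeriodPair.weierstrassP_scale (L := lattice τ) (L' := lattice (γ • τ))
    (c := D⁻¹) (inv_ne_zero hd0) (by
      intro w
      rw [mem_lattice_iff, mem_lattice_iff, hτ]
      constructor
      · rintro ⟨m, n, h⟩
        refine ⟨m * γ 0 0 + n * γ 1 0, m * γ 0 1 + n * γ 1 1, ?_⟩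
        have h2 : w = m * (γ 0 0 * τ + γ 0 1) + n * D := by
          field_simp at h
          linear_combination h
        rw [h2, hD]
        push_cast
        ring
      · rintro ⟨m, n, h⟩
        refine ⟨m * γ 1 1 - n * γ 1 0, n * γ 0 0 - m * γ 0 1, ?_⟩
        rw [h]
        push_cast
        field_simp
        rw [hD]
        linear_combination (-(m * τ + n) : ℂ) * hdet)
  rw [inv_pow, inv_inv] at hs
  rw [hd, mul_left_comm, ← hs, hτ]
  congr 2
  push_cast
  field_simp
  rw [hD]
  ring

theorem ne_zero_of_zero {N : ℕ} {v : Fin 2 → ZMod N} (hv : v 0 ≠ 0) : v ≠ 0 :=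
  fun h => hv (by rw [h]; rfl)

theorem ne_zero_of_one {N : ℕ} {w : ZMod N} (hw : w ≠ 0) : (![0, w] : Fin 2 → ZMod N) ≠ 0 :=
  fun h => hw (congrFun h 1)

variable {N : ℕ} [NeZero N]

/-! ### Isogenous curves -/

/-- The modular form `a` of the quotient of the curve by the group generated by the point of index
`v`, by Vélu's formulas. -/
def isogA (N : ℕ) (v : Fin 2 → ZMod N) (τ : ℍ) : ℂ :=
  aForm τ - 15 * ∑ l ∈ Finset.Ico 1 N, torsionX N ((l : ZMod N) • v) τ ^ 2 -
    5 * ((N : ℂ) - 1) * aForm τ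

/-- The modular form `b` of the quotient of the curve by the group generated by the point of index
`v`, by Vélu's formulas. -/
def isogB (N : ℕ) (v : Fin 2 → ZMod N) (τ : ℍ) : ℂ :=
  bForm τ - 35 * ∑ l ∈ Finset.Ico 1 N, torsionX N ((l : ZMod N) • v) τ ^ 3 -
    21 * aForm τ * ∑ l ∈ Finset.Ico 1 N, torsionX N ((l : ZMod N) • v) τ -
    14 * ((N : ℂ) - 1) * bForm τ

theorem coe_ofComplex {z : ℂ} (hz : 0 < z.im) : ((ofComplex z : ℍ) : ℂ) = z := by
  rw [ofComplex_apply_of_im_pos hz]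

theorem coe_ofComplex_mul (τ : ℍ) : ((ofComplex (N * (τ : ℂ)) : ℍ) : ℂ) = N * (τ : ℂ) := by
  apply coe_ofComplex
  simpa using mul_pos (Nat.cast_pos.2 (NeZero.pos N)) τ.im_pos

theorem coe_ofComplex_div (τ : ℍ) (t : ℕ) :
    ((ofComplex (((τ : ℂ) + t) / N) : ℍ) : ℂ) = ((τ : ℂ) + t) / N := by
  apply coe_ofComplex
  have : ((τ : ℂ) + t) / N = ((1 / N : ℝ) : ℂ) * ((τ : ℂ) + t) := by push_cast; ring
  rw [this, Complex.im_ofReal_mul, Complex.add_im, Complex.natCast_im, add_zero]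
  exact mul_pos (one_div_pos.2 (Nat.cast_pos.2 (NeZero.pos N))) τ.im_pos

variable [Fact N.Prime]

theorem isogA_eq_of_cosets {v : Fin 2 → ZMod N} (hv : v ≠ 0) (τ τ' : ℍ) {c : ℂ} (hc : c ≠ 0)
    (h : ∀ w, c * w ∈ (lattice τ').lattice ↔ ∃ l < N,
      w + l * ((((v 0).val : ℂ) * τ + (v 1).val) / N) ∈ (lattice τ).lattice) :
    isogA N v τ = c ^ 4 * aForm τ' := by
  have := PeriodPair.scaledA_of_cosets hc (NeZero.pos N) (natCast_mul_pt_notMem hv τ) h scaleFactor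
  rw [scaledA_lattice, scaledA_lattice] at this
  rw [this]
  simp only [isogA, torsionX_nsmul]

theorem isogB_eq_of_cosets {v : Fin 2 → ZMod N} (hv : v ≠ 0) (τ τ' : ℍ) {c : ℂ} (hc : c ≠ 0)
    (h : ∀ w, c * w ∈ (lattice τ').lattice ↔ ∃ l < N,
      w + l * ((((v 0).val : ℂ) * τ + (v 1).val) / N) ∈ (lattice τ).lattice) :
    isogB N v τ = c ^ 6 * bForm τ' := by
  have := PeriodPair.scaledB_of_cosets hc (NeZero.pos N) (natCast_mul_pt_notMem hv τ) h scaleFactor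
  rw [scaledA_lattice, scaledB_lattice, scaledB_lattice] at this
  rw [this]
  simp only [isogB, torsionX_nsmul]

/-- In `ℤ/N` every element is a multiple of a nonzero one. -/
theorem exists_natCast_mul_add_eq_zero {u : ZMod N} (hu : u ≠ 0) (m : ZMod N) :
    ∃ l < N, m + (l : ZMod N) * u = 0 :=
  ⟨(-m * u⁻¹).val, ZMod.val_lt _, by
    rw [ZMod.natCast_val, ZMod.cast_id', id_eq, inv_mul_cancel_right₀ hu, add_neg_cancel]⟩

theorem cosets_mul {w : ZMod N} (hw : w ≠ 0) (τ : ℍ) (z : ℂ) :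
    (N : ℂ) * z ∈ (lattice (ofComplex (N * (τ : ℂ)))).lattice ↔ ∃ l < N,
      z + l * (((((![0, w] : Fin 2 → ZMod N) 0).val : ℂ) * τ +
        ((![0, w] : Fin 2 → ZMod N) 1).val) / N) ∈ (lattice τ).lattice := by
  have hN : (N : ℂ) ≠ 0 := Nat.cast_ne_zero.2 (NeZero.ne N)
  rw [mem_lattice_iff, coe_ofComplex_mul]
  simp only [Matrix.cons_val_zero, Matrix.cons_val_one, ZMod.val_zero, Nat.cast_zero, zero_mul,
    zero_add]
  constructor
  · rintro ⟨m, n, h⟩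
    obtain ⟨l, hl, e⟩ := exists_natCast_mul_add_eq_zero hw n
    refine ⟨l, hl, ?_⟩
    have := (div_mem_lattice_iff (τ := τ) (N := N) (m := m * N) (n := n + l * w.val)).2 (by
      simpa using e)
    convert this using 1
    push_cast
    field_simp
    linear_combination h
  · rintro ⟨l, hl, h⟩
    obtain ⟨m, n, e⟩ := mem_lattice_iff.1 h
    refine ⟨m, N * n - l * w.val, ?_⟩
    push_cast
    field_simp at e
    linear_combination e

theorem cosets_div {v : Fin 2 → ZMod N} (hv : v 0 ≠ 0) {t : ℕ} (ht : v 0 * t = v 1) (τ : ℍ)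
    (z : ℂ) : 1 * z ∈ (lattice (ofComplex (((τ : ℂ) + t) / N))).lattice ↔ ∃ l < N,
      z + l * ((((v 0).val : ℂ) * τ + (v 1).val) / N) ∈ (lattice τ).lattice := by
  have hN : (N : ℂ) ≠ 0 := Nat.cast_ne_zero.2 (NeZero.ne N)
  rw [mem_lattice_iff, coe_ofComplex_div, one_mul]
  constructor
  · rintro ⟨m, n, h⟩
    obtain ⟨l, hl, e⟩ := exists_natCast_mul_add_eq_zero hv m
    refine ⟨l, hl, ?_⟩
    have := (div_mem_lattice_iff (τ := τ) (N := N) (m := m + l * (v 0).val)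
      (n := m * t + n * N + l * (v 1).val)).2 ⟨by simpa using e, by
        have : ((m : ZMod N) + l * v 0) * t = 0 := by rw [e, zero_mul]
        push_cast
        simp only [ZMod.natCast_val, ZMod.cast_id', id_eq, CharP.cast_eq_zero, mul_zero, add_zero]
        rw [← ht]
        linear_combination this⟩
    convert this using 1
    rw [h]
    push_cast
    field_simp
    ring
  · rintro ⟨l, hl, h⟩
    obtain ⟨m, n, e⟩ := mem_lattice_iff.1 h
    have hd : (N : ℤ) ∣ (v 0).val * t - (v 1).val := by
      rw [← ZMod.intCast_zmod_eq_zero_iff_dvd]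
      push_cast
      simp only [ZMod.natCast_val, ZMod.cast_id', id_eq, ht, sub_self]
    obtain ⟨s, hs⟩ := hd
    have hs' : ((v 0).val : ℂ) * t - (v 1).val = N * s := by exact_mod_cast hs
    refine ⟨N * m - l * (v 0).val, n - m * t + l * s, ?_⟩
    push_cast
    field_simp at e ⊢
    linear_combination e + l * hs'

theorem isogA_zero {w : ZMod N} (hw : w ≠ 0) (τ : ℍ) :
    isogA N ![0, w] τ = primed N 4 aForm τ :=
  isogA_eq_of_cosets (ne_zero_of_one hw) τ _ (Nat.cast_ne_zero.2 (NeZero.ne N)) (cosets_mul hw τ)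

theorem isogB_zero {w : ZMod N} (hw : w ≠ 0) (τ : ℍ) :
    isogB N ![0, w] τ = primed N 6 bForm τ :=
  isogB_eq_of_cosets (ne_zero_of_one hw) τ _ (Nat.cast_ne_zero.2 (NeZero.ne N)) (cosets_mul hw τ)

theorem isogA_of_ne {v : Fin 2 → ZMod N} (hv : v 0 ≠ 0) {t : ℕ} (ht : v 0 * t = v 1) (τ : ℍ) :
    isogA N v τ = aForm (ofComplex (((τ : ℂ) + t) / N)) := by
  rw [isogA_eq_of_cosets (ne_zero_of_zero hv) τ _ one_ne_zero (cosets_div hv ht τ), one_pow,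
    one_mul]

theorem isogB_of_ne {v : Fin 2 → ZMod N} (hv : v 0 ≠ 0) {t : ℕ} (ht : v 0 * t = v 1) (τ : ℍ) :
    isogB N v τ = bForm (ofComplex (((τ : ℂ) + t) / N)) := by
  rw [isogB_eq_of_cosets (ne_zero_of_zero hv) τ _ one_ne_zero (cosets_div hv ht τ), one_pow,
    one_mul]

/-! ### Holomorphy of the `x`-coordinates -/

section Holomorphy

variable {N : ℕ}

/-- The summand of index `m` of the Weierstrass function at `(u w + v) / N`, as a function of the
modulus `w`. -/
def weierstrassTerm (N : ℕ) (u m : Fin 2 → ℤ) (w : ℂ) : ℂ :=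
  (N : ℂ) ^ 2 * (((u - (N : ℤ) • m) 0 : ℤ) * w + ((u - (N : ℤ) • m) 1 : ℤ)) ^ (-2 : ℤ) -
    ((m 0 : ℂ) * w + m 1) ^ (-2 : ℤ)

theorem weierstrassP_eq_tsum_weierstrassTerm (hN : N ≠ 0) (u : Fin 2 → ℤ) (τ : ℍ) :
    (lattice τ).weierstrassP (((u 0 : ℂ) * τ + u 1) / N) = ∑' m, weierstrassTerm N u m τ := by
  have hN' : (N : ℂ) ≠ 0 := Nat.cast_ne_zero.2 hN
  rw [PeriodPair.weierstrassP, ← (latticeEquiv τ).tsum_eq]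
  congr 1 with m
  rw [coe_latticeEquiv, weierstrassTerm]
  have : ((u 0 : ℂ) * τ + u 1) / N - (m 0 * (τ : ℂ) + m 1) =
      (((u - (N : ℤ) • m) 0 : ℤ) * (τ : ℂ) + ((u - (N : ℤ) • m) 1 : ℤ)) / N := by
    simp
    field_simp
    ring
  rw [this, div_pow, zpow_neg, zpow_neg]
  simp [div_eq_mul_inv]

theorem norm_le_mul_norm_sub {u m : Fin 2 → ℤ} (hN : 0 < N) (hu : ∀ i, ‖u i‖ ≤ N)
    (hne : u - (N : ℤ) • m ≠ 0) : ‖m‖ ≤ (N + 1) * ‖u - (N : ℤ) • m‖ ∧ 1 ≤ ‖u - (N : ℤ) • m‖ := by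
  have h1 : 1 ≤ ‖u - (N : ℤ) • m‖ := by
    obtain ⟨i, hi⟩ := Function.ne_iff.1 hne
    refine le_trans ?_ (norm_le_pi_norm _ i)
    rw [Int.norm_eq_abs]
    exact_mod_cast Int.one_le_abs hi
  refine ⟨(pi_norm_le_iff_of_nonneg (by positivity)).2 fun i => ?_, h1⟩
  have h2 := norm_le_pi_norm (u - (N : ℤ) • m) i
  have h3 : ‖(N : ℤ) * m i‖ ≤ ‖u i‖ + ‖(u - (N : ℤ) • m) i‖ := by
    have : (N : ℤ) * m i = u i - (u - (N : ℤ) • m) i := by simp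
    rw [this]
    exact norm_sub_le _ _
  have h4 : ‖m i‖ ≤ ‖(N : ℤ) * m i‖ := by
    rw [norm_mul]
    have : (1 : ℝ) ≤ ‖(N : ℤ)‖ := by
      rw [Int.norm_eq_abs]
      have : (1 : ℝ) ≤ N := by exact_mod_cast hN
      simpa using this
    nlinarith [norm_nonneg (m i)]
  have h5 := hu i
  have h6 : (0 : ℝ) ≤ N := Nat.cast_nonneg N
  nlinarith

/-- The terms of the Weierstrass function are `O(‖m‖⁻³)`, uniformly for the modulus in a set where
`hl` and `hS` hold. -/
theorem norm_weierstrassTerm_le {u m : Fin 2 → ℤ} {w : ℂ} {r S : ℝ} (hr : 0 < r) (hN : 0 < N)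
    (hl : ∀ p : Fin 2 → ℤ, p ≠ 0 → r * ‖p‖ ≤ ‖(p 0 : ℂ) * w + p 1‖)
    (hu : ∀ i, ‖u i‖ ≤ N) (hne : u - (N : ℤ) • m ≠ 0) (hS : ‖(u 0 : ℂ) * w + u 1‖ ≤ S) :
    ‖weierstrassTerm N u m w‖ ≤ S * (N * (N + 1) ^ 2 + (N + 1)) / r ^ 3 * ‖m‖ ^ (-(3 : ℝ)) +
      if m = 0 then N ^ 2 / r ^ 2 else 0 := by
  obtain ⟨h1, h2⟩ := norm_le_mul_norm_sub hN hu hne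
  have hq := hl _ hne
  have hS0 : 0 ≤ S := (norm_nonneg _).trans hS
  set q : ℂ := ((u - (N : ℤ) • m) 0 : ℤ) * w + ((u - (N : ℤ) • m) 1 : ℤ) with hqd
  set p := u - (N : ℤ) • m with hp
  have hq1 : r ≤ ‖q‖ := by nlinarith
  have hq0 : 0 < ‖q‖ := hr.trans_le hq1
  rw [weierstrassTerm, ← hp, ← hqd]
  split_ifs with hm
  · subst hm
    rw [norm_zero, Real.zero_rpow (by norm_num), mul_zero, zero_add]
    simp only [Pi.zero_apply, Int.cast_zero, zero_mul, add_zero]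
    rw [zero_zpow _ (by norm_num), sub_zero, norm_mul, norm_pow, norm_zpow, zpow_neg,
      Complex.norm_natCast, div_eq_mul_inv]
    gcongr
    exact_mod_cast pow_le_pow_left₀ hr.le hq1 2
  · have hl' := hl m hm
    have hm0 : 0 < ‖m‖ := norm_pos_iff.2 hm
    set l : ℂ := (m 0 : ℂ) * w + m 1 with hld
    have hl0 : 0 < ‖l‖ := (mul_pos hr hm0).trans_le hl'
    have e : (N : ℂ) * l + q = u 0 * w + u 1 := by
      simp only [hqd, hld, hp, Pi.sub_apply, Pi.smul_apply, smul_eq_mul]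
      push_cast
      ring
    have hl1 : l ≠ 0 := norm_pos_iff.1 hl0
    have hq2 : q ≠ 0 := norm_pos_iff.1 hq0
    have e2 : (N : ℂ) ^ 2 * q ^ (-2 : ℤ) - l ^ (-2 : ℤ) =
        (u 0 * w + u 1) * (N / (q ^ 2 * l) - 1 / (q * l ^ 2)) := by
      rw [← e, zpow_neg, zpow_neg]
      field_simp
      ring
    rw [e2, norm_mul, add_zero]
    have hq3 : r * ‖m‖ / (N + 1) ≤ ‖q‖ := by
      rw [div_le_iff₀ (by positivity)]
      nlinarith
    have hb : 0 < r * ‖m‖ / (N + 1) := by positivity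
    calc ‖(u 0 : ℂ) * w + u 1‖ * ‖N / (q ^ 2 * l) - 1 / (q * l ^ 2)‖
        ≤ S * (‖N / (q ^ 2 * l)‖ + ‖1 / (q * l ^ 2)‖) := by
          gcongr
          exact norm_sub_le _ _
      _ = S * (N / (‖q‖ ^ 2 * ‖l‖) + 1 / (‖q‖ * ‖l‖ ^ 2)) := by simp
      _ ≤ S * (N / ((r * ‖m‖ / (N + 1)) ^ 2 * (r * ‖m‖)) +
            1 / ((r * ‖m‖ / (N + 1)) * (r * ‖m‖) ^ 2)) := by gcongr
      _ = _ := by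
        rw [Real.rpow_neg hm0.le, show (3 : ℝ) = (3 : ℕ) by norm_num, Real.rpow_natCast]
        field_simp

theorem differentiableAt_tsum_weierstrassTerm (hN : 0 < N) {u : Fin 2 → ℤ} (hu : ∀ i, ‖u i‖ ≤ N)
    (hne : ∀ m, u - (N : ℤ) • m ≠ 0) (τ : ℍ) :
    DifferentiableAt ℂ (fun w => ∑' m, weierstrassTerm N u m w) τ := by
  set A : ℝ := |τ.re| + 1
  set B : ℝ := τ.im / 2
  have hB : 0 < B := half_pos τ.im_pos
  set R : ℝ := ‖(τ : ℂ)‖ + 1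
  set r : ℝ := EisensteinSeries.r ⟨⟨A, B⟩, hB⟩
  have hr : 0 < r := EisensteinSeries.r_pos _
  let U : Set ℂ := {w | |w.re| < A ∧ B < w.im ∧ ‖w‖ < R}
  have hU : IsOpen U := by
    exact (isOpen_lt (continuous_abs.comp Complex.continuous_re) continuous_const).inter
      ((isOpen_lt continuous_const Complex.continuous_im).inter
        (isOpen_lt continuous_norm continuous_const))
  have hτ : (τ : ℂ) ∈ U :=
    ⟨lt_add_one _, half_lt_self τ.im_pos, lt_add_one _⟩
  refine DifferentiableOn.differentiableAt (s := U) ?_ (hU.mem_nhds hτ)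
  have hsub : U ⊆ {w : ℂ | 0 < w.im} := fun w hw => hB.trans hw.2.1
  refine Complex.differentiableOn_tsum_of_summable_norm
    (u := fun m : Fin 2 → ℤ => (‖u 0‖ * R + ‖u 1‖) * (N * (N + 1) ^ 2 + (N + 1)) / r ^ 3 *
      ‖m‖ ^ (-(3 : ℝ)) + if m = 0 then N ^ 2 / r ^ 2 else 0) ?_ ?_ hU ?_
  · refine ((EisensteinSeries.summable_one_div_norm_rpow (by norm_num)).mul_left _).add ?_
    exact (hasSum_ite_eq _ _).summable
  · intro m
    refine ((EisensteinSeries.div_linear_zpow_differentiableOn 2 (u - (N : ℤ) • m)).const_mul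
      _).sub (EisensteinSeries.div_linear_zpow_differentiableOn 2 m) |>.mono hsub
  · intro m w hw
    refine norm_weierstrassTerm_le hr hN ?_ hu (hne m) ?_
    · intro p hp
      have h1 := EisensteinSeries.r_mul_max_le ⟨w, hsub hw⟩ hp
      have h2 := EisensteinSeries.r_lower_bound_on_verticalStrip (⟨w, hsub hw⟩ : ℍ) (A := A) hB
        ⟨hw.1.le, hw.2.1.le⟩
      exact (mul_le_mul_of_nonneg_right h2 (norm_nonneg _)).trans h1
    · refine (norm_add_le _ _).trans ?_
      rw [norm_mul, Complex.norm_intCast, Complex.norm_intCast, Int.norm_eq_abs, Int.norm_eq_abs]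
      gcongr
      exact hw.2.2.le

theorem mdifferentiable_torsionX [NeZero N] {v : Fin 2 → ZMod N} (hv : v ≠ 0) :
    MDiff (torsionX N v) := by
  set u : Fin 2 → ℤ := fun i => (v i).val with hud
  have hu : ∀ i, ‖u i‖ ≤ N := fun i => by
    rw [hud, Int.norm_eq_abs, Int.cast_natCast, Nat.abs_cast]
    exact_mod_cast (ZMod.val_lt (v i)).le
  have hne : ∀ m, u - (N : ℤ) • m ≠ 0 := by
    intro m h
    apply hv
    ext i
    have := congrArg (Int.cast : ℤ → ZMod N) (congrFun h i)
    simpa [hud] using this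
  intro τ
  rw [UpperHalfPlane.mdifferentiableAt_iff]
  refine ((differentiableAt_tsum_weierstrassTerm (NeZero.pos N) hu hne τ).const_mul
    (scaleFactor ^ 2)).congr_of_eventuallyEq ?_
  filter_upwards [isOpen_upperHalfPlaneSet.mem_nhds τ.2] with w hw
  lift w to ℍ using hw
  rw [Function.comp_apply, ofComplex_apply, torsionX,
    ← weierstrassP_eq_tsum_weierstrassTerm (NeZero.ne N)]
  simp [hud]

end Holomorphy

/-! ### The polynomial `torsionPoly` over a ring -/

section TorsionPoly

open Polynomial

variable {R : Type*} [CommRing R]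

/-- The polynomial `torsionPoly` for elements `a`, `b` of an arbitrary commutative ring. -/
def ringTorsionPoly (a b : R) (N : ℕ) : R[X] :=
  if N = 2 then X ^ 3 + C a * X + C b else (⟨0, 0, 0, a, b⟩ : WeierstrassCurve R).preΨ' N

theorem torsionPoly_eq {k : Type*} [Field k] (a b : k) (N : ℕ) :
    torsionPoly a b N = ringTorsionPoly a b N := rfl

theorem map_ringTorsionPoly {S : Type*} [CommRing S] (f : R →+* S) (a b : R) (N : ℕ) :
    (ringTorsionPoly a b N).map f = ringTorsionPoly (f a) (f b) N := by
  rw [ringTorsionPoly, ringTorsionPoly]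
  split_ifs
  · simp
  · rw [← WeierstrassCurve.map_preΨ']
    simp [WeierstrassCurve.map]

variable {N : ℕ}

theorem natDegree_ringTorsionPoly_le (hN : N.Prime) (a b : R) :
    (ringTorsionPoly a b N).natDegree ≤ torsionDegree N := by
  rw [ringTorsionPoly, torsionDegree]
  split_ifs with h
  · compute_degree
  · refine (WeierstrassCurve.natDegree_preΨ'_le _ N).trans_eq ?_
    rw [if_neg (Nat.not_even_iff_odd.2 (hN.odd_of_ne_two h))]

/-- The leading coefficient is `1` for `N = 2` and `N` for odd `N`. -/
theorem coeff_torsionDegree (hN : N.Prime) (a b : R) :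
    (ringTorsionPoly a b N).coeff (torsionDegree N) = ((if N = 2 then 1 else N : ℕ) : R) := by
  rw [ringTorsionPoly, torsionDegree]
  split_ifs with h
  · simp
  · have h' := Nat.not_even_iff_odd.2 (hN.odd_of_ne_two h)
    have := WeierstrassCurve.coeff_preΨ' (⟨0, 0, 0, a, b⟩ : WeierstrassCurve R) N
    rwa [if_neg h', if_neg h'] at this

theorem leading_ne_zero (hN : N.Prime) : (if N = 2 then 1 else N : ℕ) ≠ 0 := by
  split_ifs
  exacts [one_ne_zero, hN.ne_zero]

theorem natDegree_ringTorsionPoly [CharZero R] (hN : N.Prime) (a b : R) :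
    (ringTorsionPoly a b N).natDegree = torsionDegree N := by
  refine le_antisymm (natDegree_ringTorsionPoly_le hN a b) (le_natDegree_of_ne_zero ?_)
  rw [coeff_torsionDegree hN]
  exact Nat.cast_ne_zero.2 (leading_ne_zero hN)

theorem leadingCoeff_ringTorsionPoly [CharZero R] (hN : N.Prime) (a b : R) :
    (ringTorsionPoly a b N).leadingCoeff = ((if N = 2 then 1 else N : ℕ) : R) := by
  rw [leadingCoeff, natDegree_ringTorsionPoly hN, coeff_torsionDegree hN]

theorem ringTorsionPoly_ne_zero [CharZero R] (hN : N.Prime) (a b : R) :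
    ringTorsionPoly a b N ≠ 0 := by
  rw [← leadingCoeff_ne_zero, leadingCoeff_ringTorsionPoly hN]
  exact Nat.cast_ne_zero.2 (leading_ne_zero hN)

end TorsionPoly

/-! ### Growth of the `x`-coordinates at the cusps -/

section Bounded

variable {N : ℕ}

/-- A function that is a root of a polynomial with bounded coefficients and constant leading
coefficient is bounded. -/
theorem isBoundedAtImInfty_of_root (hN : N.Prime)
    {a b f : ℍ → ℂ} (ha : IsBoundedAtImInfty a) (hb : IsBoundedAtImInfty b)
    (hf : ∀ τ, (torsionPoly (a τ) (b τ) N).eval (f τ) = 0) : IsBoundedAtImInfty f := by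
  let S := boundedAtImInftySubalgebra ℂ
  let p := ringTorsionPoly (⟨a, ha⟩ : S) ⟨b, hb⟩ N
  have hp : ∀ τ i, (torsionPoly (a τ) (b τ) N).coeff i = (p.coeff i : ℍ → ℂ) τ := by
    intro τ i
    have := map_ringTorsionPoly ((Pi.evalRingHom (fun _ : ℍ => ℂ) τ).comp (S.val : S →+* (ℍ → ℂ)))
      (⟨a, ha⟩ : S) ⟨b, hb⟩ N
    have h2 := congrArg (fun q => q.coeff i) this
    simp only [Polynomial.coeff_map] at h2
    exact h2.symm
  have hs : IsBoundedAtImInfty fun τ => ∑ i ∈ Finset.range (torsionDegree N),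
      ‖(p.coeff i : ℍ → ℂ) τ‖ + 1 := by
    refine Filter.BoundedAtFilter.add ?_ (Filter.const_boundedAtFilter _ (1 : ℝ))
    have : (fun τ : ℍ => ∑ i ∈ Finset.range (torsionDegree N), ‖(p.coeff i : ℍ → ℂ) τ‖) =
        ∑ i ∈ Finset.range (torsionDegree N), fun τ => ‖(p.coeff i : ℍ → ℂ) τ‖ := by
      ext τ
      simp
    rw [this]
    refine Finset.sum_induction _ (Filter.BoundedAtFilter atImInfty) (fun _ _ => .add)
      (Filter.const_boundedAtFilter _ (0 : ℝ)) fun i _ => ?_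
    have hi : IsBoundedAtImInfty (p.coeff i : ℍ → ℂ) := (p.coeff i).2
    exact Asymptotics.IsBigO.norm_left hi
  refine Asymptotics.IsBigO.trans (Asymptotics.IsBigO.of_bound 1 ?_) hs
  refine Filter.Eventually.of_forall fun τ => ?_
  have hne : torsionPoly (a τ) (b τ) N ≠ 0 := ringTorsionPoly_ne_zero hN _ _
  have h1 : ‖f τ‖₊ < _ := Polynomial.IsRoot.norm_lt_cauchyBound hne (hf τ)
  rw [Polynomial.cauchyBound, torsionPoly_eq, natDegree_ringTorsionPoly hN,
    leadingCoeff_ringTorsionPoly hN, ← torsionPoly_eq] at h1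
  have h2 : (Finset.range (torsionDegree N)).sup
      (fun i => ‖(torsionPoly (a τ) (b τ) N).coeff i‖₊) ≤
      ∑ i ∈ Finset.range (torsionDegree N), ‖(p.coeff i : ℍ → ℂ) τ‖₊ := by
    refine Finset.sup_le fun i hi => ?_
    rw [hp]
    exact Finset.single_le_sum (f := fun i => ‖(p.coeff i : ℍ → ℂ) τ‖₊) (fun _ _ => zero_le) hi
  have h3 : (1 : NNReal) ≤ ‖((if N = 2 then 1 else N : ℕ) : ℂ)‖₊ := by
    rw [← NNReal.coe_le_coe, coe_nnnorm, Complex.norm_natCast, NNReal.coe_one]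
    exact_mod_cast Nat.one_le_iff_ne_zero.2 (leading_ne_zero hN)
  have h4 : ‖f τ‖₊ ≤ ∑ i ∈ Finset.range (torsionDegree N), ‖(p.coeff i : ℍ → ℂ) τ‖₊ + 1 :=
    h1.le.trans (add_le_add_left ((div_le_self zero_le h3).trans h2) 1)
  have h5 : ‖f τ‖ ≤ ∑ i ∈ Finset.range (torsionDegree N), ‖(p.coeff i : ℍ → ℂ) τ‖ + 1 := by
    have := NNReal.coe_le_coe.2 h4
    push_cast at this
    exact this
  rw [one_mul]
  exact h5.trans (le_abs_self _)

theorem isBoundedAtImInfty_levelOne {k : ℤ} (f : ModularForm 𝒮ℒ k) :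
    IsBoundedAtImInfty (f : ℍ → ℂ) :=
  ModularFormClass.bdd_at_infty f

theorem isBoundedAtImInfty_torsionX [Fact N.Prime] [NeZero N] {v : Fin 2 → ZMod N} (hv : v ≠ 0) :
    IsBoundedAtImInfty (torsionX N v) :=
  isBoundedAtImInfty_of_root Fact.out (isBoundedAtImInfty_levelOne aForm)
    (isBoundedAtImInfty_levelOne bForm) (eval_torsionPoly_torsionX hv)

end Bounded

/-! ### The action of `SL(2, ℤ)` on the points of order `N` -/

section RowAct

variable {N : ℕ}

/-- The right action of `SL(2, ℤ)` on row vectors modulo `N`. -/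
def rowAct (v : Fin 2 → ZMod N) (γ : SL(2, ℤ)) : Fin 2 → ZMod N :=
  Matrix.vecMul v ((γ : Matrix (Fin 2) (Fin 2) ℤ).map (Int.cast : ℤ → ZMod N))

theorem rowAct_one (v : Fin 2 → ZMod N) : rowAct v 1 = v := by
  simp [rowAct]

theorem rowAct_mul (v : Fin 2 → ZMod N) (γ δ : SL(2, ℤ)) :
    rowAct v (γ * δ) = rowAct (rowAct v γ) δ := by
  rw [rowAct, rowAct, rowAct, Matrix.vecMul_vecMul, Matrix.SpecialLinearGroup.coe_mul]
  congr 1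
  exact Matrix.map_mul (f := Int.castRingHom (ZMod N))

theorem rowAct_neg (v : Fin 2 → ZMod N) (γ : SL(2, ℤ)) : rowAct (-v) γ = -rowAct v γ :=
  Matrix.neg_vecMul _ _

theorem rowAct_smul (c : ZMod N) (v : Fin 2 → ZMod N) (γ : SL(2, ℤ)) :
    rowAct (c • v) γ = c • rowAct v γ :=
  Matrix.smul_vecMul _ _ _

theorem rowAct_zero (γ : SL(2, ℤ)) : rowAct (0 : Fin 2 → ZMod N) γ = 0 :=
  Matrix.zero_vecMul _

theorem rowAct_inv_rowAct (v : Fin 2 → ZMod N) (γ : SL(2, ℤ)) : rowAct (rowAct v γ) γ⁻¹ = v := by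
  rw [← rowAct_mul, mul_inv_cancel, rowAct_one]

theorem rowAct_rowAct_inv (v : Fin 2 → ZMod N) (γ : SL(2, ℤ)) : rowAct (rowAct v γ⁻¹) γ = v := by
  rw [← rowAct_mul, inv_mul_cancel, rowAct_one]

theorem rowAct_ne_zero {v : Fin 2 → ZMod N} (hv : v ≠ 0) (γ : SL(2, ℤ)) : rowAct v γ ≠ 0 := by
  intro h
  apply hv
  rw [← rowAct_inv_rowAct v γ, h, rowAct_zero]

/-- The index of the point `1/N`. -/
def baseVec (N : ℕ) : Fin 2 → ZMod N := ![0, 1]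

theorem rowAct_baseVec (γ : SL(2, ℤ)) :
    rowAct (baseVec N) γ = ![((γ 1 0 : ℤ) : ZMod N), ((γ 1 1 : ℤ) : ZMod N)] := by
  ext i
  fin_cases i <;> simp [rowAct, baseVec, Matrix.vecMul, dotProduct, Fin.sum_univ_two]

theorem mem_Gamma1_of_rowAct {γ : SL(2, ℤ)} (h : rowAct (baseVec N) γ = baseVec N) :
    γ ∈ Gamma1 N := by
  rw [rowAct_baseVec] at h
  have h0 : ((γ 1 0 : ℤ) : ZMod N) = 0 := congrFun h 0
  have h1 : ((γ 1 1 : ℤ) : ZMod N) = 1 := congrFun h 1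
  have hdet := congrArg (Int.cast : ℤ → ZMod N) γ.det_coe
  rw [Matrix.det_fin_two] at hdet
  push_cast at hdet
  rw [h0, h1, mul_one, mul_zero, sub_zero] at hdet
  exact (Gamma1_mem N γ).2 ⟨hdet, h1, h0⟩

/-- `Γ_±(N)` is the stabilizer of `±(0, 1)`. -/
theorem mem_GammaPM_iff {γ : SL(2, ℤ)} : γ ∈ GammaPM N ↔
    rowAct (baseVec N) γ = baseVec N ∨ rowAct (baseVec N) γ = -baseVec N := by
  constructor
  · let S : Subgroup SL(2, ℤ) :=
      { carrier := {γ | rowAct (baseVec N) γ = baseVec N ∨ rowAct (baseVec N) γ = -baseVec N}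
        one_mem' := Or.inl (rowAct_one _)
        mul_mem' := by
          rintro γ δ (h | h) (h' | h') <;> simp [rowAct_mul, h, h', rowAct_neg]
        inv_mem' := by
          rintro γ (h | h)
          · left
            conv_lhs => rw [← h]
            exact rowAct_inv_rowAct _ _
          · right
            have := rowAct_inv_rowAct (baseVec N) γ
            rw [h, rowAct_neg] at this
            exact neg_eq_iff_eq_neg.1 this }
    suffices GammaPM N ≤ S from fun h => this h
    refine sup_le (fun γ h => Or.inl ?_) ?_
    · rw [Gamma1_mem] at h
      rw [rowAct_baseVec, h.2.1, h.2.2]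
      rfl
    · rw [Subgroup.zpowers_le]
      right
      rw [rowAct_baseVec]
      ext i
      fin_cases i <;> simp [baseVec]
  · rintro (h | h)
    · exact Subgroup.mem_sup_left (mem_Gamma1_of_rowAct h)
    · have h1 : (-1 : SL(2, ℤ)) ∈ GammaPM N :=
        Subgroup.mem_sup_right (Subgroup.mem_zpowers (-1 : SL(2, ℤ)))
      have h2 : -γ ∈ GammaPM N := by
        refine Subgroup.mem_sup_left (mem_Gamma1_of_rowAct ?_)
        rw [rowAct_baseVec] at h ⊢
        have e0 : ((γ 1 0 : ℤ) : ZMod N) = 0 := by simpa [baseVec] using congrFun h 0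
        have e1 : ((γ 1 1 : ℤ) : ZMod N) = -1 := by simpa [baseVec] using congrFun h 1
        ext i
        fin_cases i <;> simp [baseVec, e0, e1]
      simpa using mul_mem h1 h2

instance instFiniteIndexGammaPM [NeZero N] : (GammaPM N).FiniteIndex :=
  Subgroup.finiteIndex_of_le (le_sup_left : Gamma1 N ≤ GammaPM N)

theorem torsionX_slash [NeZero N] (v : Fin 2 → ZMod N) (γ : SL(2, ℤ)) :
    torsionX N v ∣[(2 : ℤ)] γ = torsionX N (rowAct v γ) := by
  ext τ
  rw [SL_slash_apply, torsionX_smul, zpow_neg, mul_comm, ← mul_assoc]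
  have : (denom γ τ : ℂ) ≠ 0 := denom_ne_zero _ _
  rw [show ((denom γ τ : ℂ) ^ (2 : ℤ))⁻¹ * denom γ τ ^ 2 = 1 by
    rw [zpow_ofNat]; exact inv_mul_cancel₀ (pow_ne_zero 2 this), one_mul]
  rfl

variable [NeZero N] [Fact N.Prime]

/-- The functions `x_v` are modular forms of weight `2` for the groups fixing `±v`. -/
def torsionForm {v : Fin 2 → ZMod N} (hv : v ≠ 0)
    (h : ∀ γ ∈ GammaPM N, rowAct v γ = v ∨ rowAct v γ = -v) :
    ModularForm (GammaPM N : Subgroup (GL (Fin 2) ℝ)) 2 where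
  toFun := torsionX N v
  slash_action_eq' := by
    rintro _ ⟨γ, hγ, rfl⟩
    refine (torsionX_slash v γ).trans ?_
    rcases h γ hγ with h | h
    · rw [h]
    · rw [h]
      exact funext fun τ => torsionX_neg v τ
  holo' := mdifferentiable_torsionX hv
  bdd_at_cusps' {c} hc := by
    rw [Subgroup.IsArithmetic.isCusp_iff_isCusp_SL2Z] at hc
    rw [OnePoint.isBoundedAt_iff_forall_SL2Z hc]
    intro γ _
    rw [torsionX_slash]
    exact isBoundedAtImInfty_torsionX (rowAct_ne_zero hv γ)

omit [NeZero N] in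
theorem natCast_smul_baseVec_ne_zero {l : ℕ} (h1 : 1 ≤ l) (h2 : l < N) :
    (l : ZMod N) • baseVec N ≠ 0 := by
  intro h
  have : (l : ZMod N) = 0 := by simpa [baseVec] using congrFun h 1
  rw [ZMod.natCast_eq_zero_iff] at this
  exact absurd (Nat.le_of_dvd (by omega) this) (by omega)

omit [NeZero N] in
theorem baseVec_ne_zero : baseVec N ≠ 0 := fun h => one_ne_zero (α := ZMod N) (congrFun h 1)

theorem torsionX_mem_RPM {l : ℕ} (h1 : 1 ≤ l) (h2 : l < N) :
    torsionX N ((l : ZMod N) • baseVec N) ∈ RPM N := by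
  refine coe_mem_modularRing (torsionForm (natCast_smul_baseVec_ne_zero h1 h2) fun γ hγ => ?_)
  rw [rowAct_smul]
  rcases mem_GammaPM_iff.1 hγ with h | h
  · exact Or.inl (by rw [h])
  · exact Or.inr (by rw [h, smul_neg])

end RowAct

/-! ### Conjugates of `x_P` -/

section Conjugates

open Polynomial

/-- Evaluation of functions on the upper half plane at a point. -/
def evalAt (S : Subalgebra ℂ (ℍ → ℂ)) (τ : ℍ) : S →+* ℂ :=
  (Pi.evalRingHom (fun _ : ℍ => ℂ) τ).comp (S.val : S →+* (ℍ → ℂ))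

theorem evalAt_apply (S : Subalgebra ℂ (ℍ → ℂ)) (τ : ℍ) (f : S) :
    evalAt S τ f = (f : ℍ → ℂ) τ := rfl

theorem levelOne_smul {k : ℤ} (f : ModularForm 𝒮ℒ k) (g : SL(2, ℤ)) (τ : ℍ) :
    f (g • τ) = denom g τ ^ k * f τ := by
  have h := congrFun (f.slash_action_eq' (g : GL (Fin 2) ℝ) ⟨g, rfl⟩) τ
  have h2 : (((f : ℍ → ℂ) ∣[k] g) τ) = f τ := h
  rw [SL_slash_apply, zpow_neg, mul_inv_eq_iff_eq_mul₀ (zpow_ne_zero _ (denom_ne_zero _ _))] at h2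
  rw [h2, mul_comm]

/-- The values of an element of `ℛ` at the translates `g τ` of a point are, up to a power of the
automorphy factor `j`, the values of a polynomial in `j`. -/
theorem exists_weightPoly {r : ℍ → ℂ} (hr : r ∈ R₁) : ∃ K : ℕ, ∀ K' ≥ K, ∀ τ : ℍ, ∃ P : ℂ[X],
    P.eval 1 = r τ ∧ ∀ g : SL(2, ℤ), P.eval (denom g τ) = denom g τ ^ K' * r (g • τ) := by
  obtain ⟨y, rfl⟩ := hr
  change ∃ K : ℕ, ∀ K' ≥ K, ∀ τ : ℍ, ∃ P : ℂ[X], P.eval 1 = gradedToFun 𝒮ℒ y τ ∧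
    ∀ g : SL(2, ℤ), P.eval (denom g τ) = denom g τ ^ K' * gradedToFun 𝒮ℒ y (g • τ)
  induction y using DirectSum.induction_on with
  | zero => exact ⟨0, fun _ _ _ => ⟨0, by simp, by simp⟩⟩
  | of k f =>
    refine ⟨k.natAbs, fun K' hK τ => ⟨C (f τ) * X ^ (K' + k).toNat, ?_, fun g => ?_⟩⟩
    · simp [gradedToFun_of]
    · rw [gradedToFun_of, levelOne_smul, eval_mul, eval_C, eval_pow, eval_X, ← mul_assoc, mul_comm,
        ← zpow_natCast, ← zpow_natCast, ← zpow_add₀ (denom_ne_zero _ _),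
        Int.toNat_of_nonneg (by omega)]
  | add y z hy hz =>
    obtain ⟨K, hK⟩ := hy
    obtain ⟨L, hL⟩ := hz
    refine ⟨max K L, fun K' h τ => ?_⟩
    obtain ⟨P, hP, hP'⟩ := hK K' (le_of_max_le_left h) τ
    obtain ⟨Q, hQ, hQ'⟩ := hL K' (le_of_max_le_right h) τ
    refine ⟨P + Q, ?_, fun g => ?_⟩
    · rw [eval_add, hP, hQ, map_add, Pi.add_apply]
    · rw [eval_add, hP', hQ', map_add, Pi.add_apply, mul_add]

variable {N : ℕ} [NeZero N] [Fact N.Prime]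

/-- For each `k` the pair `(c, d + k N c)` is the bottom row of a matrix in `SL(2, ℤ)` that carries
`(0, 1)` to `v`. -/
theorem exists_coprime_lift {v : Fin 2 → ZMod N} (hv : v ≠ 0) : ∃ c d : ℤ, c ≠ 0 ∧
    (c : ZMod N) = v 0 ∧ (d : ZMod N) = v 1 ∧ ∀ k : ℤ, IsCoprime c (d + k * (N * c)) := by
  have hp : N.Prime := Fact.out
  by_cases h0 : v 0 = 0
  · have h1 : v 1 ≠ 0 := fun h1 => hv (by ext i; fin_cases i <;> [exact h0; exact h1])
    refine ⟨N, (v 1).val, by exact_mod_cast NeZero.ne N, by simp [h0], by simp, fun k => ?_⟩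
    rw [show ((v 1).val : ℤ) + k * (N * N) = (v 1).val + N * (k * N) by ring,
      IsCoprime.add_mul_left_right_iff, Nat.isCoprime_iff_coprime, Nat.coprime_comm]
    exact Nat.Coprime.symm ((Nat.Prime.coprime_iff_not_dvd hp).2 fun h =>
      h1 (by rw [← ZMod.natCast_zmod_val (v 1), (ZMod.natCast_eq_zero_iff _ _).2 h]))
  · have hc : Nat.Coprime N (v 0).val := (Nat.Prime.coprime_iff_not_dvd hp).2 fun h =>
      h0 (by rw [← ZMod.natCast_zmod_val (v 0), (ZMod.natCast_eq_zero_iff _ _).2 h])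
    obtain ⟨d, hd1, hd2⟩ := Nat.chineseRemainder hc (v 1).val 1
    refine ⟨(v 0).val, d, ?_, by simp, ?_, fun k => ?_⟩
    · have : (v 0).val ≠ 0 := fun h => h0 ((ZMod.val_eq_zero _).1 h)
      exact_mod_cast this
    · rw [Int.cast_natCast, (ZMod.natCast_eq_natCast_iff _ _ _).2 hd1]
      simp
    · rw [show (d : ℤ) + k * (N * (v 0).val) = d + (v 0).val * (k * N) by ring,
        IsCoprime.add_mul_left_right_iff, Nat.isCoprime_iff_coprime]
      exact (hd2.gcd_eq.trans (Nat.gcd_one_left _) : Nat.gcd d (v 0).val = 1) |> Nat.coprime_comm.1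

/-- There are infinitely many automorphy factors of elements carrying `1/N` to a given point. -/
theorem infinite_denom {v : Fin 2 → ZMod N} (hv : v ≠ 0) (τ : ℍ) :
    {j : ℂ | ∃ g : SL(2, ℤ), rowAct (baseVec N) g = v ∧ denom g τ = j}.Infinite := by
  obtain ⟨c, d, hc, h0, h1, hcop⟩ := exists_coprime_lift hv
  have hN : (N : ℂ) ≠ 0 := Nat.cast_ne_zero.2 (NeZero.ne N)
  refine Set.infinite_of_injective_forall_mem
    (f := fun k : ℤ => (c : ℂ) * τ + (d + k * (N * c) : ℤ)) ?_ ?_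
  · intro k l h
    have hc' : (c : ℂ) ≠ 0 := Int.cast_ne_zero.2 hc
    have : (k : ℂ) * (N * c) = l * (N * c) := by
      push_cast at h
      linear_combination h
    exact_mod_cast mul_right_cancel₀ (mul_ne_zero hN hc') this
  · intro k
    obtain ⟨g, -, hg⟩ := ModularGroup.bottom_row_surj (R := ℤ) (a := ![c, d + k * (N * c)])
      (by simpa using hcop k)
    have g0 : g 1 0 = c := congrFun hg 0
    have g1 : g 1 1 = d + k * (N * c) := congrFun hg 1
    refine ⟨g, ?_, ?_⟩
    · rw [rowAct_baseVec, g0, g1]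
      ext i
      fin_cases i <;> simp [h0, h1]
    · simp [denom, g0, g1]

/-- An algebraic relation over `ℛ` satisfied by `x_P` is satisfied by all its conjugates. -/
theorem eval₂_torsionX_eq_zero {q : R₁[X]}
    (hq : ∀ τ, q.eval₂ (evalAt R₁ τ) (torsionX N (baseVec N) τ) = 0)
    {v : Fin 2 → ZMod N} (hv : v ≠ 0) (τ : ℍ) : q.eval₂ (evalAt R₁ τ) (torsionX N v τ) = 0 := by
  simp only [eval₂_eq_sum_range, evalAt_apply] at hq ⊢
  choose K hK using fun i => exists_weightPoly (q.coeff i).2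
  set s := Finset.range (q.natDegree + 1)
  have hle : ∀ i ∈ s, K i ≤ ∑ i ∈ s, K i := fun i hi =>
    Finset.single_le_sum (fun _ _ => Nat.zero_le _) hi
  have hP : ∀ i, ∃ P : ℂ[X], i ∈ s → P.eval 1 = (q.coeff i : ℍ → ℂ) τ ∧ ∀ g : SL(2, ℤ),
      P.eval (denom g τ) = denom g τ ^ (∑ i ∈ s, K i) * (q.coeff i : ℍ → ℂ) (g • τ) := by
    intro i
    by_cases hi : i ∈ s
    · obtain ⟨P, h⟩ := hK i _ (hle i hi) τ
      exact ⟨P, fun _ => h⟩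
    · exact ⟨0, fun h => absurd h hi⟩
  choose P hP using hP
  set Q : ℂ[X] := ∑ i ∈ s, P i * (C (torsionX N v τ) * X ^ 2) ^ i with hQ
  have hQ0 : Q = 0 := by
    refine eq_zero_of_infinite_isRoot Q ((infinite_denom hv τ).mono ?_)
    rintro _ ⟨g, hg, rfl⟩
    have := hq (g • τ)
    have hx : torsionX N (baseVec N) (g • τ) = denom g τ ^ 2 * torsionX N v τ := by
      rw [torsionX_smul, ← hg]
      rfl
    rw [hx] at this
    simp only [IsRoot.def, Set.mem_ofPred_eq, hQ, eval_finsetSum]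
    rw [Finset.sum_congr rfl fun i hi => by
      rw [eval_mul, (hP i hi).2 g, eval_pow, eval_mul, eval_C, eval_pow, eval_X, mul_assoc,
        mul_comm (torsionX N v τ)], ← Finset.mul_sum, this, mul_zero]
  have h1 := congrArg (eval 1) hQ0
  rw [hQ, eval_finsetSum, eval_zero, Finset.sum_congr rfl fun i hi => by
    rw [eval_mul, (hP i hi).1, eval_pow, eval_mul, eval_C, eval_pow, eval_X, one_pow,
      mul_one]] at h1
  exact h1

/-- Representatives of the nonzero vectors modulo `N` up to sign: `(s, none)` stands for `(0, s)`
and `(s, some t)` for `(s, s t)`, with `1 ≤ s ≤ N / 2` (the first component is `s - 1`). -/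
abbrev TorsionIndex (N : ℕ) : Type := Fin (N / 2) × Option (Fin N)

/-- The vector of index `i`. -/
def torsionVec (N : ℕ) (i : TorsionIndex N) : Fin 2 → ZMod N :=
  match i with
  | (s, none) => ![0, ((s + 1 : ℕ) : ZMod N)]
  | (s, some t) => ![((s + 1 : ℕ) : ZMod N), ((s + 1 : ℕ) : ZMod N) * (t : ℕ)]

omit [NeZero N] in
theorem card_torsionIndex : Fintype.card (TorsionIndex N) = torsionDegree N := by
  have hp : N.Prime := Fact.out
  rw [Fintype.card_prod, Fintype.card_option, Fintype.card_fin, Fintype.card_fin, torsionDegree]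
  split_ifs with h
  · subst h; rfl
  · obtain ⟨m, rfl⟩ := hp.odd_of_ne_two h
    rw [show (2 * m + 1) / 2 = m by omega, show (2 * m + 1) ^ 2 - 1 = 2 * (m * (2 * m + 1 + 1)) by
      rw [Nat.sub_eq_iff_eq_add (Nat.one_le_pow _ _ (by omega))]; ring]
    omega

omit [NeZero N] in
theorem natCast_succ_ne_zero (s : Fin (N / 2)) : ((s + 1 : ℕ) : ZMod N) ≠ 0 := by
  rw [Ne, ZMod.natCast_eq_zero_iff]
  intro h
  have := Nat.le_of_dvd (by omega) h
  have := s.2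
  have := (Fact.out : N.Prime).two_le
  omega

omit [NeZero N] in
theorem natCast_succ_inj {s s' : Fin (N / 2)}
    (h : ((s + 1 : ℕ) : ZMod N) = ((s' + 1 : ℕ) : ZMod N) ∨
      ((s + 1 : ℕ) : ZMod N) = -((s' + 1 : ℕ) : ZMod N)) : s = s' := by
  have h1 := s.2
  have h2 := s'.2
  rcases h with h | h
  · rw [ZMod.natCast_eq_natCast_iff] at h
    have := Nat.ModEq.eq_of_lt_of_lt h (by omega) (by omega)
    exact Fin.ext (by omega)
  · rw [eq_neg_iff_add_eq_zero, ← Nat.cast_add, ZMod.natCast_eq_zero_iff] at h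
    have := Nat.le_of_dvd (by omega) h
    exact Fin.ext (by omega)

omit [NeZero N] in
theorem torsionVec_ne_zero (i : TorsionIndex N) : torsionVec N i ≠ 0 := by
  rcases i with ⟨s, _ | t⟩
  · exact fun h => natCast_succ_ne_zero s (congrFun h 1)
  · exact fun h => natCast_succ_ne_zero s (congrFun h 0)

omit [NeZero N] in
theorem torsionVec_eq_or_neg {i j : TorsionIndex N}
    (h : torsionVec N i = torsionVec N j ∨ torsionVec N i = -torsionVec N j) : i = j := by
  have hcomp : ∀ k, torsionVec N i k = torsionVec N j k ∨ torsionVec N i k = -torsionVec N j k :=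
    fun k => h.imp (fun h => congrFun h k) (fun h => congrFun h k)
  rcases i with ⟨s, _ | t⟩ <;> rcases j with ⟨s', _ | t'⟩
  · rw [natCast_succ_inj (hcomp 1)]
  · have := hcomp 0
    simp only [torsionVec, Matrix.cons_val_zero] at this
    rw [eq_comm, zero_eq_neg, or_self] at this
    exact absurd this (natCast_succ_ne_zero s')
  · have := hcomp 0
    simp only [torsionVec, Matrix.cons_val_zero, neg_zero, or_self] at this
    exact absurd this (natCast_succ_ne_zero s)
  · obtain rfl := natCast_succ_inj (hcomp 0)
    have hs := natCast_succ_ne_zero s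
    suffices ((t : ℕ) : ZMod N) = (t' : ℕ) by
      rw [ZMod.natCast_eq_natCast_iff] at this
      rw [Fin.ext (Nat.ModEq.eq_of_lt_of_lt this t.2 t'.2)]
    rcases h with h | h
    · exact mul_left_cancel₀ hs (congrFun h 1)
    · have e0 : ((s + 1 : ℕ) : ZMod N) = -((s + 1 : ℕ) : ZMod N) := congrFun h 0
      have e1 : ((s + 1 : ℕ) : ZMod N) * (t : ℕ) = -(((s + 1 : ℕ) : ZMod N) * (t' : ℕ)) :=
        congrFun h 1
      rw [← neg_mul, ← e0] at e1
      exact mul_left_cancel₀ hs e1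

/-- The `d` values of the conjugates of `x_P` are distinct at every point. -/
theorem torsionX_injective (τ : ℍ) :
    Function.Injective fun i : TorsionIndex N => torsionX N (torsionVec N i) τ := fun i j h =>
  torsionVec_eq_or_neg (eq_or_eq_neg_of_torsionX_eq (torsionVec_ne_zero i) (torsionVec_ne_zero j) h)

/-- The powers `1, x_P, …, x_P^(d-1)` are linearly independent over `ℛ`. -/
theorem eq_zero_of_eval₂_torsionX {q : R₁[X]} (hd : q.natDegree < torsionDegree N)
    (hq : ∀ τ, q.eval₂ (evalAt R₁ τ) (torsionX N (baseVec N) τ) = 0) : q = 0 := by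
  refine Polynomial.ext fun i => Subtype.ext (funext fun τ => ?_)
  have : q.map (evalAt R₁ τ) = 0 := by
    refine eq_zero_of_natDegree_lt_card_of_eval_eq_zero _ (torsionX_injective (N := N) τ)
      (fun j => ?_) ?_
    · rw [eval_map]
      exact eval₂_torsionX_eq_zero hq (torsionVec_ne_zero j) τ
    · rw [card_torsionIndex]
      exact natDegree_map_le.trans_lt hd
  have h2 := congrArg (fun p => p.coeff i) this
  simpa [evalAt_apply] using h2

end Conjugates

/-! ### The field `𝒦_{Γ_±(N)}` is generated by `x_P` -/

section Spanning

open Polynomial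

variable {N : ℕ} [NeZero N] [Fact N.Prime]

theorem torsionX_baseVec_mem : torsionX N (baseVec N) ∈ RPM N := by
  have := torsionX_mem_RPM (N := N) le_rfl (Fact.out : N.Prime).one_lt
  rwa [Nat.cast_one, one_smul] at this

/-- `x_P` as an element of `ℛ_{Γ_±(N)}`. -/
def xRing (N : ℕ) [NeZero N] [Fact N.Prime] : RPM N :=
  ⟨torsionX N (baseVec N), torsionX_baseVec_mem⟩

/-- The inclusion of `ℛ` in `ℛ_{Γ_±(N)}`. -/
def inclR (N : ℕ) : R₁ →+* RPM N :=
  (Subalgebra.inclusion (modularRing_mono (GammaPM_le N))).toRingHom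

omit [NeZero N] [Fact N.Prime] in
theorem evalAt_inclR (τ : ℍ) (r : R₁) : evalAt (RPM N) τ (inclR N r) = evalAt R₁ τ r := rfl

theorem ext_evalAt {S : Subalgebra ℂ (ℍ → ℂ)} {f g : S} (h : ∀ τ, evalAt S τ f = evalAt S τ g) :
    f = g := Subtype.ext (funext h)

theorem evalAt_xRing (τ : ℍ) : evalAt (RPM N) τ (xRing N) = torsionX N (baseVec N) τ := rfl

/-- The polynomial `torsionPoly` over the ring `ℛ`. -/
def torsionPolyR (N : ℕ) : R₁[X] := ringTorsionPoly aR bR N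

omit [NeZero N] [Fact N.Prime] in
theorem map_torsionPolyR_evalAt (τ : ℍ) :
    (torsionPolyR N).map (evalAt R₁ τ) = torsionPoly (aForm τ) (bForm τ) N :=
  map_ringTorsionPoly _ _ _ _

theorem eval₂_torsionPolyR {v : Fin 2 → ZMod N} (hv : v ≠ 0) (τ : ℍ) :
    (torsionPolyR N).eval₂ (evalAt R₁ τ) (torsionX N v τ) = 0 := by
  rw [← eval_map, map_torsionPolyR_evalAt, eval_torsionPoly_torsionX hv]

theorem evalAt_eval₂ (q : R₁[X]) (τ : ℍ) : evalAt (RPM N) τ (q.eval₂ (inclR N) (xRing N)) =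
    q.eval₂ (evalAt R₁ τ) (torsionX N (baseVec N) τ) := by
  rw [hom_eval₂]
  rfl

theorem eval₂_torsionPolyR_xRing : (torsionPolyR N).eval₂ (inclR N) (xRing N) = 0 :=
  ext_evalAt fun τ => by rw [evalAt_eval₂, eval₂_torsionPolyR baseVec_ne_zero, map_zero]

theorem eq_zero_of_eval₂_xRing {q : R₁[X]} (hd : q.natDegree < torsionDegree N)
    (hq : q.eval₂ (inclR N) (xRing N) = 0) : q = 0 :=
  eq_zero_of_eval₂_torsionX hd fun τ => by rw [← evalAt_eval₂, hq, map_zero]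

instance instCharZeroSubalgebra (S : Subalgebra ℂ (ℍ → ℂ)) : CharZero S :=
  charZero_of_injective_algebraMap (R := ℂ) fun _ _ h =>
    congrFun (congrArg (Subtype.val : S → ℍ → ℂ) h) UpperHalfPlane.I

omit [NeZero N] [Fact N.Prime] in
theorem torsionDegree_pos (hN : N.Prime) : 0 < torsionDegree N := by
  rw [torsionDegree]
  split_ifs with h
  · norm_num
  · have h3 : 3 ≤ N := by have := hN.two_le; omega
    have : 3 ^ 2 ≤ N ^ 2 := Nat.pow_le_pow_left h3 2
    omega

/-- `x_P` is a simple root of `torsionPoly`, since the derivative has degree less than `d`. -/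
theorem eval₂_derivative_ne_zero :
    (derivative (torsionPolyR N)).eval₂ (inclR N) (xRing N) ≠ 0 := by
  have hp : N.Prime := Fact.out
  have hd : (torsionPolyR N).natDegree = torsionDegree N := natDegree_ringTorsionPoly hp _ _
  have h0 := torsionDegree_pos hp
  intro h
  have h1 := eq_zero_of_eval₂_xRing
    ((natDegree_derivative_lt (by omega)).trans_eq hd) h
  have := derivative_eq_zero.1 h1
  omega

/-- The conjugates of a modular form `h` for `Γ_±(N)` under `SL(2, ℤ)`, together with those of
`x_P`: their power sums `∑ h_i x_i ^ n` are modular forms of level one, and only one of the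
conjugates of `x_P` takes the same value as `x_P` at any given point. -/
theorem exists_conjugates {k : ℤ} (h : ModularForm (GammaPM N : Subgroup (GL (Fin 2) ℝ)) k) :
    ∃ (ι : Type) (_ : Fintype ι) (_ : DecidableEq ι) (c : ι → ℍ → ℂ) (w : ι → Fin 2 → ZMod N)
      (i₀ : ι), c i₀ = h ∧ (∀ i, w i ≠ 0) ∧
      (∀ τ i, torsionX N (w i) τ = torsionX N (baseVec N) τ ↔ i = i₀) ∧
      ∀ n : ℕ, (fun τ => ∑ i, c i τ * torsionX N (w i) τ ^ n) ∈ R₁ := by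
  classical
  let G : Subgroup (GL (Fin 2) ℝ) := GammaPM N
  let Q := 𝒮ℒ ⧸ G.subgroupOf 𝒮ℒ
  let : Fintype Q := Fintype.ofFinite Q
  have hex : ∀ q : Q, ∃ γ : SL(2, ℤ), Matrix.SpecialLinearGroup.mapGL ℝ γ = (q.out : 𝒮ℒ).val⁻¹ :=
    fun q => inv_mem (q.out : 𝒮ℒ).2
  choose γ hγ using hex
  have hfun : ∀ {m : ℤ} (f : ModularForm G m) (q : Q),
      SlashInvariantForm.quotientFunc (ℋ := 𝒮ℒ) f q = (f : ℍ → ℂ) ∣[m] γ q := by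
    intro m f q
    conv_lhs => rw [← Quotient.out_eq q]
    rw [SL_slash]
    exact (SlashInvariantForm.quotientFunc_mk f q.out).trans (by rw [← hγ q]; rfl)
  have hmem : ∀ q : Q, γ q ∈ GammaPM N ↔ q = ((1 : 𝒮ℒ) : Q) := by
    intro q
    conv_rhs => rw [← Quotient.out_eq q]
    rw [eq_comm]
    change _ ↔ ((1 : 𝒮ℒ) : Q) = ((q.out : 𝒮ℒ) : Q)
    rw [QuotientGroup.eq, inv_one, one_mul, Subgroup.mem_subgroupOf]
    rw [← inv_mem_iff (x := (q.out : 𝒮ℒ).val), ← hγ q]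
    constructor
    · intro h
      exact ⟨_, h, rfl⟩
    · rintro ⟨g, hg, e⟩
      rwa [← Matrix.SpecialLinearGroup.mapGL_injective e]
  refine ⟨ULift.{0} Q, inferInstance, inferInstance, fun q => (h : ℍ → ℂ) ∣[k] γ q.down,
    fun q => rowAct (baseVec N) (γ q.down), ⟨((1 : 𝒮ℒ) : Q)⟩, ?_,
    fun q => rowAct_ne_zero baseVec_ne_zero _, ?_, ?_⟩
  · have h1 := (hmem ((1 : 𝒮ℒ) : Q)).2 rfl
    exact h.slash_action_eq' _ ⟨_, h1, rfl⟩
  · rintro τ ⟨q⟩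
    rw [ULift.ext_iff, ← hmem, mem_GammaPM_iff]
    constructor
    · exact eq_or_eq_neg_of_torsionX_eq (rowAct_ne_zero baseVec_ne_zero _) baseVec_ne_zero
    · rintro (h | h)
      · exact congrArg (fun v => torsionX N v τ) h
      · exact (congrArg (fun v => torsionX N v τ) h).trans (torsionX_neg _ _)
  · intro n
    let x : ModularForm G 2 := torsionForm baseVec_ne_zero fun γ hγ => mem_GammaPM_iff.1 hγ
    have hT := coe_mem_modularRing (ModularForm.trace 𝒮ℒ (h.mul (x.pow n)))
    convert hT using 1
    ext τ
    rw [ModularForm.coe_trace, Finset.sum_apply]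
    refine Fintype.sum_equiv Equiv.ulift _ _ ?_
    rintro ⟨q⟩
    have hq := hfun (h.mul (x.pow n)) q
    refine Eq.trans ?_ (congrFun hq τ).symm
    have hx : ∀ σ, torsionX N (rowAct (baseVec N) (γ q)) σ =
      torsionX N (baseVec N) (γ q • σ) * denom (γ q) σ ^ (-2 : ℤ) := fun σ => by
        rw [← torsionX_slash, SL_slash_apply]
    change ((h : ℍ → ℂ) ∣[k] γ q) τ * _ = _
    rw [hx, SL_slash_apply, SL_slash_apply, ModularForm.coe_mul, Pi.mul_apply, ModularForm.coe_pow,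
      Pi.pow_apply, mul_pow, ← zpow_natCast (_ ^ (-2 : ℤ)), ← zpow_mul,
      show -(k + (n : ℤ) * 2) = -k + (-2) * n by ring, zpow_add₀ (denom_ne_zero _ _)]
    change _ = h _ * torsionX N (baseVec N) _ ^ n * _
    ring

/-- The dual basis of the powers of `x_P`: multiplied by the derivative of `torsionPoly` at `x_P`,
every modular form for `Γ_±(N)` becomes a polynomial in `x_P` over `ℛ`. -/
theorem mul_derivative_eq {k : ℤ} (h : ModularForm (GammaPM N : Subgroup (GL (Fin 2) ℝ)) k) :
    ∃ t : ℕ → R₁, (⟨h, coe_mem_modularRing h⟩ : RPM N) *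
      (derivative (torsionPolyR N)).eval₂ (inclR N) (xRing N) =
      ∑ i ∈ Finset.range (torsionDegree N + 1),
        (((torsionPolyR N).map (inclR N)) /ₘ (X - C (xRing N))).coeff i * inclR N (t i) := by
  obtain ⟨ι, _, _, c, w, i₀, h0, hw, hinj, hmem⟩ := exists_conjugates h
  refine ⟨fun n => ⟨_, hmem n⟩, ext_evalAt fun τ => ?_⟩
  set P := (torsionPolyR N).map (inclR N) with hP
  set D := P /ₘ (X - C (xRing N)) with hD
  have hroot : P.IsRoot (xRing N) := by
    rw [IsRoot.def, hP, eval_map, eval₂_torsionPolyR_xRing]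
  have hmul : (X - C (xRing N)) * D = P := mul_divByMonic_eq_iff_isRoot.2 hroot
  have hder : (derivative (torsionPolyR N)).eval₂ (inclR N) (xRing N) = D.eval (xRing N) := by
    rw [← eval_map, ← derivative_map, ← hP, ← hmul, derivative_mul]
    simp
  have hdeg : D.natDegree < torsionDegree N + 1 := by
    have h1 : D.natDegree ≤ P.natDegree := by
      rw [hD, natDegree_divByMonic _ (monic_X_sub_C _)]
      exact Nat.sub_le _ _
    have h2 : P.natDegree ≤ torsionDegree N :=
      natDegree_map_le.trans (natDegree_ringTorsionPoly_le Fact.out _ _)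
    omega
  have hτ : ∀ z : ℂ, ∑ i ∈ Finset.range (torsionDegree N + 1),
      evalAt (RPM N) τ (D.coeff i) * z ^ i = (D.map (evalAt (RPM N) τ)).eval z := by
    intro z
    rw [eval_map, eval₂_eq_sum_range' _ hdeg]
  have hz : ∀ i, i ≠ i₀ → (D.map (evalAt (RPM N) τ)).eval (torsionX N (w i) τ) = 0 := by
    intro i hi
    have e1 : ((X - C (torsionX N (baseVec N) τ)) * D.map (evalAt (RPM N) τ)).eval
        (torsionX N (w i) τ) = 0 := by
      have := congrArg (Polynomial.map (evalAt (RPM N) τ)) hmul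
      rw [Polynomial.map_mul, Polynomial.map_sub, map_X, map_C, evalAt_xRing, hP, map_map] at this
      rw [this, eval_map]
      exact eval₂_torsionPolyR (hw i) τ
    rw [eval_mul, eval_sub, eval_X, eval_C] at e1
    exact (mul_eq_zero.1 e1).resolve_left (sub_ne_zero.2 fun e => hi ((hinj τ i).1 e))
  rw [hder, map_mul, map_sum]
  simp only [map_mul, evalAt_inclR]
  simp only [evalAt_apply R₁, Finset.mul_sum]
  rw [Finset.sum_comm]
  have hterm : ∀ i, ∑ n ∈ Finset.range (torsionDegree N + 1), evalAt (RPM N) τ (D.coeff n) *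
      (c i τ * torsionX N (w i) τ ^ n) =
      c i τ * (D.map (evalAt (RPM N) τ)).eval (torsionX N (w i) τ) := by
    intro i
    rw [← hτ, Finset.mul_sum]
    exact Finset.sum_congr rfl fun _ _ => by ring
  rw [Finset.sum_congr rfl fun i _ => hterm i, Finset.sum_eq_single i₀
    (fun i _ hi => by rw [hz i hi, mul_zero]) (fun h => absurd (Finset.mem_univ _) h), h0,
    (hinj τ i₀).2 rfl, ← evalAt_xRing, eval_map_apply]
  rfl

/-! ### The basis of powers of `x_P` -/

/-- `x_P` as an element of `𝒦_{Γ_±(N)}`. -/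
def xField (N : ℕ) [NeZero N] [Fact N.Prime] : KPM N := algebraMap (RPM N) (KPM N) (xRing N)

omit [NeZero N] [Fact N.Prime] in
theorem algebraMap_algebraMap (r : R₁) : algebraMap K₁ (KPM N) (algebraMap R₁ K₁ r) =
    algebraMap (RPM N) (KPM N) (inclR N r) :=
  IsLocalization.map_eq (M := nonZeroDivisors R₁) (T := nonZeroDivisors (RPM N)) (S := K₁)
    (Q := KPM N) (g := inclR N) (nonZeroDivisors_le_comap_nonZeroDivisors_of_injective _
      (Subalgebra.inclusion_injective (modularRing_mono (GammaPM_le N)))) r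

instance instCharZeroK₁ : CharZero K₁ :=
  charZero_of_injective_algebraMap (IsFractionRing.injective R₁ K₁)

theorem aeval_map_xField (q : R₁[X]) : aeval (xField N) (q.map (algebraMap R₁ K₁)) =
    algebraMap (RPM N) (KPM N) (q.eval₂ (inclR N) (xRing N)) := by
  rw [aeval_def, eval₂_map, hom_eval₂]
  congr 1
  exact RingHom.ext algebraMap_algebraMap

omit [NeZero N] [Fact N.Prime] in
theorem map_torsionPolyR : (torsionPolyR N).map (algebraMap R₁ K₁) =
    torsionPoly (algebraMap R₁ K₁ aR) (algebraMap R₁ K₁ bR) N :=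
  map_ringTorsionPoly _ _ _ _

theorem aeval_torsionPoly_xField :
    aeval (xField N) (torsionPoly (algebraMap R₁ K₁ aR) (algebraMap R₁ K₁ bR) N) = 0 := by
  rw [← map_torsionPolyR, aeval_map_xField, eval₂_torsionPolyR_xRing, map_zero]

theorem isIntegral_xField : IsIntegral K₁ (xField N) := by
  rw [← isAlgebraic_iff_isIntegral]
  exact ⟨_, ringTorsionPoly_ne_zero Fact.out _ _, aeval_torsionPoly_xField⟩

theorem natDegree_minpoly_xField : (minpoly K₁ (xField N)).natDegree = torsionDegree N := by
  have hp : N.Prime := Fact.out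
  refine le_antisymm ?_ ?_
  · have h := minpoly.degree_le_of_ne_zero K₁ (xField N) (ringTorsionPoly_ne_zero hp _ _)
      aeval_torsionPoly_xField
    have h2 := natDegree_le_natDegree h
    rwa [natDegree_ringTorsionPoly hp] at h2
  · by_contra! hlt
    obtain ⟨c, hc, e⟩ := IsLocalization.integerNormalization_spec (nonZeroDivisors R₁)
      (minpoly K₁ (xField N))
    set q := IsLocalization.integerNormalization (nonZeroDivisors R₁) (minpoly K₁ (xField N))
    have hq0 : q ≠ 0 := fun h => minpoly.ne_zero (isIntegral_xField (N := N))
      ((IsLocalization.integerNormalization_eq_zero_iff le_rfl _).1 h)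
    have hdeg : q.natDegree < torsionDegree N := by
      rw [← natDegree_map_eq_of_injective (IsFractionRing.injective R₁ K₁) q, e]
      exact (natDegree_smul_le _ _).trans_lt hlt
    refine hq0 (eq_zero_of_eval₂_xRing hdeg ?_)
    apply IsFractionRing.injective (RPM N) (KPM N)
    rw [← aeval_map_xField, e, map_zero, algebra_compatible_smul K₁ c, map_smul, minpoly.aeval,
      smul_zero]

open IntermediateField in
/-- By `mul_derivative_eq` every modular form for `Γ_±(N)` is a quotient of polynomials in `x_P`. -/
theorem adjoin_xField : K₁⟮xField N⟯ = ⊤ := by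
  set F := K₁⟮xField N⟯
  have hx : xField N ∈ F := mem_adjoin_simple_self _ _
  have hR : ∀ r : R₁, algebraMap (RPM N) (KPM N) (inclR N r) ∈ F := fun r => by
    rw [← algebraMap_algebraMap]
    exact F.algebraMap_mem _
  have hpow : ∀ q : R₁[X], algebraMap (RPM N) (KPM N) (q.eval₂ (inclR N) (xRing N)) ∈ F := by
    intro q
    rw [eval₂_eq_sum_range, map_sum]
    refine sum_mem fun i _ => ?_
    rw [map_mul, map_pow]
    exact mul_mem (hR _) (pow_mem hx _)
  have hform : ∀ {k : ℤ} (h : ModularForm (GammaPM N : Subgroup (GL (Fin 2) ℝ)) k),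
      algebraMap (RPM N) (KPM N) ⟨h, coe_mem_modularRing h⟩ ∈ F := by
    intro k h
    obtain ⟨t, ht⟩ := mul_derivative_eq h
    have hne : algebraMap (RPM N) (KPM N)
        ((derivative (torsionPolyR N)).eval₂ (inclR N) (xRing N)) ≠ 0 :=
      (map_ne_zero_iff _ (IsFractionRing.injective (RPM N) (KPM N))).2 eval₂_derivative_ne_zero
    have e := congrArg (algebraMap (RPM N) (KPM N)) ht
    rw [map_mul] at e
    rw [eq_div_of_mul_eq hne e]
    refine div_mem ?_ (hpow _)
    rw [map_sum]
    refine sum_mem fun i _ => ?_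
    rw [map_mul]
    refine mul_mem ?_ (hR _)
    rw [coeff_divByMonic_X_sub_C, map_sum]
    refine sum_mem fun j _ => ?_
    rw [map_mul, map_pow, coeff_map]
    exact mul_mem (pow_mem hx _) (hR _)
  have hall : ∀ f : RPM N, algebraMap (RPM N) (KPM N) f ∈ F := by
    rintro ⟨f, y, hy⟩
    suffices ∀ f (hf : f ∈ RPM N), f = gradedToFun _ y →
        algebraMap (RPM N) (KPM N) ⟨f, hf⟩ ∈ F from this f _ hy.symm
    clear hy
    induction y using DirectSum.induction_on with
    | zero =>
      intro f hf e
      have : (⟨f, hf⟩ : RPM N) = 0 := Subtype.ext (e.trans (map_zero _))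
      rw [this, map_zero]
      exact zero_mem F
    | of k g =>
      intro f hf e
      rw [gradedToFun_of] at e
      subst e
      exact hform g
    | add y z hy hz =>
      intro f hf e
      have : (⟨f, hf⟩ : RPM N) = ⟨gradedToFun _ y, y, rfl⟩ + ⟨gradedToFun _ z, z, rfl⟩ :=
        Subtype.ext (e.trans (map_add _ _ _))
      rw [this, map_add]
      exact add_mem (hy _ _ rfl) (hz _ _ rfl)
  rw [eq_top_iff]
  intro z _
  obtain ⟨f, g, -, rfl⟩ := IsFractionRing.div_surjective (A := RPM N) z
  exact div_mem (hall f) (hall g)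

theorem finrank_KPM : Module.finrank K₁ (KPM N) = torsionDegree N := by
  rw [← natDegree_minpoly_xField, ← IntermediateField.adjoin.finrank isIntegral_xField,
    adjoin_xField, IntermediateField.finrank_top']

instance instNonemptyFin : Nonempty (Fin (torsionDegree N)) :=
  ⟨⟨0, torsionDegree_pos Fact.out⟩⟩

/-- The basis `1, x_P, x_P², …` of `𝒦_{Γ_±(N)}` over `𝒦`. -/
def powBasis (N : ℕ) [NeZero N] [Fact N.Prime] :
    Module.Basis (Fin (torsionDegree N)) K₁ (KPM N) :=
  basisOfLinearIndependentOfCardEqFinrank (b := fun i : Fin (torsionDegree N) => xField N ^ (i : ℕ))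
    (by
      have := linearIndependent_pow (K := K₁) (xField N)
      rwa [natDegree_minpoly_xField] at this)
    (by rw [finrank_KPM, Fintype.card_fin])

theorem powBasis_apply (i : Fin (torsionDegree N)) : powBasis N i = xField N ^ (i : ℕ) := by
  rw [powBasis, coe_basisOfLinearIndependentOfCardEqFinrank]

end Spanning

/-! ### Forms of level one are polynomials in `a` and `b` -/

section LevelOne

open MvPolynomial

/-- The value at `a`, `b` of a polynomial, as an element of `ℛ`. -/
def evalForms : MvPolynomial (Fin 2) ℂ →ₐ[ℂ] R₁ := aeval ![aR, bR]

theorem evalAt_evalForms (P : MvPolynomial (Fin 2) ℂ) (τ : ℍ) :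
    evalAt R₁ τ (evalForms P) = eval ![aForm τ, bForm τ] P := by
  let φ : R₁ →ₐ[ℂ] ℂ := { evalAt R₁ τ with commutes' := fun c => rfl }
  have : φ.comp evalForms = aeval ![aForm τ, bForm τ] :=
    MvPolynomial.algHom_ext fun i => by
      fin_cases i <;> simp [evalForms] <;> rfl
  exact (DFunLike.congr_fun this P).trans (by rw [aeval_eq_eval])

theorem aForm_mem : (aForm : ℍ → ℂ) ∈ (R₁.val.comp evalForms).range :=
  ⟨X 0, by simp [evalForms, aR]⟩

theorem bForm_mem : (bForm : ℍ → ℂ) ∈ (R₁.val.comp evalForms).range :=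
  ⟨X 1, by simp [evalForms, bR]⟩

theorem E₄_mem : (E₄ : ℍ → ℂ) ∈ (R₁.val.comp evalForms).range := by
  have : (E₄ : ℍ → ℂ) = (-3 : ℂ) • (aForm : ℍ → ℂ) := by
    ext τ
    simp [aForm]
  rw [this]
  exact Subalgebra.smul_mem _ aForm_mem _

theorem E₆_mem : (E₆ : ℍ → ℂ) ∈ (R₁.val.comp evalForms).range := by
  have : (E₆ : ℍ → ℂ) = (27 / 2 : ℂ) • (bForm : ℍ → ℂ) := by
    ext τ
    simp [bForm]
    ring
  rw [this]
  exact Subalgebra.smul_mem _ bForm_mem _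

theorem discriminant_mem : (discriminant : ℍ → ℂ) ∈ (R₁.val.comp evalForms).range := by
  have : (discriminant : ℍ → ℂ) =
      (1 / 1728 : ℂ) • ((E₄ : ℍ → ℂ) ^ 3 - (E₆ : ℍ → ℂ) ^ 2) := by
    ext τ
    rw [discriminant_eq_E₄_cube_sub_E₆_sq, Pi.smul_apply, smul_eq_mul, Pi.sub_apply, Pi.pow_apply,
      Pi.pow_apply]
    ring
  rw [this]
  exact Subalgebra.smul_mem _ (sub_mem (pow_mem E₄_mem 3) (pow_mem E₆_mem 2)) _

/-- In every even weight `k ≥ 4` there is a monomial in `E₄`, `E₆` with constant term `1`. -/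
theorem exists_levelOne_coeff_zero (n : ℕ) : (∃ g : ModularForm 𝒮ℒ (4 * n + 4 : ℕ),
      (qExpansion 1 g).coeff 0 = 1 ∧ (g : ℍ → ℂ) ∈ (R₁.val.comp evalForms).range) ∧
    ∃ g : ModularForm 𝒮ℒ (4 * n + 6 : ℕ),
      (qExpansion 1 g).coeff 0 = 1 ∧ (g : ℍ → ℂ) ∈ (R₁.val.comp evalForms).range := by
  have h4 : (qExpansion 1 E₄).coeff 0 = 1 := EisensteinSeries.E_qExpansion_coeff_zero _ ⟨2, rfl⟩
  have h6 : (qExpansion 1 E₆).coeff 0 = 1 := EisensteinSeries.E_qExpansion_coeff_zero _ ⟨3, rfl⟩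
  have step : ∀ {k l : ℕ}, l = k + 4 → (∃ g : ModularForm 𝒮ℒ k, (qExpansion 1 g).coeff 0 = 1 ∧
      (g : ℍ → ℂ) ∈ (R₁.val.comp evalForms).range) → ∃ g : ModularForm 𝒮ℒ l,
      (qExpansion 1 g).coeff 0 = 1 ∧ (g : ℍ → ℂ) ∈ (R₁.val.comp evalForms).range := by
    rintro k l rfl ⟨g, h0, hg⟩
    refine ⟨ModularForm.mcast (by push_cast; rfl) (g.mul E₄), ?_, ?_⟩
    · rw [coe_mcast, ModularForm.qExpansion_mul one_pos one_mem_strictPeriods_SL,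
        PowerSeries.coeff_mul, Finset.Nat.antidiagonal_zero, Finset.sum_singleton, h0, h4, one_mul]
    · rw [coe_mcast, ModularForm.coe_mul]
      exact mul_mem hg E₄_mem
  induction n with
  | zero => exact ⟨⟨E₄, h4, E₄_mem⟩, ⟨E₆, h6, E₆_mem⟩⟩
  | succ n ih => exact ⟨step (by ring) ih.1, step (by ring) ih.2⟩

/-- Every form of level one is a polynomial in `a` and `b`, by induction on the weight: after
subtraction of a monomial the form is a cusp form, and it is divisible by `Δ`. -/
theorem levelOne_mem (k : ℕ) : ∀ f : ModularForm 𝒮ℒ k,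
    (f : ℍ → ℂ) ∈ (R₁.val.comp evalForms).range := by
  induction k using Nat.strong_induction_on with
  | _ k ih =>
    intro f
    by_cases hg : ∃ g : ModularForm 𝒮ℒ k, (qExpansion 1 g).coeff 0 = 1 ∧
        (g : ℍ → ℂ) ∈ (R₁.val.comp evalForms).range
    · obtain ⟨g, hg, hmem⟩ := hg
      obtain ⟨s, hs⟩ := sub_smul_isCuspForm f g hg
      set c := (qExpansion 1 f).coeff 0
      have hsf : (s : ℍ → ℂ) = f - c • (g : ℍ → ℂ) := congrArg DFunLike.coe hs
      have hq : (CuspForm.discriminantEquiv s : ℍ → ℂ) ∈ (R₁.val.comp evalForms).range := by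
        by_cases hk : k < 12
        · rw [ModularFormClass.levelOne_neg_weight_eq_zero (k := (k : ℤ) - 12) (by omega)]
          exact zero_mem _
        · have := ih (k - 12) (by omega)
            (ModularForm.mcast (by push_cast [not_lt.1 hk]; rfl) (CuspForm.discriminantEquiv s))
          rwa [coe_mcast] at this
      have hf : (f : ℍ → ℂ) =
          discriminant * (CuspForm.discriminantEquiv s : ℍ → ℂ) + c • (g : ℍ → ℂ) := by
        rw [discriminant_mul_discriminantEquiv, hsf, sub_add_cancel]
      rw [hf]
      exact add_mem (mul_mem discriminant_mem hq) (Subalgebra.smul_mem _ hmem c)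
    · rcases Nat.even_or_odd k with he | ho
      · have hlt : k = 0 ∨ k = 2 := by
          by_contra! h
          obtain ⟨m, rfl⟩ := he
          rcases Nat.even_or_odd' m with ⟨r, rfl | rfl⟩
          · exact hg (by
              have := (exists_levelOne_coeff_zero (r - 1)).1
              rwa [show 4 * (r - 1) + 4 = 2 * r + 2 * r by omega] at this)
          · exact hg (by
              have := (exists_levelOne_coeff_zero (r - 1)).2
              rwa [show 4 * (r - 1) + 6 = 2 * r + 1 + (2 * r + 1) by omega] at this)
        rcases hlt with rfl | rfl
        · obtain ⟨c, hc⟩ := ModularFormClass.levelOne_weight_zero_const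
            (ModularForm.mcast (by rfl) f : ModularForm 𝒮ℒ 0)
          rw [coe_mcast] at hc
          rw [hc]
          exact Subalgebra.algebraMap_mem _ c
        · have h0 := rank_zero_iff_forall_zero.1 levelOne_weight_two_rank_zero f
          rw [h0]
          exact zero_mem (R₁.val.comp evalForms).range
      · rw [levelOne_odd_weight_eq_zero (k := (k : ℤ)) (by exact_mod_cast ho) f]
        exact zero_mem (R₁.val.comp evalForms).range

/-! ### Algebraic independence of `a` and `b` -/

theorem S_smul_I : ModularGroup.S • UpperHalfPlane.I = UpperHalfPlane.I := by
  ext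
  rw [modular_S_smul]
  simp

theorem bForm_I : bForm UpperHalfPlane.I = 0 := by
  have h := levelOne_smul bForm ModularGroup.S UpperHalfPlane.I
  have hd : (denom ModularGroup.S UpperHalfPlane.I : ℂ) = Complex.I := by
    rw [ModularGroup.denom_apply]
    simp [ModularGroup.S]
  have h6 : Complex.I ^ (6 : ℤ) = -1 := by
    rw [show (6 : ℤ) = ((6 : ℕ) : ℤ) by rfl, zpow_natCast, show 6 = 2 * 3 by rfl, pow_mul,
      Complex.I_sq]
    norm_num
  rw [S_smul_I, hd, h6] at h
  linear_combination h / 2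

theorem aForm_I_ne_zero : aForm UpperHalfPlane.I ≠ 0 := by
  intro h
  have := disc_form_ne_zero UpperHalfPlane.I
  rw [h, bForm_I] at this
  norm_num at this

theorem bR_ne_zero : bR ≠ 0 := by
  intro h
  have hb : ∀ τ, bForm τ = 0 := fun τ => congrFun (congrArg Subtype.val h) τ
  have h6 := EisensteinSeries.E_qExpansion_coeff_zero (k := 6) (by norm_num) ⟨3, rfl⟩
  have : (E₆ : ModularForm 𝒮ℒ 6) = 0 := by
    ext τ
    have := hb τ
    rw [bForm, smul_apply, smul_eq_mul, mul_eq_zero] at this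
    exact this.resolve_left (by norm_num)
  change (qExpansion 1 (E₆ : ℍ → ℂ)).coeff 0 = 1 at h6
  rw [this, (ModularForm.qExpansion_eq_zero_iff one_pos one_mem_strictPeriods_SL _).2 rfl] at h6
  simp at h6

/-- If the polynomial `p₀ + p₁ Y + p₂ Y² + …`, with coefficients in `ℂ[X]`, vanishes at `(a, b)`,
then it vanishes at `(λ⁴ a(i), λ⁶ b(i)) = (λ⁴ a(i), 0)` for infinitely many `λ`. -/
theorem coeff_zero_eq_zero {q : Polynomial (Polynomial ℂ)}
    (hq : q.eval₂ (Polynomial.aeval aR).toRingHom bR = 0) : q.coeff 0 = 0 := by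
  have : Fact (Nat.Prime 2) := ⟨Nat.prime_two⟩
  have hinf := infinite_denom (N := 2) baseVec_ne_zero UpperHalfPlane.I
  have hr : (q.coeff 0).comp
      (Polynomial.C (aForm UpperHalfPlane.I) * Polynomial.X ^ 4) = 0 := by
    refine Polynomial.eq_zero_of_infinite_isRoot _ (hinf.mono ?_)
    rintro _ ⟨g, -, rfl⟩
    have h0 := congrArg (evalAt R₁ (g • UpperHalfPlane.I)) hq
    have hb : evalAt R₁ (g • UpperHalfPlane.I) bR = 0 :=
      (levelOne_smul bForm g UpperHalfPlane.I).trans (by rw [bForm_I, mul_zero])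
    have ha : evalAt R₁ (g • UpperHalfPlane.I) aR =
        denom g UpperHalfPlane.I ^ 4 * aForm UpperHalfPlane.I :=
      levelOne_smul aForm g UpperHalfPlane.I
    rw [Polynomial.hom_eval₂, hb, Polynomial.eval₂_at_zero, map_zero] at h0
    have h1 : ∀ p : Polynomial ℂ, ((evalAt R₁ (g • UpperHalfPlane.I)).comp
        (Polynomial.aeval aR).toRingHom) p = p.eval (evalAt R₁ (g • UpperHalfPlane.I) aR) := by
      intro p
      rw [RingHom.comp_apply]
      exact (Polynomial.hom_eval₂ p (algebraMap ℂ R₁) (evalAt R₁ (g • UpperHalfPlane.I)) aR)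
    rw [h1, ha] at h0
    simp only [Set.mem_ofPred_eq, Polynomial.IsRoot.def, Polynomial.eval_comp, Polynomial.eval_mul,
      Polynomial.eval_C, Polynomial.eval_pow, Polynomial.eval_X]
    rw [mul_comm, h0]
  rcases Polynomial.comp_eq_zero_iff.1 hr with h | ⟨-, h⟩
  · exact h
  · have := congrArg (fun p => Polynomial.coeff p 4) h
    simp [Polynomial.coeff_C] at this
    exact absurd this aForm_I_ne_zero

/-- `a` and `b` are algebraically independent: a relation is divisible by the second variable, and
`b` may be cancelled from it. -/
theorem eq_zero_of_eval₂_forms (n : ℕ) : ∀ q : Polynomial (Polynomial ℂ), q.natDegree < n →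
    q.eval₂ (Polynomial.aeval aR).toRingHom bR = 0 → q = 0 := by
  induction n with
  | zero => exact fun q h => absurd h (Nat.not_lt_zero _)
  | succ n ih =>
    intro q hd hq
    have hq0 := coeff_zero_eq_zero hq
    have hX : q.divX * Polynomial.X = q := by
      have := Polynomial.divX_mul_X_add q
      rwa [hq0, map_zero, add_zero] at this
    have h1 : q.divX.eval₂ (Polynomial.aeval aR).toRingHom bR = 0 := by
      rw [← hX, Polynomial.eval₂_mul, Polynomial.eval₂_X] at hq
      exact (mul_eq_zero.1 hq).resolve_right bR_ne_zero
    by_cases hn : q.natDegree = 0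
    · rw [Polynomial.eq_C_of_natDegree_eq_zero hn, hq0, map_zero]
    · rw [← hX, ih _ (by rw [Polynomial.natDegree_divX_eq_natDegree_tsub_one]; omega) h1, zero_mul]

/-- `a` and `b` are algebraically independent. -/
theorem evalForms_injective : Function.Injective evalForms := by
  rw [injective_iff_map_eq_zero]
  intro P hP
  let φ : MvPolynomial (Fin 2) ℂ →+* Polynomial (Polynomial ℂ) :=
    eval₂Hom (Polynomial.C.comp Polynomial.C) ![Polynomial.C Polynomial.X, Polynomial.X]
  let ψ : Polynomial (Polynomial ℂ) →+* MvPolynomial (Fin 2) ℂ :=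
    Polynomial.eval₂RingHom (Polynomial.aeval (X 0)).toRingHom (X 1)
  have h1 : ψ.comp φ = RingHom.id _ := by
    apply MvPolynomial.ringHom_ext
    · intro c
      simp [φ, ψ]
    · intro i
      fin_cases i <;> simp [φ, ψ]
  have h2 : (Polynomial.eval₂RingHom (Polynomial.aeval aR).toRingHom bR).comp φ =
      (evalForms : MvPolynomial (Fin 2) ℂ →+* R₁) := by
    apply MvPolynomial.ringHom_ext
    · intro c
      simp [φ, evalForms]
    · intro i
      fin_cases i <;> simp [φ, evalForms]
  have h3 : φ P = 0 := eq_zero_of_eval₂_forms _ _ (Nat.lt_succ_self _)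
    ((DFunLike.congr_fun h2 P).trans hP)
  rw [← RingHom.id_apply P, ← h1, RingHom.comp_apply, h3, map_zero]

theorem polyToField_injective : Function.Injective polyToField :=
  (IsFractionRing.injective R₁ K₁).comp evalForms_injective

end LevelOne

/-! ### The Hecke operator as a sum over isogenies -/

section Hecke

variable {N : ℕ} [NeZero N]

theorem isogA_smul (v : Fin 2 → ZMod N) (γ : SL(2, ℤ)) (τ : ℍ) :
    isogA N v (γ • τ) = denom γ τ ^ 4 * isogA N (rowAct v γ) τ := by
  have ha : aForm (γ • τ) = denom γ τ ^ 4 * aForm τ := levelOne_smul aForm γ τ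
  have hx : ∀ l : ℕ, torsionX N ((l : ZMod N) • v) (γ • τ) =
      denom γ τ ^ 2 * torsionX N ((l : ZMod N) • rowAct v γ) τ := fun l => by
    rw [torsionX_smul, ← rowAct_smul]
    rfl
  simp only [isogA, ha, hx, mul_pow, ← Finset.mul_sum]
  ring

theorem isogB_smul (v : Fin 2 → ZMod N) (γ : SL(2, ℤ)) (τ : ℍ) :
    isogB N v (γ • τ) = denom γ τ ^ 6 * isogB N (rowAct v γ) τ := by
  have ha : aForm (γ • τ) = denom γ τ ^ 4 * aForm τ := levelOne_smul aForm γ τ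
  have hb : bForm (γ • τ) = denom γ τ ^ 6 * bForm τ := levelOne_smul bForm γ τ
  have hx : ∀ l : ℕ, torsionX N ((l : ZMod N) • v) (γ • τ) =
      denom γ τ ^ 2 * torsionX N ((l : ZMod N) • rowAct v γ) τ := fun l => by
    rw [torsionX_smul, ← rowAct_smul]
    rfl
  simp only [isogB, ha, hb, hx, mul_pow, ← Finset.mul_sum]
  ring

variable [Fact N.Prime]

omit [NeZero N] in
theorem natCast_smul_ne_zero {v : Fin 2 → ZMod N} (hv : v ≠ 0) {l : ℕ} (hl : l ∈ Finset.Ico 1 N) :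
    (l : ZMod N) • v ≠ 0 := by
  rw [Finset.mem_Ico] at hl
  refine smul_ne_zero (fun h => ?_) hv
  rw [ZMod.natCast_eq_zero_iff] at h
  exact absurd (Nat.le_of_dvd (by omega) h) (by omega)

omit [NeZero N] in
/-- If a subalgebra of functions contains `a`, `b` and all `x_v`, then it contains all `isogA N v`
and `isogB N v`. -/
theorem isog_mem (S : Subalgebra ℂ (ℍ → ℂ)) (ha : (aForm : ℍ → ℂ) ∈ S) (hb : (bForm : ℍ → ℂ) ∈ S)
    {v : Fin 2 → ZMod N} (hx : ∀ l ∈ Finset.Ico 1 N, torsionX N ((l : ZMod N) • v) ∈ S) :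
    isogA N v ∈ S ∧ isogB N v ∈ S := by
  have hA : isogA N v = (aForm : ℍ → ℂ) -
      (15 : ℂ) • ∑ l ∈ Finset.Ico 1 N, torsionX N ((l : ZMod N) • v) ^ 2 -
      (5 * ((N : ℂ) - 1)) • (aForm : ℍ → ℂ) := by
    ext τ
    simp [isogA]
  have hB : isogB N v = (bForm : ℍ → ℂ) -
      (35 : ℂ) • ∑ l ∈ Finset.Ico 1 N, torsionX N ((l : ZMod N) • v) ^ 3 -
      (21 : ℂ) • ((aForm : ℍ → ℂ) * ∑ l ∈ Finset.Ico 1 N, torsionX N ((l : ZMod N) • v)) -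
      (14 * ((N : ℂ) - 1)) • (bForm : ℍ → ℂ) := by
    ext τ
    simp [isogB]
    ring
  rw [hA, hB]
  exact ⟨sub_mem (sub_mem ha (S.smul_mem (sum_mem fun l hl => pow_mem (hx l hl) 2) _))
    (S.smul_mem ha _), sub_mem (sub_mem (sub_mem hb
    (S.smul_mem (sum_mem fun l hl => pow_mem (hx l hl) 3) _))
    (S.smul_mem (mul_mem ha (sum_mem fun l hl => hx l hl)) _)) (S.smul_mem hb _)⟩

/-- Functions that are holomorphic on the upper half plane. -/
def holomorphicSubalgebra : Subalgebra ℂ (ℍ → ℂ) where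
  carrier := {f | MDiff f}
  mul_mem' hf hg := MDifferentiable.mul hf hg
  add_mem' hf hg := MDifferentiable.add hf hg
  algebraMap_mem' _ := mdifferentiable_const

theorem mdifferentiable_isog {v : Fin 2 → ZMod N} (hv : v ≠ 0) :
    isogA N v ∈ holomorphicSubalgebra ∧ isogB N v ∈ holomorphicSubalgebra :=
  isog_mem holomorphicSubalgebra aForm.holo' bForm.holo' fun _ hl =>
    mdifferentiable_torsionX (natCast_smul_ne_zero hv hl)

theorem isBoundedAtImInfty_isog {v : Fin 2 → ZMod N} (hv : v ≠ 0) :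
    IsBoundedAtImInfty (isogA N v) ∧ IsBoundedAtImInfty (isogB N v) :=
  isog_mem (boundedAtImInftySubalgebra ℂ) (isBoundedAtImInfty_levelOne aForm)
    (isBoundedAtImInfty_levelOne bForm) fun _ hl =>
    isBoundedAtImInfty_torsionX (natCast_smul_ne_zero hv hl)

/-- The sum of `a'ⁱ b'ʲ` over all pairs of an isogeny of degree `N` with a generator of its
kernel. -/
def isogSum (N : ℕ) [NeZero N] (i j : ℕ) : ℍ → ℂ :=
  ∑ v : {v : Fin 2 → ZMod N // v ≠ 0}, isogA N v.1 ^ i * isogB N v.1 ^ j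

omit [Fact N.Prime] in
theorem isogSum_smul (i j : ℕ) (γ : SL(2, ℤ)) (τ : ℍ) :
    isogSum N i j (γ • τ) = denom γ τ ^ (4 * i + 6 * j) * isogSum N i j τ := by
  simp only [isogSum, Finset.sum_apply, Finset.mul_sum]
  refine Fintype.sum_equiv
    { toFun := fun v => ⟨rowAct v.1 γ, rowAct_ne_zero v.2 γ⟩
      invFun := fun v => ⟨rowAct v.1 γ⁻¹, rowAct_ne_zero v.2 γ⁻¹⟩
      left_inv := fun v => Subtype.ext (rowAct_inv_rowAct _ _)
      right_inv := fun v => Subtype.ext (rowAct_rowAct_inv _ _) } _ _ fun v => ?_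
  simp only [Pi.mul_apply, Pi.pow_apply, isogA_smul, isogB_smul, Equiv.coe_fn_mk]
  ring

omit [Fact N.Prime] in
theorem isogSum_slash (i j : ℕ) (γ : SL(2, ℤ)) :
    isogSum N i j ∣[((4 * i + 6 * j : ℕ) : ℤ)] γ = isogSum N i j := by
  ext τ
  rw [SL_slash_apply, isogSum_smul, zpow_neg, zpow_natCast, mul_comm, ← mul_assoc,
    inv_mul_cancel₀ (pow_ne_zero _ (denom_ne_zero _ _)), one_mul]

/-- `isogSum` is a modular form of level one. -/
def isogForm (N : ℕ) [NeZero N] [Fact N.Prime] (i j : ℕ) :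
    ModularForm 𝒮ℒ ((4 * i + 6 * j : ℕ) : ℤ) where
  toFun := isogSum N i j
  slash_action_eq' := by
    rintro _ ⟨γ, rfl⟩
    exact isogSum_slash i j γ
  holo' := by
    change isogSum N i j ∈ holomorphicSubalgebra
    exact sum_mem fun v _ => mul_mem (pow_mem (mdifferentiable_isog v.2).1 i)
      (pow_mem (mdifferentiable_isog v.2).2 j)
  bdd_at_cusps' {c} hc := by
    rw [Subgroup.IsArithmetic.isCusp_iff_isCusp_SL2Z] at hc
    rw [OnePoint.isBoundedAt_iff_forall_SL2Z hc]
    intro γ _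
    rw [isogSum_slash]
    change isogSum N i j ∈ boundedAtImInftySubalgebra ℂ
    exact sum_mem fun v _ => mul_mem (pow_mem (isBoundedAtImInfty_isog v.2).1 i)
      (pow_mem (isBoundedAtImInfty_isog v.2).2 j)

theorem isog_zero_eq {w : ZMod N} (hw : w ≠ 0) (i j : ℕ) (τ : ℍ) :
    isogA N ![0, w] τ ^ i * isogB N ![0, w] τ ^ j =
      primed N (4 * i + 6 * j) (fun z => aForm z ^ i * bForm z ^ j) τ := by
  rw [isogA_zero hw, isogB_zero hw, primed, primed, primed]
  ring

theorem isog_of_ne_eq {v : Fin 2 → ZMod N} (hv : v 0 ≠ 0) {t : ℕ} (ht : v 0 * t = v 1) (i j : ℕ)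
    (τ : ℍ) : isogA N v τ ^ i * isogB N v τ ^ j =
      (fun z => aForm z ^ i * bForm z ^ j) (ofComplex (((τ : ℂ) + t) / N)) := by
  rw [isogA_of_ne hv ht, isogB_of_ne hv ht]

omit [Fact N.Prime] in
theorem natCast_mul_hecke (k : ℕ) (f : ℍ → ℂ) (τ : ℍ) : (N : ℂ) * hecke N k f τ =
    primed N k f τ + ∑ t ∈ Finset.range N, f (ofComplex (((τ : ℂ) + t) / N)) := by
  rw [hecke, ← mul_assoc, mul_one_div_cancel (Nat.cast_ne_zero.2 (NeZero.ne N)), one_mul]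

/-- Every nonzero vector is uniquely `(0, w)` or `(w, w t)` with `w ≠ 0` and `0 ≤ t < N`; the
summand does not depend on `w`. -/
theorem isogSum_eq (i j : ℕ) (τ : ℍ) : isogSum N i j τ = ((N : ℂ) - 1) * N *
    hecke N (4 * i + 6 * j) (fun z => aForm z ^ i * bForm z ^ j) τ := by
  have hp : N.Prime := Fact.out
  set f : ℍ → ℂ := fun z => aForm z ^ i * bForm z ^ j with hf
  rw [mul_assoc, natCast_mul_hecke, isogSum, Finset.sum_apply]
  simp only [Pi.mul_apply, Pi.pow_apply]
  let e : {w : ZMod N // w ≠ 0} × Option (Fin N) → {v : Fin 2 → ZMod N // v ≠ 0} := fun p =>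
    match p with
    | (w, none) => ⟨![0, w.1], ne_zero_of_one w.2⟩
    | (w, some t) => ⟨![w.1, w.1 * (t : ℕ)], ne_zero_of_zero w.2⟩
  have he : Function.Bijective e := by
    constructor
    · rintro ⟨w, _ | t⟩ ⟨w', _ | t'⟩ h
      · have h1 : w.1 = w'.1 := congrFun (congrArg Subtype.val h) 1
        rw [Subtype.ext h1]
      · exact absurd (congrFun (congrArg Subtype.val h) 0).symm w'.2
      · exact absurd (congrFun (congrArg Subtype.val h) 0) w.2
      · have h0 : w.1 = w'.1 := congrFun (congrArg Subtype.val h) 0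
        have h1 : w.1 * (t : ℕ) = w'.1 * (t' : ℕ) := congrFun (congrArg Subtype.val h) 1
        rw [← h0] at h1
        have h2 := mul_left_cancel₀ w.2 h1
        rw [ZMod.natCast_eq_natCast_iff', Nat.mod_eq_of_lt t.2, Nat.mod_eq_of_lt t'.2] at h2
        rw [Subtype.ext h0, Fin.ext h2]
    · rintro ⟨v, hv⟩
      by_cases h0 : v 0 = 0
      · have h1 : v 1 ≠ 0 := fun h1 => hv (by ext k; fin_cases k <;> [exact h0; exact h1])
        refine ⟨(⟨v 1, h1⟩, none), Subtype.ext ?_⟩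
        ext k
        fin_cases k
        · exact h0.symm
        · rfl
      · refine ⟨(⟨v 0, h0⟩, some ⟨((v 0)⁻¹ * v 1).val, ZMod.val_lt _⟩), Subtype.ext ?_⟩
        ext k
        fin_cases k
        · rfl
        · change v 0 * (((((v 0)⁻¹ * v 1).val : ℕ)) : ZMod N) = v 1
          rw [ZMod.natCast_val, ZMod.cast_id', id_eq, mul_inv_cancel_left₀ h0]
  rw [← he.sum_comp, Fintype.sum_prod_type]
  have hw : ∀ w : {w : ZMod N // w ≠ 0}, ∑ o : Option (Fin N),
      isogA N (e (w, o)).1 τ ^ i * isogB N (e (w, o)).1 τ ^ j =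
      primed N (4 * i + 6 * j) f τ + ∑ t ∈ Finset.range N, f (ofComplex (((τ : ℂ) + t) / N)) := by
    intro w
    rw [Fintype.sum_option, Finset.sum_range]
    congr 1
    · exact isog_zero_eq w.2 i j τ
    · exact Finset.sum_congr rfl fun t _ => isog_of_ne_eq (v := ![w.1, w.1 * (t : ℕ)]) w.2 rfl i j τ
  rw [Finset.sum_congr rfl fun w _ => hw w, Finset.sum_const, nsmul_eq_mul, Finset.card_univ,
    Fintype.card_subtype_compl, Fintype.card_subtype_eq, ZMod.card, Nat.cast_sub hp.one_lt.le,
    Nat.cast_one]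

/-- The sum over representatives up to sign; it is the trace of `a'ⁱ b'ʲ`. -/
theorem sum_torsionIndex (i j : ℕ) (τ : ℍ) :
    ∑ s : TorsionIndex N, isogA N (torsionVec N s) τ ^ i * isogB N (torsionVec N s) τ ^ j =
      ((N / 2 : ℕ) : ℂ) * N * hecke N (4 * i + 6 * j) (fun z => aForm z ^ i * bForm z ^ j) τ := by
  set f : ℍ → ℂ := fun z => aForm z ^ i * bForm z ^ j with hf
  rw [mul_assoc, natCast_mul_hecke, Fintype.sum_prod_type]
  have hs : ∀ s : Fin (N / 2), ∑ o : Option (Fin N),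
      isogA N (torsionVec N (s, o)) τ ^ i * isogB N (torsionVec N (s, o)) τ ^ j =
      primed N (4 * i + 6 * j) f τ + ∑ t ∈ Finset.range N, f (ofComplex (((τ : ℂ) + t) / N)) := by
    intro s
    rw [Fintype.sum_option, Finset.sum_range]
    congr 1
    · exact isog_zero_eq (natCast_succ_ne_zero s) i j τ
    · exact Finset.sum_congr rfl fun t _ =>
        isog_of_ne_eq (v := torsionVec N (s, some t)) (natCast_succ_ne_zero s) rfl i j τ
  rw [Finset.sum_congr rfl fun s _ => hs s, Finset.sum_const, nsmul_eq_mul, Finset.card_univ,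
    Fintype.card_fin]

/-! ### The generating function -/

theorem exists_eval_eq_hecke (i j : ℕ) : ∃ P : MvPolynomial (Fin 2) ℂ, ∀ τ : ℍ,
    MvPolynomial.eval ![aForm τ, bForm τ] P =
      hecke N (4 * i + 6 * j) (fun z => aForm z ^ i * bForm z ^ j) τ := by
  have hp : N.Prime := Fact.out
  obtain ⟨P, hP⟩ := levelOne_mem _ (isogForm N i j)
  have hN : ((N : ℂ) - 1) * N ≠ 0 := mul_ne_zero
    (sub_ne_zero.2 (by exact_mod_cast hp.one_lt.ne')) (Nat.cast_ne_zero.2 (NeZero.ne N))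
  refine ⟨MvPolynomial.C (((N : ℂ) - 1) * N)⁻¹ * P, fun τ => ?_⟩
  have h : MvPolynomial.eval ![aForm τ, bForm τ] P = isogSum N i j τ := by
    rw [← evalAt_evalForms]
    exact congrFun hP τ
  rw [map_mul, MvPolynomial.eval_C, h, isogSum_eq, inv_mul_cancel_left₀ hN]

theorem exists_isHeckeGeneratingFunction : ∃ F, IsHeckeGeneratingFunction N F := by
  choose P hP using fun m : Fin 2 →₀ ℕ => exists_eval_eq_hecke (N := N) (m 0) (m 1)
  exact ⟨P, hP⟩

omit [NeZero N] [Fact N.Prime] in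
theorem IsHeckeGeneratingFunction.unique
    {F G : MvPowerSeries (Fin 2) (MvPolynomial (Fin 2) ℂ)} (hF : IsHeckeGeneratingFunction N F)
    (hG : IsHeckeGeneratingFunction N G) : G = F := by
  ext1 m
  refine evalForms_injective (ext_evalAt fun τ => ?_)
  rw [evalAt_evalForms, evalAt_evalForms, hF, hG]

end Hecke

/-! ### The matrices of the regular representation -/

section Matrices

open Polynomial

variable {N : ℕ} [NeZero N] [Fact N.Prime]

/-- The curve `y² = x³ + a x + b` over `ℛ`. -/
def curveR : WeierstrassCurve R₁ := ⟨0, 0, 0, aR, bR⟩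

theorem map_curveR {k : Type*} [Field k] (f : R₁ →+* k) : curveR.map f = curve (f aR) (f bR) := by
  simp [curveR, curve, WeierstrassCurve.map]

theorem evalAt_eval₂_inclusion {S : Subalgebra ℂ (ℍ → ℂ)} (hS : R₁ ≤ S) (x : S) (q : R₁[X])
    (τ : ℍ) : evalAt S τ (q.eval₂ (Subalgebra.inclusion hS).toRingHom x) =
      q.eval₂ (evalAt R₁ τ) ((x : ℍ → ℂ) τ) := by
  rw [hom_eval₂]
  rfl

/-- The multiplication formula for the points of order `N`, in any ring of functions containing
`ℛ` and the coordinates involved. -/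
theorem mul_eval₂_ΨSq (h3 : 3 ≤ N) {l : ℕ} (h1 : 1 ≤ l) (hl : l < N) {v : Fin 2 → ZMod N}
    (hv : v ≠ 0) {S : Subalgebra ℂ (ℍ → ℂ)} (hS : R₁ ≤ S) {x y : S}
    (hx : (x : ℍ → ℂ) = torsionX N v) (hy : (y : ℍ → ℂ) = torsionX N ((l : ZMod N) • v)) :
    y * (curveR.ΨSq l).eval₂ (Subalgebra.inclusion hS).toRingHom x =
        (curveR.Φ l).eval₂ (Subalgebra.inclusion hS).toRingHom x ∧
      (curveR.ΨSq l).eval₂ (Subalgebra.inclusion hS).toRingHom x ≠ 0 := by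
  have hc : ∀ τ, curveR.map (evalAt R₁ τ) = curve (aForm τ) (bForm τ) := fun τ => map_curveR _
  have hone : ∀ τ, torsionX N (((1 : ℕ) : ZMod N) • v) τ = torsionX N v τ := fun τ => by
    rw [Nat.cast_one, one_smul]
  constructor
  · refine ext_evalAt fun τ => ?_
    obtain ⟨z, hz⟩ := isMultipleSeq_torsionX h3 hv τ
    have := hz.mul_eval_ΨSq h1 hl
    rw [map_mul, evalAt_eval₂_inclusion, evalAt_eval₂_inclusion, evalAt_apply, hx, hy,
      ← eval_map, ← eval_map, ← WeierstrassCurve.map_ΨSq, ← WeierstrassCurve.map_Φ, hc]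
    rwa [hone] at this
  · intro h
    obtain ⟨z, hz⟩ := isMultipleSeq_torsionX h3 hv UpperHalfPlane.I
    have := hz.eval_ΨSq_ne_zero h1 hl
    rw [hone] at this
    apply this
    have h0 := congrArg (evalAt S UpperHalfPlane.I) h
    rwa [evalAt_eval₂_inclusion, hx, ← eval_map, ← WeierstrassCurve.map_ΨSq, hc, map_zero] at h0

theorem pow_torsionDegree_xField :
    xField N ^ torsionDegree N = ∑ i : Fin (torsionDegree N),
      (-((torsionPoly (algebraMap R₁ K₁ aR) (algebraMap R₁ K₁ bR) N).coeff i /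
        (torsionPoly (algebraMap R₁ K₁ aR) (algebraMap R₁ K₁ bR) N).coeff (torsionDegree N))) •
        powBasis N i := by
  have hp : N.Prime := Fact.out
  set p := torsionPoly (algebraMap R₁ K₁ aR) (algebraMap R₁ K₁ bR) N with hpd
  have hd : p.natDegree = torsionDegree N := natDegree_ringTorsionPoly hp _ _
  have h0 : p.coeff (torsionDegree N) ≠ 0 := by
    rw [← hd]
    exact leadingCoeff_ne_zero.2 (ringTorsionPoly_ne_zero hp _ _)
  have h : aeval (xField N) p = 0 := aeval_torsionPoly_xField
  rw [aeval_eq_sum_range, hd, Finset.sum_range_succ, Finset.sum_range] at h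
  have h' : xField N ^ torsionDegree N = (p.coeff (torsionDegree N))⁻¹ •
      -∑ i : Fin (torsionDegree N), p.coeff i • xField N ^ (i : ℕ) := by
    rw [← eq_neg_of_add_eq_zero_right h, inv_smul_smul₀ h0]
  rw [h', smul_neg, Finset.smul_sum, ← Finset.sum_neg_distrib]
  refine Finset.sum_congr rfl fun i _ => ?_
  rw [powBasis_apply, smul_smul, _root_.neg_smul, div_eq_inv_mul]

theorem leftMulMatrix_xField : Algebra.leftMulMatrix (powBasis N) (xField N) =
    xMatrix (algebraMap R₁ K₁ aR) (algebraMap R₁ K₁ bR) N := by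
  ext i j
  rw [Algebra.leftMulMatrix_eq_repr_mul, powBasis_apply, ← pow_succ', xMatrix]
  split_ifs with h h'
  · have : xField N ^ ((j : ℕ) + 1) = powBasis N ⟨j + 1, h⟩ := (powBasis_apply ⟨j + 1, h⟩).symm
    rw [this, Module.Basis.repr_self, Finsupp.single_apply, if_pos (Fin.ext h'.symm)]
  · have : xField N ^ ((j : ℕ) + 1) = powBasis N ⟨j + 1, h⟩ := (powBasis_apply ⟨j + 1, h⟩).symm
    rw [this, Module.Basis.repr_self, Finsupp.single_apply,
      if_neg fun e => h' (congrArg Fin.val e).symm]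
  · rw [show (j : ℕ) + 1 = torsionDegree N by have := j.2; omega, pow_torsionDegree_xField,
      Module.Basis.repr_sum_self]

/-- The coordinate `x_{ℓP}` as an element of `ℛ_{Γ_±(N)}`; it is only used for `1 ≤ ℓ < N`. -/
def xMulRing (N : ℕ) [NeZero N] [Fact N.Prime] (l : ℕ) : RPM N :=
  if h : l ∈ Finset.Ico 1 N then
    ⟨torsionX N ((l : ZMod N) • baseVec N),
      torsionX_mem_RPM (Finset.mem_Ico.1 h).1 (Finset.mem_Ico.1 h).2⟩
  else 0

theorem coe_xMulRing {l : ℕ} (h : l ∈ Finset.Ico 1 N) :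
    (xMulRing N l : ℍ → ℂ) = torsionX N ((l : ZMod N) • baseVec N) := by
  rw [xMulRing, dif_pos h]

theorem xMulRing_one : xMulRing N 1 = xRing N := by
  apply Subtype.ext
  rw [coe_xMulRing (Finset.mem_Ico.2 ⟨le_rfl, (Fact.out : N.Prime).one_lt⟩), Nat.cast_one, one_smul]
  rfl

theorem leftMulMatrix_eval₂ (q : R₁[X]) : Algebra.leftMulMatrix (powBasis N)
      (algebraMap (RPM N) (KPM N) (q.eval₂ (inclR N) (xRing N))) =
    aeval (xMatrix (algebraMap R₁ K₁ aR) (algebraMap R₁ K₁ bR) N) (q.map (algebraMap R₁ K₁)) := by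
  rw [← aeval_map_xField, ← leftMulMatrix_xField, ← aeval_algHom_apply]

/-- The regular representation carries `x_(ℓP)` to `X_ℓ`, by `x(ℓP) = φ_ℓ / ψ_ℓ²`. -/
theorem leftMulMatrix_xMulRing (h3 : 3 ≤ N) {l : ℕ} (hl : l ∈ Finset.Ico 1 N) :
    Algebra.leftMulMatrix (powBasis N) (algebraMap (RPM N) (KPM N) (xMulRing N l)) =
      xMulMatrix (algebraMap R₁ K₁ aR) (algebraMap R₁ K₁ bR) N l := by
  obtain ⟨h1, h2⟩ := Finset.mem_Ico.1 hl
  obtain ⟨he, hne⟩ := mul_eval₂_ΨSq h3 h1 h2 baseVec_ne_zero (modularRing_mono (GammaPM_le N))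
    (x := xRing N) rfl (coe_xMulRing hl)
  change _ * (curveR.ΨSq l).eval₂ (inclR N) _ = (curveR.Φ l).eval₂ (inclR N) _ at he
  change (curveR.ΨSq l).eval₂ (inclR N) _ ≠ 0 at hne
  set u := algebraMap (RPM N) (KPM N) ((curveR.ΨSq l).eval₂ (inclR N) (xRing N)) with hu
  have hu0 : u ≠ 0 := (map_ne_zero_iff _ (IsFractionRing.injective (RPM N) (KPM N))).2 hne
  have hx : algebraMap (RPM N) (KPM N) (xMulRing N l) =
      algebraMap (RPM N) (KPM N) ((curveR.Φ l).eval₂ (inclR N) (xRing N)) * u⁻¹ := by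
    rw [← he, map_mul, ← hu, mul_inv_cancel_right₀ hu0]
  have hinv : (Algebra.leftMulMatrix (powBasis N) u)⁻¹ =
      Algebra.leftMulMatrix (powBasis N) u⁻¹ := by
    apply Matrix.inv_eq_right_inv
    rw [← map_mul, mul_inv_cancel₀ hu0, map_one]
  rw [hx, map_mul, ← hinv, hu, leftMulMatrix_eval₂, leftMulMatrix_eval₂, xMulMatrix,
    ← WeierstrassCurve.map_ΨSq, ← WeierstrassCurve.map_Φ, map_curveR]

theorem xMulRing_sub {l : ℕ} (hl : l ∈ Finset.Ico 1 N) : xMulRing N (N - l) = xMulRing N l := by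
  obtain ⟨h1, h2⟩ := Finset.mem_Ico.1 hl
  apply Subtype.ext
  rw [coe_xMulRing hl, coe_xMulRing (Finset.mem_Ico.2 (by omega)), Nat.cast_sub h2.le,
    ZMod.natCast_self, zero_sub, _root_.neg_smul]
  exact funext fun τ => torsionX_neg _ _

omit [NeZero N] [Fact N.Prime] in
theorem sum_Ico_eq_two_mul {M : Type*} [CommSemiring M] (hN : Odd N) (f : ℕ → M)
    (hf : ∀ l ∈ Finset.Ico 1 N, f (N - l) = f l) :
    ∑ l ∈ Finset.Ico 1 N, f l = 2 * ∑ l ∈ Finset.Icc 1 ((N - 1) / 2), f l := by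
  obtain ⟨m, rfl⟩ := hN
  have hm : (2 * m + 1 - 1) / 2 = m := by omega
  have h2 : Finset.Icc 1 m = Finset.Ico 1 (m + 1) := by ext; simp
  rw [hm, two_mul (∑ l ∈ _, f l), h2, ← Finset.sum_Ico_consecutive f (show 1 ≤ m + 1 by omega)
    (show m + 1 ≤ 2 * m + 1 by omega)]
  congr 1
  refine Finset.sum_nbij' (fun l => 2 * m + 1 - l) (fun l => 2 * m + 1 - l) ?_ ?_ ?_ ?_ ?_
  all_goals intro l hl
  all_goals rw [Finset.mem_Ico] at hl
  any_goals rw [Finset.mem_Ico]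
  any_goals omega
  exact (hf l (Finset.mem_Ico.2 (by omega))).symm

theorem primed_mem_RPM : primed N 4 aForm ∈ RPM N ∧ primed N 6 bForm ∈ RPM N := by
  have hA : isogA N ![0, 1] = primed N 4 aForm := funext (isogA_zero one_ne_zero)
  have hB : isogB N ![0, 1] = primed N 6 bForm := funext (isogB_zero one_ne_zero)
  rw [← hA, ← hB]
  exact isog_mem _ (modularRing_mono (GammaPM_le N) aR.2) (modularRing_mono (GammaPM_le N) bR.2)
    fun l hl => torsionX_mem_RPM (Finset.mem_Ico.1 hl).1 (Finset.mem_Ico.1 hl).2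

/-- `a'` as an element of `ℛ_{Γ_±(N)}`. -/
def aPrime (N : ℕ) [NeZero N] [Fact N.Prime] : RPM N := ⟨primed N 4 aForm, primed_mem_RPM.1⟩

/-- `b'` as an element of `ℛ_{Γ_±(N)}`. -/
def bPrime (N : ℕ) [NeZero N] [Fact N.Prime] : RPM N := ⟨primed N 6 bForm, primed_mem_RPM.2⟩

theorem aPrime_eq : aPrime N = inclR N aR - 15 * ∑ l ∈ Finset.Ico 1 N, xMulRing N l ^ 2 -
    5 * ((N : RPM N) - 1) * inclR N aR := by
  refine ext_evalAt fun τ => ?_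
  simp only [map_sub, map_mul, map_sum, map_pow, map_natCast, map_one, map_ofNat, evalAt_inclR]
  refine (isogA_zero one_ne_zero τ).symm.trans ?_
  have hx : ∀ l ∈ Finset.Ico 1 N, evalAt (RPM N) τ (xMulRing N l) =
      torsionX N ((l : ZMod N) • baseVec N) τ := fun l hl => by
    rw [evalAt_apply, coe_xMulRing hl]
  rw [Finset.sum_congr rfl fun l hl => by rw [hx l hl]]
  rfl

theorem bPrime_eq : bPrime N = inclR N bR - 35 * ∑ l ∈ Finset.Ico 1 N, xMulRing N l ^ 3 -
    21 * inclR N aR * ∑ l ∈ Finset.Ico 1 N, xMulRing N l -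
    14 * ((N : RPM N) - 1) * inclR N bR := by
  refine ext_evalAt fun τ => ?_
  simp only [map_sub, map_mul, map_sum, map_pow, map_natCast, map_one, map_ofNat, evalAt_inclR]
  refine (isogB_zero one_ne_zero τ).symm.trans ?_
  have hx : ∀ l ∈ Finset.Ico 1 N, evalAt (RPM N) τ (xMulRing N l) =
      torsionX N ((l : ZMod N) • baseVec N) τ := fun l hl => by
    rw [evalAt_apply, coe_xMulRing hl]
  rw [Finset.sum_congr rfl fun l hl => by rw [hx l hl], Finset.sum_congr rfl hx]
  rfl

theorem leftMulMatrix_inclR (r : R₁) : Algebra.leftMulMatrix (powBasis N)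
    (algebraMap (RPM N) (KPM N) (inclR N r)) = algebraMap K₁ _ (algebraMap R₁ K₁ r) := by
  rw [← algebraMap_algebraMap, AlgHom.commutes]

theorem cubic_xField (h2 : N = 2) : xField N ^ 3 +
    algebraMap K₁ (KPM N) (algebraMap R₁ K₁ aR) * xField N +
    algebraMap K₁ (KPM N) (algebraMap R₁ K₁ bR) = 0 := by
  have := aeval_torsionPoly_xField (N := N)
  rw [torsionPoly, if_pos h2] at this
  simpa using this

theorem leftMulMatrix_aPrime :
    Algebra.leftMulMatrix (powBasis N) (algebraMap (RPM N) (KPM N) (aPrime N)) =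
      aMatrix (algebraMap R₁ K₁ aR) (algebraMap R₁ K₁ bR) N := by
  have hp : N.Prime := Fact.out
  rw [aMatrix]
  split_ifs with h2
  · have h : aPrime N = -4 * inclR N aR - 15 * xRing N ^ 2 := by
      subst h2
      rw [aPrime_eq, show Finset.Ico 1 2 = {1} by rfl, Finset.sum_singleton, xMulRing_one]
      push_cast
      ring
    rw [h]
    simp only [map_sub, map_mul, map_neg, map_ofNat, map_pow, leftMulMatrix_inclR,
      ← leftMulMatrix_xField, Algebra.smul_def, mul_one]
    rfl
  · have ho := hp.odd_of_ne_two h2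
    have h3 : 3 ≤ N := by have := hp.two_le; omega
    have h : aPrime N = inclR N aR - 30 * ∑ l ∈ Finset.Icc 1 ((N - 1) / 2), xMulRing N l ^ 2 -
        5 * ((N : RPM N) - 1) * inclR N aR := by
      rw [aPrime_eq, sum_Ico_eq_two_mul ho _ fun l hl => by rw [xMulRing_sub hl]]
      ring
    rw [h]
    simp only [map_sub, map_mul, map_sum, map_natCast, map_one, map_ofNat, map_pow,
      leftMulMatrix_inclR, Algebra.smul_def, mul_one]
    rw [Finset.sum_congr rfl fun l hl => by
      rw [leftMulMatrix_xMulRing h3 (Finset.mem_Ico.2 (by rw [Finset.mem_Icc] at hl; omega))]]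

theorem leftMulMatrix_bPrime :
    Algebra.leftMulMatrix (powBasis N) (algebraMap (RPM N) (KPM N) (bPrime N)) =
      bMatrix (algebraMap R₁ K₁ aR) (algebraMap R₁ K₁ bR) N := by
  have hp : N.Prime := Fact.out
  rw [bMatrix]
  split_ifs with h2
  · have h : algebraMap (RPM N) (KPM N) (bPrime N) =
        22 * algebraMap K₁ (KPM N) (algebraMap R₁ K₁ bR) +
          14 * algebraMap K₁ (KPM N) (algebraMap R₁ K₁ aR) * xField N := by
      have hc := cubic_xField h2
      have hb : bPrime N = -13 * inclR N bR - 35 * xRing N ^ 3 - 21 * inclR N aR * xRing N := by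
        subst h2
        rw [bPrime_eq, show Finset.Ico 1 2 = {1} by rfl, Finset.sum_singleton,
          Finset.sum_singleton, xMulRing_one]
        push_cast
        ring
      rw [hb]
      simp only [map_sub, map_mul, map_neg, map_ofNat, map_pow, ← algebraMap_algebraMap]
      change _ * _ - 35 * xField N ^ 3 - _ * _ * xField N = _
      linear_combination -35 * hc
    rw [h]
    simp only [map_add, map_mul, map_ofNat, AlgHom.commutes, ← leftMulMatrix_xField,
      Algebra.smul_def, mul_one]
  · have ho := hp.odd_of_ne_two h2
    have h3 : 3 ≤ N := by have := hp.two_le; omega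
    have h : bPrime N = inclR N bR - 70 * ∑ l ∈ Finset.Icc 1 ((N - 1) / 2), xMulRing N l ^ 3 -
        42 * inclR N aR * ∑ l ∈ Finset.Icc 1 ((N - 1) / 2), xMulRing N l -
        14 * ((N : RPM N) - 1) * inclR N bR := by
      rw [bPrime_eq, sum_Ico_eq_two_mul ho _ fun l hl => by rw [xMulRing_sub hl],
        sum_Ico_eq_two_mul ho _ fun l hl => by rw [xMulRing_sub hl]]
      ring
    rw [h]
    have hx : ∀ l ∈ Finset.Icc 1 ((N - 1) / 2),
        Algebra.leftMulMatrix (powBasis N) (algebraMap (RPM N) (KPM N) (xMulRing N l)) =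
          xMulMatrix (algebraMap R₁ K₁ aR) (algebraMap R₁ K₁ bR) N l := fun l hl =>
      leftMulMatrix_xMulRing h3 (Finset.mem_Ico.2 (by rw [Finset.mem_Icc] at hl; omega))
    simp only [map_sub, map_mul, map_sum, map_natCast, map_one, map_ofNat, map_pow,
      leftMulMatrix_inclR, Algebra.smul_def, mul_one]
    rw [Finset.sum_congr rfl hx, Finset.sum_congr rfl fun l hl => by rw [hx l hl]]

end Matrices

/-! ### Embeddings of `𝒦_{Γ_±(N)}` over `𝒦` -/

section Embeddings

open Polynomial

variable {N : ℕ} [NeZero N] [Fact N.Prime]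

instance instIsDomainHolomorphic : IsDomain holomorphicSubalgebra :=
  have : NoZeroDivisors holomorphicSubalgebra :=
    ⟨fun {f g} h => by
      rcases (UpperHalfPlane.mul_eq_zero_iff f.2 g.2).1 (congrArg Subtype.val h) with h | h
      · exact Or.inl (Subtype.ext h)
      · exact Or.inr (Subtype.ext h)⟩
  NoZeroDivisors.to_isDomain _

/-- An algebraic closure of the field of meromorphic functions on the upper half plane. -/
def merClosure : Type := AlgebraicClosure (FractionRing holomorphicSubalgebra)

instance instFieldMerClosure : Field merClosure :=
  inferInstanceAs (Field (AlgebraicClosure (FractionRing holomorphicSubalgebra)))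

instance instIsAlgClosedMerClosure : IsAlgClosed merClosure :=
  inferInstanceAs (IsAlgClosed (AlgebraicClosure (FractionRing holomorphicSubalgebra)))

/-- Holomorphic functions as elements of `merClosure`. -/
def holToMer : holomorphicSubalgebra →+* merClosure :=
  (algebraMap (FractionRing holomorphicSubalgebra)
    (AlgebraicClosure (FractionRing holomorphicSubalgebra))).comp
    (algebraMap holomorphicSubalgebra (FractionRing holomorphicSubalgebra))

theorem holToMer_injective : Function.Injective holToMer :=
  (algebraMap (FractionRing holomorphicSubalgebra)
    (AlgebraicClosure (FractionRing holomorphicSubalgebra))).injective.comp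
    (IsFractionRing.injective _ _)

theorem R₁_le : R₁ ≤ holomorphicSubalgebra := fun _ hf => mdifferentiable_of_mem hf

/-- Forms of level one as holomorphic functions. -/
def inclHol : R₁ →+* holomorphicSubalgebra := (Subalgebra.inclusion R₁_le).toRingHom

theorem inclHol_injective : Function.Injective inclHol := Subalgebra.inclusion_injective R₁_le

theorem holToMer_inclHol_injective : Function.Injective (holToMer.comp inclHol) := by
  rw [RingHom.coe_comp]
  exact holToMer_injective.comp inclHol_injective

instance instAlgebraMerClosure : Algebra K₁ merClosure :=
  (IsFractionRing.lift (A := R₁) (K := K₁) holToMer_inclHol_injective).toAlgebra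

theorem algebraMap_merClosure (r : R₁) :
    algebraMap K₁ merClosure (algebraMap R₁ K₁ r) = holToMer (inclHol r) :=
  IsFractionRing.lift_algebraMap holToMer_inclHol_injective r

/-- `x_v` as a holomorphic function; it is only used for `v ≠ 0`. -/
def xHol (v : Fin 2 → ZMod N) : holomorphicSubalgebra :=
  if hv : v ≠ 0 then ⟨torsionX N v, mdifferentiable_torsionX hv⟩ else 0

theorem coe_xHol {v : Fin 2 → ZMod N} (hv : v ≠ 0) : (xHol v : ℍ → ℂ) = torsionX N v := by
  rw [xHol, dif_pos hv]

theorem aeval_holToMer (q : R₁[X]) (x : holomorphicSubalgebra) :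
    aeval (holToMer x) (q.map (algebraMap R₁ K₁)) = holToMer (q.eval₂ inclHol x) := by
  rw [aeval_def, eval₂_map, hom_eval₂]
  congr 1
  exact RingHom.ext algebraMap_merClosure

theorem aeval_minpoly_xHol {v : Fin 2 → ZMod N} (hv : v ≠ 0) :
    aeval (holToMer (xHol v)) (minpoly K₁ (xField N)) = 0 := by
  have hp : N.Prime := Fact.out
  obtain ⟨q, hq⟩ := minpoly.dvd K₁ (xField N) aeval_torsionPoly_xField
  have h0 : torsionPoly (algebraMap R₁ K₁ aR) (algebraMap R₁ K₁ bR) N ≠ 0 :=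
    ringTorsionPoly_ne_zero hp _ _
  have hm := minpoly.ne_zero (isIntegral_xField (N := N))
  have hq0 : q ≠ 0 := fun h => h0 (by rw [hq, h, mul_zero])
  have hd : q.natDegree = 0 := by
    have h1 := natDegree_mul hm hq0
    rw [← hq, natDegree_minpoly_xField] at h1
    have h2 : (torsionPoly (algebraMap R₁ K₁ aR) (algebraMap R₁ K₁ bR) N).natDegree =
      torsionDegree N := natDegree_ringTorsionPoly hp _ _
    omega
  have hroot : aeval (holToMer (xHol v))
      (torsionPoly (algebraMap R₁ K₁ aR) (algebraMap R₁ K₁ bR) N) = 0 := by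
    rw [← map_torsionPolyR, aeval_holToMer, ← map_zero holToMer]
    congr 1
    refine ext_evalAt fun τ => ?_
    rw [inclHol, evalAt_eval₂_inclusion, coe_xHol hv, eval₂_torsionPolyR hv, map_zero]
  rw [hq, map_mul, eq_C_of_natDegree_eq_zero hd, aeval_C] at hroot
  refine (mul_eq_zero.1 hroot).resolve_right ((_root_.map_ne_zero _).2 fun h => hq0 ?_)
  rw [eq_C_of_natDegree_eq_zero hd, h, map_zero]

/-- The power basis of `𝒦_{Γ_±(N)}` given by `x_P`. -/
def xPowerBasis (N : ℕ) [NeZero N] [Fact N.Prime] : PowerBasis K₁ (KPM N) where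
  gen := xField N
  dim := torsionDegree N
  basis := powBasis N
  basis_eq_pow := powBasis_apply

instance instFiniteDimensionalKPM : FiniteDimensional K₁ (KPM N) := (xPowerBasis N).finite

/-- The embedding of `𝒦_{Γ_±(N)}` that carries `x_P` to `x_v`. -/
def emb {v : Fin 2 → ZMod N} (hv : v ≠ 0) : KPM N →ₐ[K₁] merClosure :=
  (xPowerBasis N).lift (holToMer (xHol v)) (aeval_minpoly_xHol hv)

theorem emb_xField {v : Fin 2 → ZMod N} (hv : v ≠ 0) :
    emb hv (xField N) = holToMer (xHol v) :=
  (xPowerBasis N).lift_gen _ (aeval_minpoly_xHol hv)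

theorem emb_inclR {v : Fin 2 → ZMod N} (hv : v ≠ 0) (r : R₁) :
    emb hv (algebraMap (RPM N) (KPM N) (inclR N r)) = holToMer (inclHol r) := by
  rw [← algebraMap_algebraMap, AlgHom.commutes, algebraMap_merClosure]

theorem emb_eval₂ {v : Fin 2 → ZMod N} (hv : v ≠ 0) (q : R₁[X]) :
    emb hv (algebraMap (RPM N) (KPM N) (q.eval₂ (inclR N) (xRing N))) =
      holToMer (q.eval₂ inclHol (xHol v)) := by
  rw [← aeval_map_xField, ← aeval_algHom_apply, emb_xField, aeval_holToMer]

theorem emb_xMulRing {v : Fin 2 → ZMod N} (hv : v ≠ 0) {l : ℕ} (hl : l ∈ Finset.Ico 1 N) :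
    emb hv (algebraMap (RPM N) (KPM N) (xMulRing N l)) =
      holToMer (xHol ((l : ZMod N) • v)) := by
  obtain ⟨h1, h2⟩ := Finset.mem_Ico.1 hl
  by_cases h3 : 3 ≤ N
  · obtain ⟨e, -⟩ := mul_eval₂_ΨSq h3 h1 h2 baseVec_ne_zero (modularRing_mono (GammaPM_le N))
      (x := xRing N) rfl (coe_xMulRing hl)
    obtain ⟨e', hne⟩ := mul_eval₂_ΨSq h3 h1 h2 hv R₁_le (coe_xHol hv)
      (coe_xHol (natCast_smul_ne_zero hv hl))
    have e1 : emb hv (algebraMap (RPM N) (KPM N)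
        (xMulRing N l * (curveR.ΨSq l).eval₂ (inclR N) (xRing N))) = emb hv (algebraMap _ _
          ((curveR.Φ l).eval₂ (inclR N) (xRing N))) :=
      congrArg (fun z => emb hv (algebraMap _ _ z)) e
    rw [map_mul, map_mul, emb_eval₂, emb_eval₂] at e1
    have e2 : holToMer (xHol ((l : ZMod N) • v) * (curveR.ΨSq l).eval₂ inclHol (xHol v)) =
      holToMer ((curveR.Φ l).eval₂ inclHol (xHol v)) := congrArg holToMer e'
    rw [map_mul] at e2
    exact mul_right_cancel₀ ((map_ne_zero_iff _ holToMer_injective).2 hne) (e1.trans e2.symm)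
  · obtain rfl : l = 1 := by omega
    rw [xMulRing_one, Nat.cast_one, one_smul]
    exact emb_xField hv

/-- The conjugates of `a'` are the coefficients `a` of the isogenous curves. -/
theorem emb_aPrime {v : Fin 2 → ZMod N} (hv : v ≠ 0) :
    emb hv (algebraMap (RPM N) (KPM N) (aPrime N)) =
      holToMer ⟨isogA N v, (mdifferentiable_isog hv).1⟩ := by
  have hA : (⟨isogA N v, (mdifferentiable_isog hv).1⟩ : holomorphicSubalgebra) =
      inclHol aR - 15 * ∑ l ∈ Finset.Ico 1 N, xHol ((l : ZMod N) • v) ^ 2 -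
        5 * ((N : holomorphicSubalgebra) - 1) * inclHol aR := by
    refine ext_evalAt fun τ => ?_
    simp only [map_sub, map_mul, map_sum, map_pow, map_natCast, map_one, map_ofNat]
    rw [Finset.sum_congr rfl fun l hl => by
      rw [evalAt_apply, coe_xHol (natCast_smul_ne_zero hv hl)]]
    rfl
  rw [hA, aPrime_eq]
  simp only [map_sub, map_mul, map_sum, map_pow, map_natCast, map_one, map_ofNat, emb_inclR]
  rw [Finset.sum_congr rfl fun l hl => by rw [emb_xMulRing hv hl]]

theorem emb_bPrime {v : Fin 2 → ZMod N} (hv : v ≠ 0) :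
    emb hv (algebraMap (RPM N) (KPM N) (bPrime N)) =
      holToMer ⟨isogB N v, (mdifferentiable_isog hv).2⟩ := by
  have hB : (⟨isogB N v, (mdifferentiable_isog hv).2⟩ : holomorphicSubalgebra) =
      inclHol bR - 35 * ∑ l ∈ Finset.Ico 1 N, xHol ((l : ZMod N) • v) ^ 3 -
        21 * inclHol aR * ∑ l ∈ Finset.Ico 1 N, xHol ((l : ZMod N) • v) -
        14 * ((N : holomorphicSubalgebra) - 1) * inclHol bR := by
    refine ext_evalAt fun τ => ?_
    simp only [map_sub, map_mul, map_sum, map_pow, map_natCast, map_one, map_ofNat]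
    have hx : ∀ l ∈ Finset.Ico 1 N, evalAt _ τ (xHol ((l : ZMod N) • v)) =
        torsionX N ((l : ZMod N) • v) τ := fun l hl => by
      rw [evalAt_apply, coe_xHol (natCast_smul_ne_zero hv hl)]
    rw [Finset.sum_congr rfl fun l hl => by rw [hx l hl], Finset.sum_congr rfl hx]
    rfl
  rw [hB, bPrime_eq]
  simp only [map_sub, map_mul, map_sum, map_pow, map_natCast, map_one, map_ofNat, emb_inclR]
  rw [Finset.sum_congr rfl fun l hl => by rw [emb_xMulRing hv hl],
    Finset.sum_congr rfl fun l hl => emb_xMulRing hv hl]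

/-- The embeddings given by the `x_v` are all the embeddings of `𝒦_{Γ_±(N)}` over `𝒦`: there are
as many of them as the degree. -/
theorem emb_bijective :
    Function.Bijective fun s : TorsionIndex N => emb (torsionVec_ne_zero (N := N) s) := by
  classical
  rw [Fintype.bijective_iff_injective_and_card, AlgHom.card, finrank_KPM, card_torsionIndex]
  refine ⟨fun s t h => torsionX_injective UpperHalfPlane.I ?_, rfl⟩
  have h1 := DFunLike.congr_fun h (xField N)
  simp only [emb_xField] at h1
  have h2 := congrArg (evalAt _ UpperHalfPlane.I) (holToMer_injective h1)
  rwa [evalAt_apply, evalAt_apply, coe_xHol (torsionVec_ne_zero s),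
    coe_xHol (torsionVec_ne_zero t)] at h2

/-- The trace of `a'ⁱ b'ʲ` over `𝒦` is a multiple of the Hecke transform of `aⁱ bʲ`, since its
conjugates are the summands of the latter. -/
theorem trace_eq {F : MvPowerSeries (Fin 2) (MvPolynomial (Fin 2) ℂ)}
    (hF : IsHeckeGeneratingFunction N F) (m : Fin 2 →₀ ℕ) :
    Algebra.trace K₁ (KPM N) (algebraMap (RPM N) (KPM N) (aPrime N) ^ m 0 *
      algebraMap (RPM N) (KPM N) (bPrime N) ^ m 1) =
    ((N / 2 : ℕ) : K₁) * N * polyToField (MvPowerSeries.coeff m F) := by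
  apply (algebraMap K₁ merClosure).injective
  rw [trace_eq_sum_embeddings, ← emb_bijective.sum_comp]
  have h1 : ((N / 2 : ℕ) : K₁) * N * polyToField (MvPowerSeries.coeff m F) = algebraMap R₁ K₁
      (((N / 2 : ℕ) : R₁) * N * evalForms (MvPowerSeries.coeff m F)) := by
    rw [map_mul, map_mul, map_natCast, map_natCast]
    rfl
  rw [h1, algebraMap_merClosure]
  simp only [map_mul, map_pow, emb_aPrime, emb_bPrime]
  simp only [← map_mul, ← map_pow, ← map_sum]
  congr 1
  refine ext_evalAt fun τ => ?_
  rw [map_sum]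
  simp only [map_mul, map_pow, map_natCast]
  refine (sum_torsionIndex (N := N) (m 0) (m 1) τ).trans ?_
  rw [← hF m τ, ← evalAt_evalForms]
  rfl

theorem trace_leftMulMatrix {F : MvPowerSeries (Fin 2) (MvPolynomial (Fin 2) ℂ)}
    (hF : IsHeckeGeneratingFunction N F) (m : Fin 2 →₀ ℕ) :
    Matrix.trace (aMatrix (algebraMap R₁ K₁ aR) (algebraMap R₁ K₁ bR) N ^ m 0 *
      bMatrix (algebraMap R₁ K₁ aR) (algebraMap R₁ K₁ bR) N ^ m 1) =
    ((N / 2 : ℕ) : K₁) * N * polyToField (MvPowerSeries.coeff m F) := by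
  rw [← trace_eq hF m, Algebra.trace_eq_matrix_trace (powBasis N), map_mul, map_pow, map_pow,
    leftMulMatrix_aPrime, leftMulMatrix_bPrime]

end Embeddings

/-! ### The trace of the resolvent -/

section Resolvent

variable {k ι : Type*} [Field k] [Fintype ι] [DecidableEq ι]

/-- The matrix of power series whose coefficients are the entries of a family of matrices. -/
def seriesMatrix (V : (Fin 2 →₀ ℕ) → Matrix ι ι k) : Matrix ι ι (MvPowerSeries (Fin 2) k) :=
  Matrix.of fun i j m => V m i j

omit [Fintype ι] [DecidableEq ι] in
theorem coeff_seriesMatrix (V : (Fin 2 →₀ ℕ) → Matrix ι ι k) (i j : ι) (m : Fin 2 →₀ ℕ) :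
    MvPowerSeries.coeff m (seriesMatrix V i j) = V m i j := rfl

/-- The matrix `I - X S`, where `X` is one of the variables. -/
def oneSubMatrix (s : Fin 2) (S : Matrix ι ι k) : Matrix ι ι (MvPowerSeries (Fin 2) k) :=
  1 - (MvPowerSeries.X s : MvPowerSeries (Fin 2) k) • S.map (MvPowerSeries.C (σ := Fin 2))

theorem oneSubMatrix_mul (s : Fin 2) (S : Matrix ι ι k) (V : (Fin 2 →₀ ℕ) → Matrix ι ι k) :
    oneSubMatrix s S * seriesMatrix V = seriesMatrix fun m =>
      V m - if 1 ≤ m s then S * V (m - Finsupp.single s 1) else 0 := by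
  ext i j m
  rw [oneSubMatrix, sub_mul, one_mul, smul_mul_assoc, Matrix.sub_apply, Matrix.smul_apply, map_sub,
    coeff_seriesMatrix, coeff_seriesMatrix, Matrix.sub_apply, smul_eq_mul, MvPowerSeries.X_def,
    MvPowerSeries.coeff_monomial_mul, one_mul]
  simp only [Finsupp.single_le_iff]
  congr 1
  split_ifs
  · rw [Matrix.mul_apply, Matrix.mul_apply, map_sum]
    exact Finset.sum_congr rfl fun l _ => by
      rw [Matrix.map_apply, MvPowerSeries.coeff_C_mul, coeff_seriesMatrix]
  · rfl

/-- The inverse of `(I - A S) (I - B T)` is `∑ Tʲ Sⁱ Aⁱ Bʲ`. -/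
theorem oneSub_mul_oneSub_mul (S T : Matrix ι ι k) :
    oneSubMatrix 0 S * oneSubMatrix 1 T * seriesMatrix (fun m => T ^ m 1 * S ^ m 0) = 1 := by
  have h1 : oneSubMatrix 1 T * seriesMatrix (fun m => T ^ m 1 * S ^ m 0) =
      seriesMatrix fun m => if m 1 = 0 then S ^ m 0 else 0 := by
    rw [oneSubMatrix_mul]
    congr 1
    funext m
    rcases Nat.eq_zero_or_pos (m 1) with h | h
    · rw [if_neg (by omega), if_pos h, h, pow_zero, one_mul, sub_zero]
    · rw [if_pos (by omega), if_neg (by omega), Finsupp.tsub_apply, Finsupp.tsub_apply,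
        Finsupp.single_eq_same, Finsupp.single_eq_of_ne (by decide), Nat.sub_zero, ← mul_assoc,
        ← pow_succ', Nat.sub_add_cancel h, sub_self]
  rw [mul_assoc, h1, oneSubMatrix_mul]
  ext i j m
  rw [coeff_seriesMatrix, Finsupp.tsub_apply, Finsupp.tsub_apply,
    Finsupp.single_eq_same, Finsupp.single_eq_of_ne (by decide), Nat.sub_zero]
  have hm : m = 0 ↔ m 0 = 0 ∧ m 1 = 0 := by
    rw [Finsupp.ext_iff, Fin.forall_fin_two]
    rfl
  have hone : MvPowerSeries.coeff m ((1 : Matrix ι ι (MvPowerSeries (Fin 2) k)) i j) =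
      if m = 0 then (1 : Matrix ι ι k) i j else 0 := by
    rw [Matrix.one_apply, Matrix.one_apply]
    split_ifs with h1 h2 h2 <;> simp [MvPowerSeries.coeff_one, h2]
  rw [hone]
  by_cases h1 : m 1 = 0
  · rw [if_pos h1, if_pos h1]
    rcases Nat.eq_zero_or_pos (m 0) with h | h
    · rw [if_neg (by omega), if_pos (hm.2 ⟨h, h1⟩), h, pow_zero, sub_zero]
    · rw [if_pos (by omega), if_neg (fun e => h.ne' (hm.1 e).1), ← pow_succ', Nat.sub_add_cancel h,
        sub_self, Matrix.zero_apply]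
  · rw [if_neg h1, if_neg h1, if_neg (fun e => h1 (hm.1 e).2), mul_zero, ite_self, sub_zero,
      Matrix.zero_apply]

theorem coeff_traceSeries (S T : Matrix ι ι k) (m : Fin 2 →₀ ℕ) :
    MvPowerSeries.coeff m (traceSeries S T) = Matrix.trace (S ^ m 0 * T ^ m 1) := by
  have h : traceSeries S T = Matrix.trace (seriesMatrix fun m => T ^ m 1 * S ^ m 0) :=
    congrArg Matrix.trace (Matrix.inv_eq_right_inv (oneSub_mul_oneSub_mul S T))
  rw [h, Matrix.trace, map_sum, Matrix.trace_mul_comm]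
  rfl

end Resolvent

/-! ### The trace formula -/

section TraceFormula

variable {N : ℕ} [NeZero N] [Fact N.Prime]

theorem indexFactor_mul : indexFactor K₁ N * ((N / 2 : ℕ) : K₁) = 1 := by
  have hp : N.Prime := Fact.out
  rw [indexFactor]
  split_ifs with h
  · subst h
    norm_num
  · obtain ⟨m, rfl⟩ := hp.odd_of_ne_two h
    have hm : (2 * m + 1) / 2 = m := by omega
    have h0 : (m : K₁) ≠ 0 := Nat.cast_ne_zero.2 (by rintro rfl; exact hp.ne_one rfl)
    rw [hm]
    push_cast
    rw [add_sub_cancel_right]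
    field_simp

theorem map_polyToField_eq {F : MvPowerSeries (Fin 2) (MvPolynomial (Fin 2) ℂ)}
    (hF : IsHeckeGeneratingFunction N F) : MvPowerSeries.map polyToField F =
      MvPowerSeries.C (1 / (N : K₁) * indexFactor K₁ N) *
        traceSeries (aMatrix (algebraMap R₁ K₁ aR) (algebraMap R₁ K₁ bR) N)
          (bMatrix (algebraMap R₁ K₁ aR) (algebraMap R₁ K₁ bR) N) := by
  ext m
  have hN : (N : K₁) ≠ 0 := Nat.cast_ne_zero.2 (NeZero.ne N)
  rw [MvPowerSeries.coeff_map, MvPowerSeries.coeff_C_mul, coeff_traceSeries, trace_leftMulMatrix hF]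
  calc polyToField (MvPowerSeries.coeff m F)
      = (indexFactor K₁ N * ((N / 2 : ℕ) : K₁)) * ((N : K₁)⁻¹ * N) *
          polyToField (MvPowerSeries.coeff m F) := by
        rw [indexFactor_mul, inv_mul_cancel₀ hN, one_mul, one_mul]
    _ = _ := by ring

end TraceFormula

/-! ### Rationality of the generating function -/

section BaseChange

variable {k k' : Type*} [Field k] [Field k'] (φ : k →+* k') (a b : k) (N : ℕ)

theorem map_torsionPoly : (torsionPoly a b N).map φ = torsionPoly (φ a) (φ b) N :=
  map_ringTorsionPoly _ _ _ _

theorem map_curve : (curve a b).map φ = curve (φ a) (φ b) := by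
  simp [curve, WeierstrassCurve.map]

theorem map_matrix_inv {ι : Type*} [Fintype ι] [DecidableEq ι] (M : Matrix ι ι k) :
    φ.mapMatrix M⁻¹ = (φ.mapMatrix M)⁻¹ := by
  rw [Matrix.inv_def, Matrix.inv_def, Ring.inverse_eq_inv', Ring.inverse_eq_inv',
    ← RingHom.map_det, ← RingHom.map_adjugate, ← map_inv₀]
  ext i j
  simp

theorem map_matrix_smul {ι : Type*} [Fintype ι] [DecidableEq ι] (c : k) (M : Matrix ι ι k) :
    φ.mapMatrix (c • M) = φ c • φ.mapMatrix M := by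
  ext i j
  simp

theorem map_matrix_aeval {ι : Type*} [Fintype ι] [DecidableEq ι] (M : Matrix ι ι k)
    (p : Polynomial k) : φ.mapMatrix (Polynomial.aeval M p) =
      Polynomial.aeval (φ.mapMatrix M) (p.map φ) := by
  induction p using Polynomial.induction_on' with
  | add p q hp hq => rw [map_add, map_add, hp, hq, Polynomial.map_add, map_add]
  | monomial n c =>
    rw [Polynomial.map_monomial, Polynomial.aeval_monomial, Polynomial.aeval_monomial, map_mul,
      map_pow, Algebra.algebraMap_eq_smul_one, Algebra.algebraMap_eq_smul_one, map_matrix_smul,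
      map_one]

theorem map_xMatrix : φ.mapMatrix (xMatrix a b N) = xMatrix (φ a) (φ b) N := by
  ext i j
  rw [RingHom.mapMatrix_apply, Matrix.map_apply, xMatrix, xMatrix, ← map_torsionPoly,
    Polynomial.coeff_map, Polynomial.coeff_map]
  split_ifs <;> simp

theorem map_xMulMatrix (l : ℕ) :
    φ.mapMatrix (xMulMatrix a b N l) = xMulMatrix (φ a) (φ b) N l := by
  rw [xMulMatrix, xMulMatrix, map_mul, map_matrix_inv, map_matrix_aeval, map_matrix_aeval,
    map_xMatrix, ← map_curve, WeierstrassCurve.map_Φ, WeierstrassCurve.map_ΨSq]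

theorem map_aMatrix : φ.mapMatrix (aMatrix a b N) = aMatrix (φ a) (φ b) N := by
  rw [aMatrix, aMatrix]
  split_ifs <;> simp only [map_sub, map_sum, map_pow, map_matrix_smul, map_one, map_xMatrix,
    map_xMulMatrix, map_mul, map_neg, map_natCast, map_ofNat]

theorem map_bMatrix : φ.mapMatrix (bMatrix a b N) = bMatrix (φ a) (φ b) N := by
  rw [bMatrix, bMatrix]
  split_ifs <;> simp only [map_sub, map_add, map_sum, map_pow, map_matrix_smul, map_one,
    map_xMatrix, map_xMulMatrix, map_mul, map_natCast, map_ofNat]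

end BaseChange

section Rationality

/-- `ℚ[a, b]` as a subring of `𝒦`. -/
def ratToField : MvPolynomial (Fin 2) ℚ →+* K₁ :=
  polyToField.comp (MvPolynomial.map (algebraMap ℚ ℂ))

theorem ratToField_injective : Function.Injective ratToField := by
  rw [ratToField, RingHom.coe_comp]
  exact polyToField_injective.comp (MvPolynomial.map_injective _ (algebraMap ℚ ℂ).injective)

theorem ratToField_X_zero : ratToField (MvPolynomial.X 0) = algebraMap R₁ K₁ aR := by
  simp [ratToField, polyToField]

theorem ratToField_X_one : ratToField (MvPolynomial.X 1) = algebraMap R₁ K₁ bR := by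
  simp [ratToField, polyToField]

/-- A matrix over `𝒦` whose entries are rational expressions in `a`, `b` has a common denominator
in `ℚ[a, b]`. -/
theorem exists_denominator (N : ℕ) : ∃ (D : MvPolynomial (Fin 2) ℚ)
    (S T : Matrix (Fin (torsionDegree N)) (Fin (torsionDegree N)) (MvPolynomial (Fin 2) ℚ)),
    D ≠ 0 ∧
    ratToField.mapMatrix S =
      ratToField D • aMatrix (algebraMap R₁ K₁ aR) (algebraMap R₁ K₁ bR) N ∧
    ratToField.mapMatrix T =
      ratToField D • bMatrix (algebraMap R₁ K₁ aR) (algebraMap R₁ K₁ bR) N := by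
  let A := MvPolynomial (Fin 2) ℚ
  let k := FractionRing A
  let φ : k →+* K₁ := IsFractionRing.lift ratToField_injective
  have hφ : ∀ r : A, φ (algebraMap A k r) = ratToField r :=
    IsFractionRing.lift_algebraMap ratToField_injective
  let S₀ := aMatrix (algebraMap A k (MvPolynomial.X 0)) (algebraMap A k (MvPolynomial.X 1)) N
  let T₀ := bMatrix (algebraMap A k (MvPolynomial.X 0)) (algebraMap A k (MvPolynomial.X 1)) N
  obtain ⟨D, hD⟩ := IsLocalization.exist_integer_multiples_of_finite (nonZeroDivisors A)
    (fun p : Bool × Fin (torsionDegree N) × Fin (torsionDegree N) =>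
      if p.1 then S₀ p.2.1 p.2.2 else T₀ p.2.1 p.2.2)
  choose f hf using hD
  refine ⟨D, Matrix.of fun i j => f (true, i, j), Matrix.of fun i j => f (false, i, j),
    nonZeroDivisors.ne_zero D.2, ?_, ?_⟩
  · rw [← ratToField_X_zero, ← ratToField_X_one, ← hφ, ← hφ, ← hφ, ← map_aMatrix]
    ext i j
    have := congrArg φ (hf (true, i, j))
    rw [hφ, if_pos rfl, Algebra.smul_def, map_mul] at this
    exact this
  · rw [← ratToField_X_zero, ← ratToField_X_one, ← hφ, ← hφ, ← hφ, ← map_bMatrix]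
    ext i j
    have := congrArg φ (hf (false, i, j))
    rw [hφ, if_neg (by simp), Algebra.smul_def, map_mul] at this
    exact this

/-- The inclusion of `ℚ[a, b]` in `ℚ[a, b, A, B]`. -/
def ratIncl : MvPolynomial (Fin 2) ℚ →+* MvPolynomial (Fin 4) ℚ :=
  (MvPolynomial.rename ![0, 1]).toRingHom

/-- `ℚ[a, b, A, B]` as a subring of `𝒦[[A, B]]`. -/
def ratToSeries : MvPolynomial (Fin 4) ℚ →+* MvPowerSeries (Fin 2) K₁ :=
  (MvPowerSeries.map polyToField).comp polyToSeries.toRingHom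

theorem ratToSeries_ratIncl (r : MvPolynomial (Fin 2) ℚ) :
    ratToSeries (ratIncl r) = MvPowerSeries.C (ratToField r) := by
  have : ratToSeries.comp ratIncl = (MvPowerSeries.C (σ := Fin 2)).comp ratToField := by
    apply MvPolynomial.ringHom_ext
    · intro c
      exact DFunLike.congr_fun (RingHom.ext_rat ((ratToSeries.comp ratIncl).comp MvPolynomial.C)
        (((MvPowerSeries.C (σ := Fin 2)).comp ratToField).comp MvPolynomial.C)) c
    · intro i
      fin_cases i <;> simp [ratToSeries, ratIncl, polyToSeries, ratToField]
  exact DFunLike.congr_fun this r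

theorem ratToSeries_X_two : ratToSeries (MvPolynomial.X 2) = MvPowerSeries.X 0 := by
  simp [ratToSeries, polyToSeries]

theorem ratToSeries_X_three : ratToSeries (MvPolynomial.X 3) = MvPowerSeries.X 1 := by
  simp [ratToSeries, polyToSeries]

theorem ratToSeries_oneSub {ι : Type*} [Fintype ι] [DecidableEq ι] {D : MvPolynomial (Fin 2) ℚ}
    {S : Matrix ι ι (MvPolynomial (Fin 2) ℚ)} {S' : Matrix ι ι K₁}
    (h : ratToField.mapMatrix S = ratToField D • S') {s : Fin 2} {t : Fin 4}
    (ht : ratToSeries (MvPolynomial.X t) = MvPowerSeries.X s) :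
    ratToSeries.mapMatrix (ratIncl D • (1 : Matrix ι ι (MvPolynomial (Fin 4) ℚ)) -
      (MvPolynomial.X t : MvPolynomial (Fin 4) ℚ) • ratIncl.mapMatrix S) =
      (MvPowerSeries.C (ratToField D) : MvPowerSeries (Fin 2) K₁) • oneSubMatrix s S' := by
  ext1 i j
  have hij : ratToField (S i j) = ratToField D * S' i j := congrFun (congrFun h i) j
  simp only [oneSubMatrix, RingHom.mapMatrix_apply, Matrix.map_apply, Matrix.sub_apply,
    Matrix.smul_apply, smul_eq_mul, map_sub, map_mul, ratToSeries_ratIncl, ht, hij,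
    Matrix.one_apply]
  rw [apply_ite ratToSeries, map_one, map_zero]
  ring

/-- With denominators cleared, the trace of the resolvent is a rational function by
Cramer's rule. -/
theorem exists_rational {N : ℕ} [NeZero N] [Fact N.Prime]
    {F : MvPowerSeries (Fin 2) (MvPolynomial (Fin 2) ℂ)} (hF : IsHeckeGeneratingFunction N F) :
    ∃ P Q : MvPolynomial (Fin 4) ℚ, Q ≠ 0 ∧ polyToSeries Q * F = polyToSeries P := by
  obtain ⟨D, S, T, hD, hS, hT⟩ := exists_denominator N
  set S' := aMatrix (algebraMap R₁ K₁ aR) (algebraMap R₁ K₁ bR) N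
  set T' := bMatrix (algebraMap R₁ K₁ aR) (algebraMap R₁ K₁ bR) N
  set δ : MvPowerSeries (Fin 2) K₁ := MvPowerSeries.C (ratToField D) with hδ
  set Y : Matrix _ _ (MvPowerSeries (Fin 2) K₁) := oneSubMatrix 0 S' * oneSubMatrix 1 T' with hY
  -- `Z` is `D² (I - A S) (I - B T)`, with the denominators cleared
  set Z := (ratIncl D • (1 : Matrix _ _ (MvPolynomial (Fin 4) ℚ)) -
      (MvPolynomial.X 2 : MvPolynomial (Fin 4) ℚ) • ratIncl.mapMatrix S) *
    (ratIncl D • (1 : Matrix _ _ (MvPolynomial (Fin 4) ℚ)) -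
      (MvPolynomial.X 3 : MvPolynomial (Fin 4) ℚ) • ratIncl.mapMatrix T) with hZ
  have hZY : ratToSeries.mapMatrix Z = (δ * δ) • Y := by
    rw [hZ, map_mul, ratToSeries_oneSub hS ratToSeries_X_two,
      ratToSeries_oneSub hT ratToSeries_X_three, smul_mul_smul_comm]
  have hdet : IsUnit Y.det := by
    rw [← Matrix.isUnit_iff_isUnit_det]
    exact IsUnit.of_mul_eq_one _ (oneSub_mul_oneSub_mul S' T')
  have hinj : Function.Injective (MvPowerSeries.map (σ := Fin 2) polyToField) := fun f g h => by
    ext1 m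
    apply polyToField_injective
    rw [← MvPowerSeries.coeff_map, ← MvPowerSeries.coeff_map, h]
  have hadj : ratToSeries Z.det • Y⁻¹ = (δ * δ) • ratToSeries.mapMatrix Z.adjugate := by
    have h1 := congrArg ratToSeries.mapMatrix (Matrix.mul_adjugate Z)
    rw [map_mul, hZY, smul_mul_assoc] at h1
    have h2 : ratToSeries.mapMatrix (Z.det • (1 : Matrix (Fin (torsionDegree N))
        (Fin (torsionDegree N)) (MvPolynomial (Fin 4) ℚ))) =
        ratToSeries Z.det • 1 := by
      ext1 i j
      simp [Matrix.one_apply, apply_ite ratToSeries]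
    rw [h2] at h1
    have h3 := congrArg (Y⁻¹ * ·) h1
    simp only [mul_smul_comm, ← mul_assoc, Matrix.nonsing_inv_mul _ hdet, one_mul, mul_one] at h3
    exact h3.symm
  have htr : ratToSeries Z.det * traceSeries S' T' =
      ratToSeries (ratIncl D * ratIncl D * Z.adjugate.trace) := by
    have h1 := congrArg Matrix.trace hadj
    rw [Matrix.trace_smul, Matrix.trace_smul, smul_eq_mul, smul_eq_mul] at h1
    rw [map_mul, map_mul, ratToSeries_ratIncl, ← hδ]
    refine h1.trans ?_
    congr 1
    rw [Matrix.trace, Matrix.trace, map_sum]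
    rfl
  have hn : ((N * (N / 2) : ℕ) : K₁) * (1 / (N : K₁) * indexFactor K₁ N) = 1 := by
    have hN : (N : K₁) ≠ 0 := Nat.cast_ne_zero.2 (NeZero.ne N)
    calc _ = ((N : K₁) * (N : K₁)⁻¹) * (indexFactor K₁ N * ((N / 2 : ℕ) : K₁)) := by
          push_cast
          ring
      _ = 1 := by rw [indexFactor_mul, mul_inv_cancel₀ hN, one_mul]
  refine ⟨ratIncl D * ratIncl D * Z.adjugate.trace, (N * (N / 2) : ℕ) * Z.det, ?_, hinj ?_⟩
  · intro h
    have h1 : ratToSeries Z.det = 0 := by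
      have hne : ((N * (N / 2) : ℕ) : MvPolynomial (Fin 4) ℚ) ≠ 0 := by
        rw [Nat.cast_ne_zero]
        rintro h0
        rw [h0, Nat.cast_zero, zero_mul] at hn
        exact zero_ne_one hn
      rw [(mul_eq_zero.1 h).resolve_left hne, map_zero]
    rw [RingHom.map_det, hZY, Matrix.det_smul] at h1
    have hδ0 : δ ≠ 0 := by
      rw [hδ, map_ne_zero_iff _ MvPowerSeries.C_injective]
      exact (map_ne_zero_iff _ ratToField_injective).2 hD
    exact mul_ne_zero (pow_ne_zero _ (mul_ne_zero hδ0 hδ0)) hdet.ne_zero h1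
  · rw [map_mul, map_polyToField_eq hF]
    change ratToSeries _ * _ = ratToSeries _
    rw [← htr, map_mul, map_natCast, ← map_natCast (MvPowerSeries.C (σ := Fin 2) (R := K₁)),
      mul_mul_mul_comm, ← map_mul, hn, map_one, one_mul]

end Rationality

end HeckeGF

end

open HeckeGF in
theorem theorem4p3 (N : ℕ) (hN : N.Prime) :
    ∃ F : MvPowerSeries (Fin 2) (MvPolynomial (Fin 2) ℂ),
      -- `F` is the generating function of `T_N`, and the only series with this property
      IsHeckeGeneratingFunction N F ∧
      (∀ G, IsHeckeGeneratingFunction N G → G = F) ∧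
      -- `F` is a rational function in `ℚ(a, b, A, B)`
      (∃ P Q : MvPolynomial (Fin 4) ℚ, Q ≠ 0 ∧ polyToSeries Q * F = polyToSeries P) ∧
      -- `x_P`, `a'`, `b'` belong to `ℛ_{Γ_±(N)}`, and the powers of `x_P` are a basis over `𝒦`
      ∃ (x a' b' : RPM N) (β : Module.Basis (Fin (torsionDegree N)) K₁ (KPM N)),
        (x : UpperHalfPlane → ℂ) = xP N ∧
        (a' : UpperHalfPlane → ℂ) = primed N 4 aForm ∧
        (b' : UpperHalfPlane → ℂ) = primed N 6 bForm ∧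
        (∀ i, β i = algebraMap (RPM N) (KPM N) x ^ (i : ℕ)) ∧
        -- explicit matrices of the regular representation in this basis
        Algebra.leftMulMatrix β (algebraMap (RPM N) (KPM N) x) =
          xMatrix (algebraMap R₁ K₁ aR) (algebraMap R₁ K₁ bR) N ∧
        Algebra.leftMulMatrix β (algebraMap (RPM N) (KPM N) a') =
          aMatrix (algebraMap R₁ K₁ aR) (algebraMap R₁ K₁ bR) N ∧
        Algebra.leftMulMatrix β (algebraMap (RPM N) (KPM N) b') =
          bMatrix (algebraMap R₁ K₁ aR) (algebraMap R₁ K₁ bR) N ∧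
        -- the trace formula
        MvPowerSeries.map polyToField F =
          MvPowerSeries.C (1 / (N : K₁) * indexFactor K₁ N) *
            traceSeries (Algebra.leftMulMatrix β (algebraMap (RPM N) (KPM N) a'))
              (Algebra.leftMulMatrix β (algebraMap (RPM N) (KPM N) b')) := by
  have : Fact N.Prime := ⟨hN⟩
  have : NeZero N := ⟨hN.ne_zero⟩
  obtain ⟨F, hF⟩ := exists_isHeckeGeneratingFunction (N := N)
  refine ⟨F, hF, fun G hG => hF.unique hG, exists_rational hF, xRing N, aPrime N, bPrime N,
    powBasis N, xP_eq_torsionX.symm, rfl, rfl, powBasis_apply, leftMulMatrix_xField,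
    leftMulMatrix_aPrime, leftMulMatrix_bPrime, ?_⟩
  rw [leftMulMatrix_aPrime, leftMulMatrix_bPrime]
  exact map_polyToField_eq hF
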